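/- All graphs are finite and connected, with loops and multiple edges allowed. A metric graph $\Gamma$ is obtained from a graph $G$ with a length function $l:E(G)\to\mathbb{R}_{>0}$ by gluing the intervals $[0,l(e)]$, $e\in E(G)$, at their endpoints as prescribed by $G$; then $(G,l)$ is called a model of $\Gamma$. The valence of a point is the number of directions emanating from it. Let $\Gamma$ be a metric graph that is not a single point, is not homeomorphic to a circle, and has no points of valence $1$. The canonical model of $\Gamma$ has as vertices the points of valence $\neq 2$; the canonical loopless model $(G,l)$ is obtained from it by adding a vertex at the midpoint of each loop edge. A divisor on $\Gamma$ is a finite formal $\mathbb{Z}$-combination $D=\sum_x D(x)\,x$ of points; its degree is $\sum_x D(x)$, and $D\ge 0$ means that all $D(x)\ge 0$. A rational function is a continuous piecewise linear function $f:\Gamma\to\mathbb{R}$ with finitely many pieces and integer slopes, and $(\operatorname{div} f)(x)$ is the sum of its outgoing slopes at $x$; $D\sim D'$ means that $D-D'=\operatorname{div} f$ for some $f$. The rank of $D$ is the greatest integer $k$ such that for every $E\ge 0$ of degree $k$ there is $E'\ge 0$ with $D-E\sim E'$. $\Gamma$ is hyperelliptic if it has a divisor of degree $2$ and rank $1$.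 An involution of $(G,l)$ is an automorphism $i$ of the graph $G$ that preserves $l$ and satisfies $i^2=\mathrm{id}$. The vertices of $G/i$ are the orbits of vertices of $G$ under the group generated by $i$, and its edges are the orbits of those edges of $G$ whose two ends lie in different orbits. A morphism $\phi:(G,l)\to(G',l')$ of loopless models is a map $V(G)\cup E(G)\to V(G')\cup E(G')$ sending vertices to vertices such that an edge $e=xy$ is sent either to the vertex $\phi(x)=\phi(y)$, or to an edge $e'$ between $\phi(x)$ and $\phi(y)$ for which $\mu_\phi(e)=l'(e')/l(e)$ is an integer. It is harmonic if for each $x\in V(G)$ the number $m_\phi(x)=\sum_{e\ni x,\ \phi(e)=e'}\mu_\phi(e)$ is the same for all edges $e'$ of $G'$ incident to $\phi(x)$ (with $m_\phi(x)=0$ if there are none); it is nondegenerate if $m_\phi(x)>0$ for all $x\in V(G)$. Its degree is $\sum_{\phi(e)=e'}\mu_\phi(e)$, which does not depend on the edge $e'$ of $G'$, and is $0$ if $G'$ has no edges. Then the following are equivalent: (i) $\Gamma$ is hyperelliptic; (ii) there is an involution $i$ of $(G,l)$ such that $G/i$ is a tree; (iii) there is a nondegenerate harmonic morphism of degree $2$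 from $(G,l)$ to a tree $(T,l')$ (with some length function $l'$), or $|V(G)|=2$. -/

import Mathlib

universe u

/-- A finite graph, loops and multiple edges allowed, with a positive length on every edge.
The edge `e` joins `src e` and `tgt e`; the order of the two ends is only a reference orientation,
used to parametrize the edge by `[0, len e]`. -/
structure LengthGraph where
  V : Type u
  E : Type u
  [fintypeV : Fintype V]
  [fintypeE : Fintype E]
  src : E → V
  tgt : E → V
  len : E → ℝ
  len_pos : ∀ e, 0 < len e

namespace LengthGraph

attribute [instance] LengthGraph.fintypeV LengthGraph.fintypeE

/-- The edge `e` is incident to the vertex `v`. -/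
def Incident (G : LengthGraph.{u}) (e : G.E) (v : G.V) : Prop := G.src e = v ∨ G.tgt e = v

/-- The two ends of `e` are `v` and `w`, in some order. -/
def Joins (G : LengthGraph.{u}) (e : G.E) (v w : G.V) : Prop :=
  s(G.src e, G.tgt e) = s(v, w)

/-- The simple graph on the vertices of `G` in which distinct vertices are adjacent when some edge
of `G` joins them. -/
def toSimple (G : LengthGraph.{u}) : SimpleGraph G.V where
  Adj v w := v ≠ w ∧ ∃ e, G.Joins e v w
  symm := ⟨fun _ _ h => ⟨h.1.symm, h.2.imp fun _ he => he.trans Sym2.eq_swap⟩⟩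
  loopless := ⟨fun _ h => h.1 rfl⟩

def Connected (G : LengthGraph.{u}) : Prop := G.toSimple.Connected

def Loopless (G : LengthGraph.{u}) : Prop := ∀ e, G.src e ≠ G.tgt e

/-- `G` is a tree: no loops, no multiple edges, and a tree as a simple graph. -/
def IsTree (G : LengthGraph.{u}) : Prop :=
  G.Loopless ∧ Function.Injective (fun e => s(G.src e, G.tgt e)) ∧ G.toSimple.IsTree

/-! ### The metric graph obtained by gluing the intervals `[0, len e]` -/

/-- The points of the metric graph with model `G`: the vertices, and the points of the open
edges `(0, len e)`. -/
inductive Point (G : LengthGraph.{u}) : Type u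
  | vertex (v : G.V) : Point G
  | interior (e : G.E) (t : ℝ) (h₀ : 0 < t) (h₁ : t < G.len e) : Point G

open Classical in
/-- The parametrization of the closed edge `e` by `[0, len e]`, extended by constants to `ℝ`. -/
noncomputable def pt (G : LengthGraph.{u}) (e : G.E) (t : ℝ) : G.Point :=
  if h₀ : 0 < t then
    if h₁ : t < G.len e then Point.interior e t h₀ h₁ else Point.vertex (G.tgt e)
  else Point.vertex (G.src e)

/-- The gluing topology: a set is open when its preimage in every closed edge is open. -/
noncomputable instance (G : LengthGraph.{u}) : TopologicalSpace G.Point :=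
  ⨆ e : G.E, TopologicalSpace.coinduced (fun t : Set.Icc (0 : ℝ) (G.len e) => G.pt e t)
    inferInstance

open Classical in
/-- The valence of a point: the number of directions (germs of segments) emanating from it. A loop
contributes twice at its vertex. -/
noncomputable def val (G : LengthGraph.{u}) : G.Point → ℕ
  | Point.vertex v =>
      (Finset.univ.filter fun e => G.src e = v).card +
        (Finset.univ.filter fun e => G.tgt e = v).card
  | Point.interior _ _ _ _ => 2

/-- `G` is the canonical loopless model of its metric graph: there are no loops, and every vertex
either has valence different from `2`, or is the midpoint of a loop edge of the canonical model,
that is, the loop is based at a point `w` of valence different from `2` and is divided by the vertex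
into two halves `e₁`, `e₂` of the same length. (Points of valence different from `2` are always
vertices, and a circle has no such model.) -/
structure IsCanonicalLoopless (G : LengthGraph.{u}) : Prop where
  loopless : G.Loopless
  midpoint : ∀ v : G.V, G.val (Point.vertex v) = 2 →
    ∃ w : G.V, G.val (Point.vertex w) ≠ 2 ∧
      ∃ e₁ e₂ : G.E, e₁ ≠ e₂ ∧ G.Joins e₁ v w ∧ G.Joins e₂ v w ∧ G.len e₁ = G.len e₂

/-! ### Divisors and rational functions on the metric graph -/

/-- Rational functions: continuous, and on every edge piecewise linear with finitely many pieces
and integer slopes. -/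
def IsRational (G : LengthGraph.{u}) (f : G.Point → ℝ) : Prop :=
  Continuous f ∧ ∀ e : G.E, ∃ (n : ℕ) (b : ℕ → ℝ), b 0 = 0 ∧ b n = G.len e ∧
    (∀ i < n, b i ≤ b (i + 1)) ∧
    ∀ i < n, ∃ m : ℤ, ∀ t ∈ Set.Icc (b i) (b (i + 1)),
      f (G.pt e t) = f (G.pt e (b i)) + m * (t - b i)

/-- The outgoing slope of `f` at the parameter `t` of `e`, towards the target of `e`. -/
noncomputable def slopeFwd (G : LengthGraph.{u}) (f : G.Point → ℝ) (e : G.E) (t : ℝ) : ℝ :=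
  derivWithin (fun s => f (G.pt e s)) (Set.Ici t) t

/-- The outgoing slope of `f` at the parameter `t` of `e`, towards the source of `e`. -/
noncomputable def slopeBwd (G : LengthGraph.{u}) (f : G.Point → ℝ) (e : G.E) (t : ℝ) : ℝ :=
  -derivWithin (fun s => f (G.pt e s)) (Set.Iic t) t

open Classical in
/-- The sum of the outgoing slopes of `f` at a point. -/
noncomputable def divFun (G : LengthGraph.{u}) (f : G.Point → ℝ) : G.Point → ℝ
  | Point.vertex v =>
      (∑ e ∈ Finset.univ.filter (fun e => G.src e = v), G.slopeFwd f e 0) +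
        ∑ e ∈ Finset.univ.filter (fun e => G.tgt e = v), G.slopeBwd f e (G.len e)
  | Point.interior e t _ _ => G.slopeFwd f e t + G.slopeBwd f e t

/-- Divisors: formal integral combinations of points. -/
abbrev Divisor (G : LengthGraph.{u}) : Type u := G.Point →₀ ℤ

def Divisor.deg {G : LengthGraph.{u}} (D : G.Divisor) : ℤ := D.sum fun _ n => n

/-- `D` is the divisor of a rational function. -/
def Divisor.IsPrincipal {G : LengthGraph.{u}} (D : G.Divisor) : Prop :=
  ∃ f : G.Point → ℝ, G.IsRational f ∧ ∀ x, (D x : ℝ) = G.divFun f x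

/-- `D` has rank `r`: `r` is the greatest integer `k` such that for all effective `F` of degree `k`
the divisor `D - F` is linearly equivalent to an effective divisor `F'`. -/
def Divisor.HasRank {G : LengthGraph.{u}} (D : G.Divisor) (r : ℤ) : Prop :=
  IsGreatest {k : ℤ | ∀ F : G.Divisor, 0 ≤ F → Divisor.deg F = k →
    ∃ F' : G.Divisor, 0 ≤ F' ∧ Divisor.IsPrincipal (D - F - F')} r

/-- The metric graph with model `G` is hyperelliptic. -/
def IsHyperelliptic (G : LengthGraph.{u}) : Prop :=
  ∃ D : G.Divisor, Divisor.deg D = 2 ∧ Divisor.HasRank D 1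

/-! ### Automorphisms and quotients -/

/-- The automorphisms of `G`: permutations of the vertices and of the edges that preserve incidence
and lengths. -/
def Aut (G : LengthGraph.{u}) : Subgroup (Equiv.Perm G.V × Equiv.Perm G.E) where
  carrier := {p | ∀ e, G.Joins (p.2 e) (p.1 (G.src e)) (p.1 (G.tgt e)) ∧ G.len (p.2 e) = G.len e}
  one_mem' := fun _ => ⟨rfl, rfl⟩
  mul_mem' := by
    intro p q hp hq e
    refine ⟨?_, (hp _).2.trans (hq e).2⟩
    have h1 := (hp (q.2 e)).1
    have h2 := congrArg (Sym2.map p.1) (hq e).1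
    exact h1.trans h2
  inv_mem' := by
    intro p hp e
    have h := hp (p.2⁻¹ e)
    rw [show p.2 (p.2⁻¹ e) = e from p.2.apply_symm_apply e] at h
    refine ⟨?_, h.2.symm⟩
    have h1 := congrArg (Sym2.map (p.1⁻¹ : Equiv.Perm G.V)) h.1
    have h2 : ∀ v, p.1⁻¹ (p.1 v) = v := p.1.symm_apply_apply
    simp only [Sym2.map_mk, h2] at h1
    exact h1.symm

instance (G : LengthGraph.{u}) : MulAction G.Aut G.V where
  smul p v := p.1.1 v
  one_smul _ := rfl
  mul_smul _ _ _ := rfl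

instance (G : LengthGraph.{u}) : MulAction G.Aut G.E where
  smul p e := p.1.2 e
  one_smul _ := rfl
  mul_smul _ _ _ := rfl

/-- The edges of `G` whose two ends lie in distinct `K`-orbits. -/
def SurvivingEdge (G : LengthGraph.{u}) (K : Subgroup G.Aut) : Type u :=
  {e : G.E // ¬ MulAction.orbitRel K G.V (G.src e) (G.tgt e)}

/-- The edges of the quotient: the `K`-orbits of the edges with inequivalent ends. -/
def QuotientEdge (G : LengthGraph.{u}) (K : Subgroup G.Aut) : Type u :=
  Quotient ((MulAction.orbitRel K G.E).comap
    (Subtype.val : G.SurvivingEdge K → G.E))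

/-- A representative of an orbit of edges. -/
noncomputable def QuotientEdge.rep {G : LengthGraph.{u}} {K : Subgroup G.Aut}
    (q : G.QuotientEdge K) : G.E :=
  (Quotient.out q : G.SurvivingEdge K).1

/-- The quotient `G / K`. Its vertices are the orbits of vertices, its edges the orbits of edges
with inequivalent ends, and the orbit of `e` has length `len e * |Stab e|`. The ends and
the length of an orbit do not depend on the representative. -/
noncomputable def quotient (G : LengthGraph.{u}) (K : Subgroup G.Aut) : LengthGraph.{u} where
  V := MulAction.orbitRel.Quotient K G.V
  E := G.QuotientEdge K
  fintypeV := @Fintype.ofFinite _ (inferInstanceAs (Finite (Quotient _)))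
  fintypeE :=
    haveI : Finite (G.SurvivingEdge K) := Subtype.finite
    @Fintype.ofFinite _ (inferInstanceAs (Finite (Quotient _)))
  src q := Quotient.mk _ (G.src q.rep)
  tgt q := Quotient.mk _ (G.tgt q.rep)
  len q := G.len q.rep * Nat.card (MulAction.stabilizer K q.rep)
  len_pos _ := mul_pos (G.len_pos _) (Nat.cast_pos.mpr Nat.card_pos)

/-! ### Harmonic morphisms -/

/-- Morphisms of loopless models: vertices go to vertices, an edge either is collapsed to a vertex
(vertical) or goes to an edge (horizontal), compatibly with the ends, and in the second case the
ratio of the lengths is an integer. -/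
structure Morphism (G G' : LengthGraph.{u}) where
  onV : G.V → G'.V
  onE : G.E → G'.V ⊕ G'.E
  vertical : ∀ e v', onE e = Sum.inl v' → onV (G.src e) = v' ∧ onV (G.tgt e) = v'
  horizontal : ∀ e e', onE e = Sum.inr e' → G'.Joins e' (onV (G.src e)) (onV (G.tgt e))
  integral : ∀ e e', onE e = Sum.inr e' → ∃ n : ℤ, G'.len e' / G.len e = n

namespace Morphism

variable {G G' : LengthGraph.{u}} (φ : Morphism G G')

open Classical in
/-- The sum of the slopes `len e' / len e` over the edges `e` at `x` that go to `e'`. -/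
noncomputable def mult (x : G.V) (e' : G'.E) : ℝ :=
  ∑ e ∈ Finset.univ.filter (fun e => G.Incident e x ∧ φ.onE e = Sum.inr e'), G'.len e' / G.len e

/-- Harmonic: at each vertex `x`, the sum above is the same for all edges `e'` at the image
of `x`. The common value is the horizontal multiplicity of `x`. -/
def IsHarmonic : Prop :=
  ∀ (x : G.V) (e' e'' : G'.E), G'.Incident e' (φ.onV x) → G'.Incident e'' (φ.onV x) →
    φ.mult x e' = φ.mult x e''

/-- All horizontal multiplicities are positive (the multiplicity is `0` if there is no edge at the
image of `x`). -/
def IsNondegenerate : Prop :=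
  ∀ x : G.V, ∃ e' : G'.E, G'.Incident e' (φ.onV x) ∧ 0 < φ.mult x e'

open Classical in
/-- The degree is `d`: for every edge `e'` the slopes over `e'` add up to `d`; the degree is `0` if
the target has no edges. -/
def HasDegree (d : ℕ) : Prop :=
  (∀ e' : G'.E, ∑ e ∈ Finset.univ.filter (fun e => φ.onE e = Sum.inr e'),
    G'.len e' / G.len e = d) ∧ (IsEmpty G'.E → d = 0)

end Morphism

end LengthGraph

/-!
Only (i) ⇒ (ii) has real content; the other two implications are explicit constructions.

**The involution.** Let `D` have degree two and rank one, so that every point `x` has some `y` with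
`x + y ~ D` (`Moves`). Everything rests on truncation: if `div f = D₁ - D₂` with `D₁`, `D₂`
effective, then the divisor of `max f c` plus `D₂` is effective and equivalent to `D₂`, for every
level `c` (`PL.exists_level_divisor`). For two points this shows that a point equivalent to another
one is equivalent to the end of a bridge (`isBridge_of_linEquiv`,
`exists_isBridge_of_not_rigid`); restricting functions to one side of a bridge shows that
`2 x ~ D` for the ends `x` of bridges (`Moves.linEquiv_of_isBridge`). So a point with `2 x ≁ D` is
rigid, and `x ↦ y` is a well defined involution `partner` on the points. When `x` starts to move in
some direction, its partner starts to move in one direction, and different directions at `x` give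
different ones at the partner (`card_dirs_le`). Hence partners have the same valence, the midpoints
of loops are fixed (`fixed_of_val_eq_two`), and the involution acts on the vertices. For an edge
from `v` to `w` with `w ≠ v̄` the function with divisor `(w + w̄) - (v + v̄)` is nonconstant exactly on
this edge and on one edge of the same length from `v̄` to `w̄`, possibly the same one
(`exists_partner_dart`); this gives the involution on the edges.

**The quotient is a tree.** A connected graph is a tree if all its edges are bridges
(`isTree_iff`). If an edge `vw` of the quotient lay on a cycle, the functions of the other edges of
the cycle would add up to a function with divisor `(w + w̄) - (v + v̄)` that is constant on this edge,
whereas such a function is unique up to constants (`exists_aut_of_moves`).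

**From the involution to a morphism.** The involution is not the identity, because `G` is not a
tree. If the quotient has edges, the quotient map is harmonic, nondegenerate and of degree two
(`exists_morphism_of_aut`); otherwise there is a single orbit of vertices and `|V(G)| = 2`.

**From a morphism to a divisor.** The fibres of a morphism of degree two to a tree, counted with
multiplicities, are effective divisors of degree two. They are all equivalent, by functions pulled
back from the tree, and truncating these functions moves the divisor to every point of a horizontal
edge. The inner points of contracted edges are reached by a tent function
(`exists_effective_of_edge`), which also settles the case of two vertices.
-/

namespace LengthGraph

open Set Filter Topology

variable {G : LengthGraph.{u}}

/-! ### Oriented edges and directions -/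

/-- An oriented edge: `(e, true)` runs from `src e` to `tgt e` and `(e, false)` runs backwards. -/
abbrev Dart (G : LengthGraph.{u}) : Type u := G.E × Bool

/-- The vertex at which an oriented edge starts. -/
def tail (G : LengthGraph.{u}) (d : G.Dart) : G.V := if d.2 then G.src d.1 else G.tgt d.1

/-- The vertex at which an oriented edge ends. -/
def head (G : LengthGraph.{u}) (d : G.Dart) : G.V := if d.2 then G.tgt d.1 else G.src d.1

/-- The same edge with the opposite orientation. -/
def rev (G : LengthGraph.{u}) (d : G.Dart) : G.Dart := (d.1, !d.2)

/-- The point of an oriented edge at distance `s` from its tail. -/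
noncomputable def dpt (G : LengthGraph.{u}) (d : G.Dart) (s : ℝ) : G.Point :=
  G.pt d.1 (if d.2 then s else G.len d.1 - s)

@[simp] lemma rev_rev (d : G.Dart) : G.rev (G.rev d) = d := by simp [rev]

@[simp] lemma rev_fst (d : G.Dart) : (G.rev d).1 = d.1 := rfl

@[simp] lemma tail_rev (d : G.Dart) : G.tail (G.rev d) = G.head d := by
  rcases d with ⟨e, _ | _⟩ <;> rfl

@[simp] lemma head_rev (d : G.Dart) : G.head (G.rev d) = G.tail d := by
  rcases d with ⟨e, _ | _⟩ <;> rfl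

lemma rev_ne (d : G.Dart) : G.rev d ≠ d := by
  rcases d with ⟨e, _ | _⟩ <;> simp [rev]

lemma eq_or_eq_rev_of_fst_eq {d d' : G.Dart} (h : d.1 = d'.1) : d = d' ∨ d = G.rev d' := by
  rcases d with ⟨e, b⟩
  rcases d' with ⟨e', b'⟩
  obtain rfl : e = e' := h
  rcases b <;> rcases b' <;> simp [rev]

lemma dart_len_pos (d : G.Dart) : 0 < G.len d.1 := G.len_pos d.1

@[simp] lemma dpt_zero (d : G.Dart) : G.dpt d 0 = Point.vertex (G.tail d) := by
  rcases d with ⟨e, _ | _⟩ <;> simp [dpt, pt, tail, G.len_pos]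

@[simp] lemma dpt_len (d : G.Dart) : G.dpt d (G.len d.1) = Point.vertex (G.head d) := by
  rcases d with ⟨e, _ | _⟩ <;> simp [dpt, pt, head, G.len_pos]

lemma dpt_rev (d : G.Dart) (s : ℝ) : G.dpt (G.rev d) s = G.dpt d (G.len d.1 - s) := by
  rcases d with ⟨e, _ | _⟩ <;> simp [dpt, rev]

lemma dpt_true {e : G.E} {t : ℝ} (h₀ : 0 < t) (h₁ : t < G.len e) :
    G.dpt (e, true) t = Point.interior e t h₀ h₁ := by
  simp [dpt, pt, h₀, h₁]

lemma dpt_false {e : G.E} {t : ℝ} (h₀ : 0 < t) (h₁ : t < G.len e) :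
    G.dpt (e, false) (G.len e - t) = Point.interior e t h₀ h₁ := by
  simp [dpt, pt, h₀, h₁]

lemma dpt_false' {e : G.E} {t : ℝ} (h₀ : 0 < t) (h₁ : t < G.len e) :
    G.dpt (e, false) t = Point.interior e (G.len e - t) (by linarith) (by linarith) := by
  simp [dpt, pt, h₀, h₁]

lemma dpt_ne_vertex {d : G.Dart} {s : ℝ} (hs : s ∈ Ioo 0 (G.len d.1)) (v : G.V) :
    G.dpt d s ≠ Point.vertex v := by
  rcases d with ⟨e, _ | _⟩
  · rw [dpt_false' hs.1 hs.2]; simp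
  · rw [dpt_true hs.1 hs.2]; simp

/-- Interior points determine their edge. -/
lemma fst_eq_of_dpt_eq {d d' : G.Dart} {s s' : ℝ} (hs : s ∈ Ioo 0 (G.len d.1))
    (hs' : s' ∈ Icc 0 (G.len d'.1)) (h : G.dpt d s = G.dpt d' s') :
    d.1 = d'.1 ∧ s' ∈ Ioo 0 (G.len d'.1) := by
  have h0 : s' ≠ 0 := by
    rintro rfl
    rw [dpt_zero] at h
    exact dpt_ne_vertex hs _ h
  have h1 : s' ≠ G.len d'.1 := by
    rintro rfl
    rw [dpt_len] at h
    exact dpt_ne_vertex hs _ h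
  have hs'' : s' ∈ Ioo 0 (G.len d'.1) :=
    ⟨lt_of_le_of_ne hs'.1 h0.symm, lt_of_le_of_ne hs'.2 h1⟩
  refine ⟨?_, hs''⟩
  rcases d with ⟨e, _ | _⟩ <;> rcases d' with ⟨e', _ | _⟩ <;>
    simp only [dpt_false' hs.1 hs.2, dpt_false' hs''.1 hs''.2, dpt_true hs.1 hs.2,
      dpt_true hs''.1 hs''.2, Point.interior.injEq] at h <;> exact h.1

lemma dpt_injOn (d : G.Dart) {s s' : ℝ} (hs : s ∈ Ioo 0 (G.len d.1))
    (hs' : s' ∈ Ioo 0 (G.len d.1)) (h : G.dpt d s = G.dpt d s') : s = s' := by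
  rcases d with ⟨e, _ | _⟩ <;>
    simp only [dpt_false' hs.1 hs.2, dpt_false' hs'.1 hs'.2, dpt_true hs.1 hs.2,
      dpt_true hs'.1 hs'.2, Point.interior.injEq] at h
  · linarith [h.2]
  · exact h.2

open Classical in
/-- The directions emanating from a point: pairs `(d, s)` such that the point lies on the oriented
edge `d` at distance `s` from its tail and before its head. -/
noncomputable def dirs (G : LengthGraph.{u}) : G.Point → Finset (G.Dart × ℝ)
  | Point.vertex v => (Finset.univ.filter fun d : G.Dart => G.tail d = v).image fun d => (d, 0)
  | Point.interior e t _ _ => {((e, true), t), ((e, false), G.len e - t)}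

lemma mem_dirs {x : G.Point} {d : G.Dart} {s : ℝ} :
    (d, s) ∈ G.dirs x ↔ s ∈ Ico 0 (G.len d.1) ∧ G.dpt d s = x := by
  classical
  rcases x with v | ⟨e, t, h₀, h₁⟩
  · simp only [dirs, Finset.mem_image, Finset.mem_filter, Finset.mem_univ, true_and,
      Prod.mk.injEq]
    constructor
    · rintro ⟨d', rfl, rfl, rfl⟩
      exact ⟨⟨le_rfl, dart_len_pos _⟩, dpt_zero _⟩
    · rintro ⟨hs, h⟩
      have h0 : s = 0 := by
        by_contra h0
        exact dpt_ne_vertex ⟨lt_of_le_of_ne hs.1 (Ne.symm h0), hs.2⟩ _ h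
      subst h0
      rw [dpt_zero] at h
      exact ⟨d, by simpa using h, rfl, rfl⟩
  · simp only [dirs, Finset.mem_insert, Finset.mem_singleton, Prod.mk.injEq]
    constructor
    · rintro (⟨rfl, rfl⟩ | ⟨rfl, rfl⟩)
      · exact ⟨⟨h₀.le, h₁⟩, dpt_true h₀ h₁⟩
      · exact ⟨⟨sub_nonneg.2 h₁.le, sub_lt_self _ h₀⟩, dpt_false h₀ h₁⟩
    · rintro ⟨hs, h⟩
      have hs0 : 0 < s := by
        refine lt_of_le_of_ne hs.1 ?_
        rintro rfl
        rw [dpt_zero] at h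
        cases h
      rcases d with ⟨e', _ | _⟩
      · rw [dpt_false' hs0 hs.2] at h
        cases h
        exact Or.inr ⟨rfl, (sub_sub_cancel _ _).symm⟩
      · rw [dpt_true hs0 hs.2] at h
        cases h
        exact Or.inl ⟨rfl, rfl⟩

lemma mem_dirs_dpt {d : G.Dart} {s : ℝ} (hs : s ∈ Ico 0 (G.len d.1)) :
    (d, s) ∈ G.dirs (G.dpt d s) := mem_dirs.2 ⟨hs, rfl⟩

lemma mem_dirs_rev {d : G.Dart} {s : ℝ} (hs : s ∈ Ioc 0 (G.len d.1)) :
    (G.rev d, G.len d.1 - s) ∈ G.dirs (G.dpt d s) := by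
  refine mem_dirs.2 ⟨⟨by linarith [hs.2], by simp [hs.1]⟩, ?_⟩
  rw [dpt_rev]
  simp

lemma mem_dirs_tail (d : G.Dart) : (d, (0 : ℝ)) ∈ G.dirs (Point.vertex (G.tail d)) :=
  mem_dirs.2 ⟨⟨le_rfl, dart_len_pos d⟩, dpt_zero d⟩

lemma mem_dirs_vertex {v : G.V} {d : G.Dart} {s : ℝ} :
    (d, s) ∈ G.dirs (Point.vertex v) ↔ s = 0 ∧ G.tail d = v := by
  classical
  simp only [dirs, Finset.mem_image, Finset.mem_filter, Finset.mem_univ, true_and, Prod.mk.injEq]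
  constructor
  · rintro ⟨d', h, rfl, rfl⟩
    exact ⟨rfl, h⟩
  · rintro ⟨rfl, h⟩
    exact ⟨d, h, rfl, rfl⟩

/-- At an interior point there are two directions. -/
lemma sum_dirs_dpt {M : Type*} [AddCommMonoid M] (φ : G.Dart × ℝ → M) {d : G.Dart} {s : ℝ}
    (hs : s ∈ Ioo 0 (G.len d.1)) :
    ∑ p ∈ G.dirs (G.dpt d s), φ p = φ (d, s) + φ (G.rev d, G.len d.1 - s) := by
  classical
  rcases d with ⟨e, _ | _⟩
  · rw [dpt_false' hs.1 hs.2]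
    simp only [dirs, rev]
    rw [Finset.sum_pair (by simp), add_comm]
    simp
  · rw [dpt_true hs.1 hs.2]
    simp only [dirs, rev]
    rw [Finset.sum_pair (by simp)]
    simp

open Classical in
lemma sum_dirs_vertex {M : Type*} [AddCommMonoid M] (φ : G.Dart × ℝ → M) (v : G.V) :
    ∑ p ∈ G.dirs (Point.vertex v), φ p =
      ∑ d ∈ Finset.univ.filter (fun d : G.Dart => G.tail d = v), φ (d, 0) := by
  simp only [dirs]
  rw [Finset.sum_image]
  intro a _ b _ h
  exact (Prod.mk.inj h).1

open Classical in
lemma sum_filter_tail {M : Type*} [AddCommMonoid M] (φ : G.Dart → M) (v : G.V) :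
    ∑ d ∈ Finset.univ.filter (fun d : G.Dart => G.tail d = v), φ d =
      ∑ e ∈ Finset.univ.filter (fun e => G.src e = v), φ (e, true) +
        ∑ e ∈ Finset.univ.filter (fun e => G.tgt e = v), φ (e, false) := by
  rw [Finset.sum_filter, Finset.sum_filter, Finset.sum_filter, Fintype.sum_prod_type,
    ← Finset.sum_add_distrib]
  refine Finset.sum_congr rfl fun e _ => ?_
  rw [Fintype.sum_bool]
  rfl

lemma val_eq_card_dirs (x : G.Point) : G.val x = (G.dirs x).card := by
  classical
  rw [Finset.card_eq_sum_ones]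
  rcases x with v | ⟨e, t, h₀, h₁⟩
  · rw [sum_dirs_vertex, sum_filter_tail]
    simp [val]
  · rw [← dpt_true h₀ h₁, sum_dirs_dpt _ ⟨h₀, h₁⟩, dpt_true h₀ h₁]
    rfl

lemma vertex_or_dpt (x : G.Point) :
    (∃ v, x = Point.vertex v) ∨ ∃ d : G.Dart, ∃ s ∈ Ioo 0 (G.len d.1), x = G.dpt d s := by
  rcases x with v | ⟨e, t, h₀, h₁⟩
  · exact Or.inl ⟨v, rfl⟩
  · exact Or.inr ⟨(e, true), t, ⟨h₀, h₁⟩, (dpt_true h₀ h₁).symm⟩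

/-! ### Connectedness -/

lemma joins_iff_exists_dart {e : G.E} {v w : G.V} :
    G.Joins e v w ↔ ∃ d : G.Dart, d.1 = e ∧ G.tail d = v ∧ G.head d = w := by
  unfold Joins
  rw [Sym2.eq_iff]
  constructor
  · rintro (⟨h1, h2⟩ | ⟨h1, h2⟩)
    · exact ⟨(e, true), rfl, h1, h2⟩
    · exact ⟨(e, false), rfl, h2, h1⟩
  · rintro ⟨⟨e', _ | _⟩, rfl, h1, h2⟩
    · exact Or.inr ⟨h2, h1⟩
    · exact Or.inl ⟨h1, h2⟩

lemma joins_dart (d : G.Dart) : G.Joins d.1 (G.tail d) (G.head d) :=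
  joins_iff_exists_dart.2 ⟨d, rfl, rfl, rfl⟩

/-- A property of vertices that spreads along oriented edges holds everywhere. -/
lemma Connected.forall_vertex (hG : G.Connected) {P : G.V → Prop}
    (h : ∀ d : G.Dart, P (G.tail d) → P (G.head d)) {v₀ : G.V} (h₀ : P v₀) (v : G.V) : P v := by
  obtain ⟨p⟩ := hG.preconnected v₀ v
  induction p with
  | nil => exact h₀
  | cons hadj _ ih =>
    obtain ⟨_, e, he⟩ := hadj
    obtain ⟨d, -, rfl, rfl⟩ := joins_iff_exists_dart.1 he
    exact ih (h d h₀)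

lemma Connected.exists_dart_tail (hG : G.Connected) [hE : Nonempty G.E] (v : G.V) :
    ∃ d : G.Dart, G.tail d = v := by
  obtain ⟨e⟩ := hE
  exact hG.forall_vertex (P := fun v => ∃ d : G.Dart, G.tail d = v)
    (fun d _ => ⟨G.rev d, tail_rev d⟩) (v₀ := G.src e) ⟨(e, true), rfl⟩ v

lemma Connected.exists_dpt_eq (hG : G.Connected) [hE : Nonempty G.E] (x : G.Point) :
    ∃ d : G.Dart, ∃ s ∈ Ico 0 (G.len d.1), G.dpt d s = x := by
  rcases vertex_or_dpt x with ⟨v, rfl⟩ | ⟨d, s, hs, rfl⟩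
  · obtain ⟨d, rfl⟩ := hG.exists_dart_tail v
    exact ⟨d, 0, ⟨le_rfl, dart_len_pos d⟩, dpt_zero d⟩
  · exact ⟨d, s, ⟨hs.1.le, hs.2⟩, rfl⟩

lemma Loopless.tail_ne_head (hG : G.Loopless) (d : G.Dart) : G.tail d ≠ G.head d := by
  rcases d with ⟨e, _ | _⟩
  · exact (hG e).symm
  · exact hG e

/-! ### Slopes of piecewise linear functions -/

/-- In the direction `p` the function `f` is linear of slope `m` near the base point of `p`. -/
def HasSlope (f : G.Point → ℝ) (p : G.Dart × ℝ) (m : ℤ) : Prop :=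
  ∀ᶠ u in 𝓝[>] p.2, f (G.dpt p.1 u) = f (G.dpt p.1 p.2) + m * (u - p.2)

/-- `f` is linear of integer slope near every point in every direction. This is the local form of
`IsRational`, see `isRational_iff`. -/
def PL (f : G.Point → ℝ) : Prop :=
  ∀ (d : G.Dart), ∀ s ∈ Ico 0 (G.len d.1), ∃ m, HasSlope f (d, s) m

open Classical in
/-- The outgoing slope of `f` in the direction `p`, and `0` if there is no integer slope. -/
noncomputable def slope (f : G.Point → ℝ) (p : G.Dart × ℝ) : ℤ :=
  if h : ∃ m, HasSlope f p m then h.choose else 0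

/-- The sum of the outgoing slopes of `f` at a point, as an integer. -/
noncomputable def divZ (f : G.Point → ℝ) (x : G.Point) : ℤ := ∑ p ∈ G.dirs x, slope f p

lemma HasSlope.unique {f : G.Point → ℝ} {p : G.Dart × ℝ} {m n : ℤ} (hm : HasSlope f p m)
    (hn : HasSlope f p n) : m = n := by
  have h : ∀ᶠ u in 𝓝[>] p.2, p.2 < u := self_mem_nhdsWithin
  obtain ⟨u, ⟨h1, h2⟩, h3⟩ := ((hm.and hn).and h).exists
  have h4 : (m : ℝ) * (u - p.2) = n * (u - p.2) := by linarith
  exact_mod_cast mul_right_cancel₀ (sub_pos.2 h3).ne' h4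

lemma HasSlope.slope_eq {f : G.Point → ℝ} {p : G.Dart × ℝ} {m : ℤ} (h : HasSlope f p m) :
    slope f p = m := by
  have h' : ∃ m, HasSlope f p m := ⟨m, h⟩
  rw [slope, dif_pos h']
  exact h'.choose_spec.unique h

lemma PL.hasSlope {f : G.Point → ℝ} (hf : PL f) {d : G.Dart} {s : ℝ}
    (hs : s ∈ Ico 0 (G.len d.1)) : HasSlope f (d, s) (slope f (d, s)) := by
  obtain ⟨m, hm⟩ := hf d s hs
  rwa [hm.slope_eq]

lemma PL.hasSlope' {f : G.Point → ℝ} (hf : PL f) {x : G.Point} {p : G.Dart × ℝ}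
    (hp : p ∈ G.dirs x) : HasSlope f p (slope f p) :=
  hf.hasSlope (d := p.1) (s := p.2) (mem_dirs.1 hp).1

lemma HasSlope.add {f g : G.Point → ℝ} {p : G.Dart × ℝ} {m n : ℤ} (hm : HasSlope f p m)
    (hn : HasSlope g p n) : HasSlope (f + g) p (m + n) := by
  filter_upwards [hm, hn] with u h1 h2
  simp only [Pi.add_apply, h1, h2]
  push_cast
  ring

lemma HasSlope.neg {f : G.Point → ℝ} {p : G.Dart × ℝ} {m : ℤ} (hm : HasSlope f p m) :
    HasSlope (-f) p (-m) := by
  filter_upwards [hm] with u h1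
  simp only [Pi.neg_apply, h1]
  push_cast
  ring

lemma hasSlope_const (c : ℝ) (p : G.Dart × ℝ) : HasSlope (fun _ : G.Point => c) p 0 :=
  Eventually.of_forall fun _ => by simp

lemma PL.add {f g : G.Point → ℝ} (hf : PL f) (hg : PL g) : PL (f + g) :=
  fun _ _ hs => ⟨_, (hf.hasSlope hs).add (hg.hasSlope hs)⟩

lemma PL.neg {f : G.Point → ℝ} (hf : PL f) : PL (-f) := fun _ _ hs => ⟨_, (hf.hasSlope hs).neg⟩

lemma pl_const (c : ℝ) : PL (fun _ : G.Point => c) := fun _ _ _ => ⟨0, hasSlope_const c _⟩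

lemma PL.sub {f g : G.Point → ℝ} (hf : PL f) (hg : PL g) : PL (f - g) := by
  rw [sub_eq_add_neg]
  exact hf.add hg.neg

lemma PL.slope_add {f g : G.Point → ℝ} (hf : PL f) (hg : PL g) {x : G.Point} {p : G.Dart × ℝ}
    (hp : p ∈ G.dirs x) : slope (f + g) p = slope f p + slope g p :=
  ((hf.hasSlope' hp).add (hg.hasSlope' hp)).slope_eq

lemma PL.slope_neg {f : G.Point → ℝ} (hf : PL f) {x : G.Point} {p : G.Dart × ℝ}
    (hp : p ∈ G.dirs x) : slope (-f) p = -slope f p :=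
  (hf.hasSlope' hp).neg.slope_eq

lemma PL.slope_sub {f g : G.Point → ℝ} (hf : PL f) (hg : PL g) {x : G.Point} {p : G.Dart × ℝ}
    (hp : p ∈ G.dirs x) : slope (f - g) p = slope f p - slope g p := by
  rw [sub_eq_add_neg, hf.slope_add hg.neg hp, hg.slope_neg hp, sub_eq_add_neg]

lemma PL.divZ_add {f g : G.Point → ℝ} (hf : PL f) (hg : PL g) (x : G.Point) :
    divZ (f + g) x = divZ f x + divZ g x := by
  unfold divZ
  rw [← Finset.sum_add_distrib]
  exact Finset.sum_congr rfl fun p hp => hf.slope_add hg hp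

lemma PL.divZ_neg {f : G.Point → ℝ} (hf : PL f) (x : G.Point) :
    divZ (-f) x = -divZ f x := by
  unfold divZ
  rw [← Finset.sum_neg_distrib]
  exact Finset.sum_congr rfl fun p hp => hf.slope_neg hp

lemma PL.divZ_sub {f g : G.Point → ℝ} (hf : PL f) (hg : PL g) (x : G.Point) :
    divZ (f - g) x = divZ f x - divZ g x := by
  rw [sub_eq_add_neg, hf.divZ_add hg.neg, hg.divZ_neg, sub_eq_add_neg]

lemma divZ_const (c : ℝ) (x : G.Point) : divZ (fun _ : G.Point => c) x = 0 :=
  Finset.sum_eq_zero fun p _ => (hasSlope_const c p).slope_eq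

lemma divZ_const' {f : G.Point → ℝ} (hf : ∀ x y, f x = f y) (x : G.Point) : divZ f x = 0 := by
  have h : f = fun _ => f x := funext fun y => hf y x
  rw [h, divZ_const]

/-! ### Truncation -/

/-- `max f c`, the truncation of `f` from below at the level `c`. -/
noncomputable def trunc (f : G.Point → ℝ) (c : ℝ) : G.Point → ℝ := fun x => max (f x) c

/-- The sum of the positive outgoing slopes of `f` at a point. -/
noncomputable def up (f : G.Point → ℝ) (x : G.Point) : ℤ := ∑ p ∈ G.dirs x, max (slope f p) 0

lemma HasSlope.tendsto {f : G.Point → ℝ} {p : G.Dart × ℝ} {m : ℤ} (hm : HasSlope f p m) :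
    Tendsto (fun u => f (G.dpt p.1 u)) (𝓝[>] p.2) (𝓝 (f (G.dpt p.1 p.2))) := by
  have h : Tendsto (fun u => f (G.dpt p.1 p.2) + m * (u - p.2)) (𝓝[>] p.2)
      (𝓝 (f (G.dpt p.1 p.2) + m * (p.2 - p.2))) :=
    (by fun_prop : Continuous fun u => f (G.dpt p.1 p.2) + m * (u - p.2)).continuousWithinAt
  rw [sub_self, mul_zero, add_zero] at h
  exact h.congr' (hm.mono fun u hu => hu.symm)

lemma HasSlope.trunc_of_lt {f : G.Point → ℝ} {p : G.Dart × ℝ} {m : ℤ} {c : ℝ}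
    (hm : HasSlope f p m) (h : c < f (G.dpt p.1 p.2)) : HasSlope (trunc f c) p m := by
  filter_upwards [hm, hm.tendsto.eventually_const_lt h] with u h1 h2
  rw [trunc, trunc, max_eq_left h2.le, max_eq_left h.le, h1]

lemma HasSlope.trunc_of_gt {f : G.Point → ℝ} {p : G.Dart × ℝ} {m : ℤ} {c : ℝ}
    (hm : HasSlope f p m) (h : f (G.dpt p.1 p.2) < c) : HasSlope (trunc f c) p 0 := by
  filter_upwards [hm.tendsto.eventually_lt_const h] with u h2
  rw [trunc, trunc, max_eq_right h2.le, max_eq_right h.le]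
  simp

lemma HasSlope.trunc_of_eq {f : G.Point → ℝ} {p : G.Dart × ℝ} {m : ℤ} {c : ℝ}
    (hm : HasSlope f p m) (h : f (G.dpt p.1 p.2) = c) : HasSlope (trunc f c) p (max m 0) := by
  filter_upwards [hm, self_mem_nhdsWithin] with u h1 h2
  have h3 : 0 < u - p.2 := sub_pos.2 h2
  rw [trunc, trunc, h1, h, max_self]
  rcases le_total m 0 with h4 | h4
  · have h5 : (m : ℝ) ≤ 0 := by exact_mod_cast h4
    rw [max_eq_right h4, max_eq_right (by nlinarith)]
    simp
  · have h5 : (0 : ℝ) ≤ m := by exact_mod_cast h4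
    rw [max_eq_left h4, max_eq_left (by nlinarith)]

lemma PL.trunc {f : G.Point → ℝ} (hf : PL f) (c : ℝ) : PL (trunc f c) := by
  intro d s hs
  rcases lt_trichotomy (f (G.dpt d s)) c with h | h | h
  · exact ⟨_, (hf.hasSlope hs).trunc_of_gt h⟩
  · exact ⟨_, (hf.hasSlope hs).trunc_of_eq h⟩
  · exact ⟨_, (hf.hasSlope hs).trunc_of_lt h⟩

lemma PL.divZ_trunc_of_lt {f : G.Point → ℝ} (hf : PL f) {c : ℝ} {x : G.Point} (h : c < f x) :
    divZ (LengthGraph.trunc f c) x = divZ f x :=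
  Finset.sum_congr rfl fun p hp =>
    ((hf.hasSlope' hp).trunc_of_lt (by rwa [(mem_dirs.1 hp).2])).slope_eq

lemma PL.divZ_trunc_of_gt {f : G.Point → ℝ} (hf : PL f) {c : ℝ} {x : G.Point} (h : f x < c) :
    divZ (LengthGraph.trunc f c) x = 0 :=
  Finset.sum_eq_zero fun p hp =>
    ((hf.hasSlope' hp).trunc_of_gt (by rwa [(mem_dirs.1 hp).2])).slope_eq

lemma PL.divZ_trunc_of_eq {f : G.Point → ℝ} (hf : PL f) {c : ℝ} {x : G.Point} (h : f x = c) :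
    divZ (LengthGraph.trunc f c) x = up f x :=
  Finset.sum_congr rfl fun p hp =>
    ((hf.hasSlope' hp).trunc_of_eq (by rwa [(mem_dirs.1 hp).2])).slope_eq

lemma up_nonneg (f : G.Point → ℝ) (x : G.Point) : 0 ≤ up f x :=
  Finset.sum_nonneg fun _ _ => le_max_right _ _

lemma slope_le_up (f : G.Point → ℝ) {x : G.Point} {p : G.Dart × ℝ} (hp : p ∈ G.dirs x) :
    slope f p ≤ up f x :=
  (le_max_left _ _).trans
    (Finset.single_le_sum (f := fun p => max (slope f p) 0) (fun _ _ => le_max_right _ _) hp)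

/-! ### Continuity -/

lemma PL.continuousOn {f : G.Point → ℝ} (hf : PL f) (d : G.Dart) :
    ContinuousOn (fun s => f (G.dpt d s)) (Icc 0 (G.len d.1)) := by
  have right : ∀ d : G.Dart, ∀ s ∈ Icc 0 (G.len d.1),
      ContinuousWithinAt (fun s => f (G.dpt d s)) (Icc s (G.len d.1)) s := by
    intro d s hs
    rcases eq_or_lt_of_le hs.2 with h | h
    · rw [← h, Icc_self]
      exact continuousWithinAt_singleton
    · have h1 : ContinuousWithinAt (fun s => f (G.dpt d s)) (Ioi s) s :=
        (hf.hasSlope ⟨hs.1, h⟩).tendsto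
      exact (continuousWithinAt_Ioi_iff_Ici.1 h1).mono Icc_subset_Ici_self
  intro s hs
  have h1 := right d s hs
  have h2 := right (G.rev d) (G.len d.1 - s) ⟨sub_nonneg.2 hs.2, by simp [hs.1]⟩
  have h3 : ContinuousWithinAt (fun s => f (G.dpt d s)) (Icc 0 s) s := by
    have h4 := ContinuousWithinAt.comp (f := fun u : ℝ => G.len d.1 - u) (s := Icc 0 s) (x := s)
      h2 (by fun_prop) (fun u hu => ⟨by linarith [hu.2], by simp [hu.1]⟩)
    refine h4.congr (fun u _ => ?_) ?_ <;> simp [dpt_rev]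
  refine (h3.union h1).mono fun u hu => ?_
  rcases le_total u s with h | h
  · exact Or.inl ⟨hu.1, h⟩
  · exact Or.inr ⟨h, hu.2⟩

lemma PL.continuous {f : G.Point → ℝ} (hf : PL f) : Continuous f := by
  refine continuous_iSup_dom.2 fun e => continuous_coinduced_dom.2 ?_
  exact continuousOn_iff_continuous_domRestrict.1 (hf.continuousOn (e, true))

/-! ### Local and global piecewise linearity -/

/-- `g` is linear of integer slope on `[a, b]`. -/
def LinearOn (g : ℝ → ℝ) (a b : ℝ) : Prop :=
  ∃ m : ℤ, ∀ t ∈ Icc a b, g t = g a + m * (t - a)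

/-- `[0, t]` has a finite subdivision into intervals on which `g` is linear of integer slope. -/
def HasPieces (g : ℝ → ℝ) (t : ℝ) : Prop :=
  ∃ (n : ℕ) (b : ℕ → ℝ), b 0 = 0 ∧ b n = t ∧ (∀ i < n, b i ≤ b (i + 1)) ∧
    ∀ i < n, LinearOn g (b i) (b (i + 1))

lemma LinearOn.mono_right {g : ℝ → ℝ} {a b c : ℝ} (h : LinearOn g a b) (hc : c ≤ b) :
    LinearOn g a c :=
  h.imp fun _ hm t ht => hm t ⟨ht.1, ht.2.trans hc⟩

lemma HasPieces.extend {g : ℝ → ℝ} {t t' : ℝ} (h : HasPieces g t) (htt' : t ≤ t')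
    (hlin : LinearOn g t t') : HasPieces g t' := by
  obtain ⟨n, b, h0, hn, hmono, hl⟩ := h
  refine ⟨n + 1, fun i => if i ≤ n then b i else t', by simp [h0], by simp, fun i hi => ?_,
    fun i hi => ?_⟩
  · rcases Nat.lt_succ_iff_lt_or_eq.1 hi with h | rfl
    · simpa [h.le, Nat.succ_le_of_lt h] using hmono i h
    · simpa [hn] using htt'
  · rcases Nat.lt_succ_iff_lt_or_eq.1 hi with h | rfl
    · simpa [h.le, Nat.succ_le_of_lt h] using hl i h
    · simpa [hn] using hlin

lemma HasPieces.restrict {g : ℝ → ℝ} {t t' : ℝ} (h : HasPieces g t) (h0' : 0 ≤ t')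
    (htt' : t' ≤ t) : HasPieces g t' := by
  obtain ⟨n, b, h0, hn, hmono, hl⟩ := h
  refine ⟨n, fun i => min (b i) t', by simp [h0, h0'], by simp [hn, htt'],
    fun i hi => min_le_min_right _ (hmono i hi), fun i hi => ?_⟩
  rcases le_total (b i) t' with h | h
  · simp only [min_eq_left h]
    exact (hl i hi).mono_right (min_le_left _ _)
  · simp only [min_eq_right h, min_eq_right (h.trans (hmono i hi))]
    refine ⟨0, fun s hs => ?_⟩
    rw [Icc_self] at hs
    rw [hs]
    simp

/-- Linearity on both sides of every point gives a finite subdivision, by real induction. -/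
lemma hasPieces_of_local {g : ℝ → ℝ} {L : ℝ} (hL : 0 ≤ L)
    (hr : ∀ t ∈ Ico 0 L, ∃ m : ℤ, ∀ᶠ u in 𝓝[>] t, g u = g t + m * (u - t))
    (hl : ∀ t ∈ Ioc 0 L, ∃ m : ℤ, ∀ᶠ u in 𝓝[<] t, g u = g t + m * (u - t)) :
    HasPieces g L := by
  have h0 : HasPieces g 0 := ⟨0, fun _ => 0, rfl, rfl, by simp, by simp⟩
  have key : Icc 0 L ⊆ {t | HasPieces g t} := by
    refine IsClosed.Icc_subset_of_forall_mem_nhdsWithin ?_ h0 ?_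
    · refine isClosed_of_closure_subset fun t ht => ?_
      have htI : t ∈ Icc 0 L :=
        closure_minimal inter_subset_right isClosed_Icc ht
      refine ⟨?_, htI⟩
      rcases eq_or_lt_of_le htI.1 with h | h
      · rw [← h]
        exact h0
      obtain ⟨m, hm⟩ := hl t ⟨h, htI.2⟩
      obtain ⟨a, ha, ha'⟩ := (mem_nhdsLT_iff_exists_Ioo_subset' h).1 hm
      obtain ⟨s, hs, hs'⟩ := mem_closure_iff_nhds.1 ht (Ioi a) (Ioi_mem_nhds ha)
      rcases le_or_gt t s with hts | hts
      · exact HasPieces.restrict hs'.1 htI.1 hts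
      · refine HasPieces.extend hs'.1 hts.le ⟨m, fun u hu => ?_⟩
        have e1 : g s = g t + m * (s - t) := ha' ⟨hs, hts⟩
        rcases eq_or_lt_of_le hu.2 with rfl | hut
        · rw [e1]
          ring
        · have e2 : g u = g t + m * (u - t) := ha' ⟨lt_of_lt_of_le hs hu.1, hut⟩
          rw [e1, e2]
          ring
    · rintro t ⟨ht, ht'⟩
      obtain ⟨m, hm⟩ := hr t ht'
      obtain ⟨a, ha, ha'⟩ := (mem_nhdsGT_iff_exists_Ioo_subset' ht'.2).1 hm
      refine mem_of_superset (Ioo_mem_nhdsGT ha) fun s hs => ?_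
      refine HasPieces.extend ht hs.1.le ⟨m, fun u hu => ?_⟩
      rcases eq_or_lt_of_le hu.1 with rfl | hut
      · ring
      · exact ha' ⟨hut, hu.2.trans_lt hs.2⟩
  exact key ⟨hL, le_rfl⟩

lemma exists_piece_right {b : ℕ → ℝ} {t : ℝ} (n : ℕ) (h0 : b 0 ≤ t) (hn : t < b n) :
    ∃ i < n, b i ≤ t ∧ t < b (i + 1) := by
  induction n with
  | zero => exact absurd hn (not_lt.2 h0)
  | succ n ih =>
    rcases lt_or_ge t (b n) with h | h
    · obtain ⟨i, hi, hi'⟩ := ih h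
      exact ⟨i, hi.trans n.lt_succ_self, hi'⟩
    · exact ⟨n, n.lt_succ_self, h, hn⟩

lemma exists_piece_left {b : ℕ → ℝ} {t : ℝ} (n : ℕ) (h0 : b 0 < t) (hn : t ≤ b n) :
    ∃ i < n, b i < t ∧ t ≤ b (i + 1) := by
  induction n with
  | zero => exact absurd hn (not_le.2 h0)
  | succ n ih =>
    rcases le_or_gt t (b n) with h | h
    · obtain ⟨i, hi, hi'⟩ := ih h
      exact ⟨i, hi.trans n.lt_succ_self, hi'⟩
    · exact ⟨n, n.lt_succ_self, h, hn⟩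

lemma dpt_false_eq_pt (e : G.E) (s : ℝ) : G.dpt (e, false) s = G.pt e (G.len e - s) := rfl

lemma dpt_true_eq_pt (e : G.E) (s : ℝ) : G.dpt (e, true) s = G.pt e s := rfl

lemma tendsto_const_sub_nhdsLT (L t : ℝ) :
    Tendsto (fun u => L - u) (𝓝[<] t) (𝓝[>] (L - t)) := by
  refine tendsto_nhdsWithin_iff.2 ⟨?_, ?_⟩
  · exact (by fun_prop : Continuous fun u => L - u).continuousWithinAt
  · filter_upwards [self_mem_nhdsWithin] with u hu
    exact sub_lt_sub_left (mem_Iio.1 hu) _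

/-- The slope of `f` in the backward direction of an edge, in the parameter of the edge. -/
lemma hasSlope_false_iff {f : G.Point → ℝ} {e : G.E} {t : ℝ} {m : ℤ} :
    HasSlope f ((e, false), G.len e - t) m ↔
      ∀ᶠ u in 𝓝[<] t, f (G.pt e u) = f (G.pt e t) + (-m : ℤ) * (u - t) := by
  have h1 := tendsto_const_sub_nhdsLT (G.len e) t
  have h2 : Tendsto (fun u => G.len e - u) (𝓝[>] (G.len e - t)) (𝓝[<] t) := by
    refine tendsto_nhdsWithin_iff.2 ⟨?_, ?_⟩
    · have := (by fun_prop : Continuous fun u => G.len e - u).continuousWithinAt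
        (s := Ioi (G.len e - t)) (x := G.len e - t)
      simpa [ContinuousWithinAt] using this
    · filter_upwards [self_mem_nhdsWithin] with u hu
      have hu' : G.len e - t < u := hu
      show G.len e - u < t
      linarith
  constructor
  · intro h
    filter_upwards [h1.eventually h] with u hu
    simp only [dpt_false_eq_pt, sub_sub_cancel] at hu
    rw [hu]
    push_cast
    ring
  · intro h
    filter_upwards [h2.eventually h] with u hu
    simp only [dpt_false_eq_pt, sub_sub_cancel] at hu ⊢
    rw [hu]
    push_cast
    ring

theorem isRational_iff {f : G.Point → ℝ} : G.IsRational f ↔ PL f := by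
  constructor
  · rintro ⟨-, h⟩ ⟨e, _ | _⟩ s hs
    · obtain ⟨n, b, h0, hn, -, hl⟩ := h e
      have hs' : s < G.len e := hs.2
      obtain ⟨i, hi, hi1, hi2⟩ := exists_piece_left (b := b) (t := G.len e - s) n
        (by rw [h0]; linarith) (by rw [hn]; linarith [hs.1])
      obtain ⟨m, hm⟩ := hl i hi
      refine ⟨-m, ?_⟩
      have key : HasSlope f ((e, false), G.len e - (G.len e - s)) (-m) := by
        rw [hasSlope_false_iff]
        filter_upwards [Ioo_mem_nhdsLT hi1] with u hu
        rw [hm u ⟨hu.1.le, hu.2.le.trans hi2⟩, hm (G.len e - s) ⟨hi1.le, hi2⟩, neg_neg]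
        ring
      rwa [sub_sub_cancel] at key
    · obtain ⟨n, b, h0, hn, -, hl⟩ := h e
      obtain ⟨i, hi, hi1, hi2⟩ := exists_piece_right (b := b) (t := s) n
        (by rw [h0]; exact hs.1) (by rw [hn]; exact hs.2)
      obtain ⟨m, hm⟩ := hl i hi
      refine ⟨m, ?_⟩
      filter_upwards [Ioo_mem_nhdsGT hi2] with u hu
      simp only [dpt_true_eq_pt]
      rw [hm u ⟨hi1.trans hu.1.le, hu.2.le⟩, hm s ⟨hi1, hi2.le⟩]
      ring
  · intro hf
    refine ⟨hf.continuous, fun e => ?_⟩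
    refine hasPieces_of_local (g := fun t => f (G.pt e t)) (G.len_pos e).le (fun t ht => ?_)
      (fun t ht => ?_)
    · exact hf (e, true) t ht
    · obtain ⟨m, hm⟩ := hf (e, false) (G.len e - t) ⟨sub_nonneg.2 ht.2, sub_lt_self _ ht.1⟩
      exact ⟨-m, hasSlope_false_iff.1 hm⟩

lemma PL.slopeFwd_eq {f : G.Point → ℝ} (hf : PL f) {e : G.E} {t : ℝ} (ht : t ∈ Ico 0 (G.len e)) :
    G.slopeFwd f e t = slope f ((e, true), t) := by
  have h : ∀ᶠ u in 𝓝[>] t, f (G.pt e u) = f (G.pt e t) + slope f ((e, true), t) * (u - t) :=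
    hf.hasSlope (d := (e, true)) ht
  have h1 : HasDerivWithinAt (fun u => f (G.pt e t) + slope f ((e, true), t) * (u - t))
      (slope f ((e, true), t) : ℝ) (Ioi t) t := by
    simpa using ((((hasDerivAt_id t).sub_const t).const_mul
      (slope f ((e, true), t) : ℝ)).const_add (f (G.pt e t))).hasDerivWithinAt
  have h2 := hasDerivWithinAt_Ioi_iff_Ici.1 (h1.congr_of_eventuallyEq h (by simp))
  exact h2.derivWithin (uniqueDiffOn_Ici t t self_mem_Ici)

lemma PL.slopeBwd_eq {f : G.Point → ℝ} (hf : PL f) {e : G.E} {t : ℝ} (ht : t ∈ Ioc 0 (G.len e)) :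
    G.slopeBwd f e t = slope f ((e, false), G.len e - t) := by
  set m := slope f ((e, false), G.len e - t) with hm
  have h : ∀ᶠ u in 𝓝[<] t, f (G.pt e u) = f (G.pt e t) + (-m : ℤ) * (u - t) :=
    hasSlope_false_iff.1
      (hf.hasSlope (d := (e, false)) ⟨sub_nonneg.2 ht.2, sub_lt_self _ ht.1⟩)
  have h1 : HasDerivWithinAt (fun u => f (G.pt e t) + (-m : ℤ) * (u - t))
      ((-m : ℤ) : ℝ) (Iio t) t := by
    simpa using ((((hasDerivAt_id t).sub_const t).const_mul
      ((-m : ℤ) : ℝ)).const_add (f (G.pt e t))).hasDerivWithinAt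
  have h2 := hasDerivWithinAt_Iio_iff_Iic.1 (h1.congr_of_eventuallyEq h (by simp))
  rw [slopeBwd, h2.derivWithin (uniqueDiffOn_Iic t t self_mem_Iic)]
  push_cast
  ring

lemma PL.divFun_eq {f : G.Point → ℝ} (hf : PL f) (x : G.Point) : G.divFun f x = divZ f x := by
  rcases x with v | ⟨e, t, h₀, h₁⟩
  · rw [divFun, divZ, sum_dirs_vertex, sum_filter_tail]
    push_cast
    congr 1
    · exact Finset.sum_congr rfl fun e _ => hf.slopeFwd_eq ⟨le_rfl, G.len_pos e⟩
    · refine Finset.sum_congr rfl fun e _ => ?_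
      rw [hf.slopeBwd_eq ⟨G.len_pos e, le_rfl⟩, sub_self]
  · rw [divFun, divZ, ← dpt_true h₀ h₁, sum_dirs_dpt _ ⟨h₀, h₁⟩, hf.slopeFwd_eq ⟨h₀.le, h₁⟩,
      hf.slopeBwd_eq ⟨h₀, h₁.le⟩]
    push_cast
    rfl

/-! ### Variation of the slope along an edge -/

lemma PL.eventually_slope_right {f : G.Point → ℝ} (hf : PL f) {d : G.Dart} {s : ℝ}
    (hs : s ∈ Ico 0 (G.len d.1)) :
    ∀ᶠ u in 𝓝[>] s, slope f (d, u) = slope f (d, s) ∧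
      slope f (G.rev d, G.len d.1 - u) = -slope f (d, s) := by
  obtain ⟨a, ha, ha'⟩ := (mem_nhdsGT_iff_exists_Ioo_subset' hs.2).1 (hf.hasSlope hs)
  filter_upwards [Ioo_mem_nhdsGT ha] with u hu
  have hu' : f (G.dpt d u) = f (G.dpt d s) + slope f (d, s) * (u - s) := ha' hu
  refine ⟨HasSlope.slope_eq ?_, HasSlope.slope_eq ?_⟩
  · filter_upwards [Ioo_mem_nhdsGT hu.2] with w hw
    have hw' : f (G.dpt d w) = f (G.dpt d s) + slope f (d, s) * (w - s) :=
      ha' ⟨hu.1.trans hw.1, hw.2⟩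
    rw [hw', hu']
    ring
  · have h1 : G.len d.1 - u < G.len d.1 - s := sub_lt_sub_left hu.1 _
    filter_upwards [Ioo_mem_nhdsGT h1] with w hw
    have hw' : f (G.dpt d (G.len d.1 - w)) =
        f (G.dpt d s) + slope f (d, s) * ((G.len d.1 - w) - s) :=
      ha' ⟨by linarith [hw.2], by linarith [hw.1, hu.2]⟩
    simp only [dpt_rev, sub_sub_cancel]
    rw [hw', hu']
    push_cast
    ring

lemma PL.eventually_slope_left {f : G.Point → ℝ} (hf : PL f) {d : G.Dart} {t : ℝ}
    (ht : t ∈ Ioc 0 (G.len d.1)) :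
    ∀ᶠ u in 𝓝[<] t, slope f (d, u) = -slope f (G.rev d, G.len d.1 - t) := by
  have h := hf.eventually_slope_right (d := G.rev d) (s := G.len d.1 - t)
    ⟨sub_nonneg.2 ht.2, sub_lt_self _ ht.1⟩
  filter_upwards [(tendsto_const_sub_nhdsLT (G.len d.1) t).eventually h] with u hu
  simpa using hu.2

lemma divZ_dpt (f : G.Point → ℝ) {d : G.Dart} {s : ℝ} (hs : s ∈ Ioo 0 (G.len d.1)) :
    divZ f (G.dpt d s) = slope f (d, s) + slope f (G.rev d, G.len d.1 - s) :=
  sum_dirs_dpt _ hs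

/-- The slope of `f` changes along an edge by the values of the divisor of `f`. -/
lemma PL.slope_eq_add_sum {f : G.Point → ℝ} (hf : PL f) {d : G.Dart} {S : Finset ℝ}
    (hS : ∀ t ∈ Ioo 0 (G.len d.1), divZ f (G.dpt d t) ≠ 0 → t ∈ S)
    (hS' : ∀ t ∈ S, t ∈ Ioo 0 (G.len d.1)) {t : ℝ} (ht : t ∈ Ico 0 (G.len d.1)) :
    slope f (d, t) = slope f (d, 0) + ∑ s ∈ S.filter (· ≤ t), divZ f (G.dpt d s) := by
  set φ : ℝ → ℤ := fun t => slope f (d, t) - ∑ s ∈ S.filter (· ≤ t), divZ f (G.dpt d s) with hφ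
  have hcont : ContinuousOn φ (Ico 0 (G.len d.1)) := by
    intro t ht
    have hright : ∀ᶠ u in 𝓝[>] t, φ u = φ t := by
      have h1 : ∀ᶠ u in 𝓝[>] t, ∀ s ∈ S, (s ≤ u ↔ s ≤ t) := by
        rw [eventually_all_finset]
        intro s _
        rcases le_or_gt s t with h | h
        · filter_upwards [self_mem_nhdsWithin] with u hu
          exact ⟨fun _ => h, fun _ => h.trans (mem_Ioi.1 hu).le⟩
        · filter_upwards [Ioo_mem_nhdsGT h] with u hu
          exact ⟨fun h' => absurd hu.2 (not_lt.2 h'), fun h' => absurd h (not_lt.2 h')⟩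
      filter_upwards [h1, hf.eventually_slope_right ht] with u hu hu'
      simp only [hφ]
      rw [hu'.1, Finset.filter_congr hu]
    have hleft : 0 < t → ∀ᶠ u in 𝓝[<] t, φ u = φ t := by
      intro h0
      have h1 : ∀ᶠ u in 𝓝[<] t, ∀ s ∈ S, (s ≤ u ↔ s < t) := by
        rw [eventually_all_finset]
        intro s _
        rcases lt_or_ge s t with h | h
        · filter_upwards [Ioo_mem_nhdsLT h] with u hu
          exact ⟨fun _ => h, fun _ => hu.1.le⟩
        · filter_upwards [self_mem_nhdsWithin] with u hu
          have hu' : u < t := hu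
          exact ⟨fun h' => h'.trans_lt hu', fun h' => absurd h (not_le.2 h')⟩
      have hsplit : ∑ s ∈ S.filter (· ≤ t), divZ f (G.dpt d s) =
          ∑ s ∈ S.filter (· < t), divZ f (G.dpt d s) + divZ f (G.dpt d t) := by
        by_cases htS : t ∈ S
        · have : S.filter (· ≤ t) = insert t (S.filter (· < t)) := by
            ext s
            simp only [Finset.mem_filter, Finset.mem_insert, le_iff_eq_or_lt]
            constructor
            · rintro ⟨h1, h2 | h2⟩
              · exact Or.inl h2
              · exact Or.inr ⟨h1, h2⟩
            · rintro (rfl | ⟨h1, h2⟩)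
              · exact ⟨htS, Or.inl rfl⟩
              · exact ⟨h1, Or.inr h2⟩
          rw [this, Finset.sum_insert (by simp), add_comm]
        · have h0' : divZ f (G.dpt d t) = 0 := by
            by_contra h
            exact htS (hS t ⟨h0, ht.2⟩ h)
          rw [h0', add_zero]
          refine Finset.sum_congr (Finset.filter_congr fun s hs => ?_) fun _ _ => rfl
          exact ⟨fun h => lt_of_le_of_ne h (fun h' => htS (h' ▸ hs)), le_of_lt⟩
      filter_upwards [h1, hf.eventually_slope_left (d := d) ⟨h0, ht.2.le⟩] with u hu hu'
      simp only [hφ]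
      rw [hu', Finset.filter_congr hu, hsplit, divZ_dpt f ⟨h0, ht.2⟩]
      ring
    have hev : ∀ᶠ u in 𝓝[Ico 0 (G.len d.1)] t, φ u = φ t := by
      rcases eq_or_lt_of_le ht.1 with h0 | h0
      · subst h0
        have h2 : ∀ᶠ u in 𝓝[≥] (0 : ℝ), φ u = φ 0 := by
          rw [← Ioi_insert, nhdsWithin_insert]
          exact eventually_sup.2 ⟨by simp, hright⟩
        exact h2.filter_mono (nhdsWithin_mono _ fun u hu => hu.1)
      · have h2 : ∀ᶠ u in 𝓝 t, φ u = φ t := by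
          rw [← nhdsLT_sup_nhdsGE, eventually_sup, ← Ioi_insert, nhdsWithin_insert, eventually_sup]
          exact ⟨hleft h0, by simp, hright⟩
        exact h2.filter_mono nhdsWithin_le_nhds
    exact tendsto_nhds_of_eventually_eq hev
  have h0 : (0 : ℝ) ∈ Ico 0 (G.len d.1) := ⟨le_rfl, dart_len_pos d⟩
  have h1 : φ t = φ 0 := isPreconnected_Ico.constant hcont ht h0
  have h2 : S.filter (· ≤ 0) = ∅ := by
    rw [Finset.filter_eq_empty_iff]
    exact fun s hs => not_le.2 (hS' s hs).1
  simp only [hφ, h2, Finset.sum_empty] at h1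
  linarith

lemma PL.sum_edge {f : G.Point → ℝ} (hf : PL f) {d : G.Dart} {S : Finset ℝ}
    (hS : ∀ t ∈ Ioo 0 (G.len d.1), divZ f (G.dpt d t) ≠ 0 → t ∈ S)
    (hS' : ∀ t ∈ S, t ∈ Ioo 0 (G.len d.1)) :
    ∑ s ∈ S, divZ f (G.dpt d s) + (slope f (d, 0) + slope f (G.rev d, 0)) = 0 := by
  have h1 := hf.eventually_slope_left (d := d) ⟨dart_len_pos d, le_rfl⟩
  have h2 : ∀ᶠ u in 𝓝[<] G.len d.1, ∀ s ∈ S, s ≤ u := by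
    rw [eventually_all_finset]
    intro s hs
    filter_upwards [Ioo_mem_nhdsLT (hS' s hs).2] with u hu using hu.1.le
  obtain ⟨u, ⟨hu1, hu2⟩, hu3⟩ := ((h1.and h2).and (Ioo_mem_nhdsLT (dart_len_pos d))).exists
  have h3 := hf.slope_eq_add_sum hS hS' (t := u) ⟨hu3.1.le, hu3.2⟩
  rw [Finset.filter_true_of_mem hu2, hu1, sub_self] at h3
  linarith

/-- If the divisor of `f` vanishes inside an edge, then `f` is linear on this edge. -/
lemma PL.slope_eq_of_divZ_eq_zero {f : G.Point → ℝ} (hf : PL f) {d : G.Dart}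
    (h : ∀ t ∈ Ioo 0 (G.len d.1), divZ f (G.dpt d t) = 0) {t : ℝ} (ht : t ∈ Ico 0 (G.len d.1)) :
    slope f (d, t) = slope f (d, 0) := by
  simpa using hf.slope_eq_add_sum (S := ∅) (fun t ht h' => absurd (h t ht) h') (by simp) ht

lemma PL.eq_of_divZ_eq_zero {f : G.Point → ℝ} (hf : PL f) {d : G.Dart}
    (h : ∀ t ∈ Ioo 0 (G.len d.1), divZ f (G.dpt d t) = 0) {t : ℝ} (ht : t ∈ Icc 0 (G.len d.1)) :
    f (G.dpt d t) = f (G.dpt d 0) + slope f (d, 0) * t := by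
  have h1 := constant_of_has_deriv_right_zero
    (f := fun s => f (G.dpt d s) - slope f (d, 0) * s) (a := 0) (b := G.len d.1)
    ((hf.continuousOn d).sub (by fun_prop)) (fun s hs => ?_) t ht
  · simp only [mul_zero, sub_zero] at h1
    linarith
  · have h2 : ∀ᶠ u in 𝓝[>] s, f (G.dpt d u) = f (G.dpt d s) + slope f (d, s) * (u - s) :=
      hf.hasSlope hs
    rw [hf.slope_eq_of_divZ_eq_zero h hs] at h2
    rw [← hasDerivWithinAt_Ioi_iff_Ici]
    refine (hasDerivWithinAt_const s (Ioi s)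
      (f (G.dpt d s) - slope f (d, 0) * s)).congr_of_eventuallyEq ?_ rfl
    filter_upwards [h2] with u hu
    rw [hu]
    ring

lemma slope_rev_of_slope_eq {f : G.Point → ℝ} (hf : PL f) {d : G.Dart}
    (h : ∀ t ∈ Ioo 0 (G.len d.1), divZ f (G.dpt d t) = 0) {t : ℝ} (ht : t ∈ Ioc 0 (G.len d.1)) :
    slope f (G.rev d, G.len d.1 - t) = -slope f (d, 0) := by
  have h1 := hf.eventually_slope_left (d := d) ht
  obtain ⟨u, hu1, hu2⟩ := (h1.and (Ioo_mem_nhdsLT ht.1)).exists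
  rw [hf.slope_eq_of_divZ_eq_zero h ⟨hu2.1.le, hu2.2.trans_le ht.2⟩] at hu1
  linarith

/-! ### The divisor of a piecewise linear function -/

lemma PL.finite_edge {f : G.Point → ℝ} (hf : PL f) (d : G.Dart) :
    {t | t ∈ Ioo 0 (G.len d.1) ∧ divZ f (G.dpt d t) ≠ 0}.Finite := by
  by_contra hinf
  obtain ⟨t, ht, hacc⟩ := Set.Infinite.exists_accPt_of_subset_isCompact hinf
    (isCompact_Icc (a := 0) (b := G.len d.1)) fun t ht => ⟨ht.1.1.le, ht.1.2.le⟩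
  rw [accPt_iff_frequently_nhdsNE] at hacc
  refine hacc ?_
  rw [← nhdsLT_sup_nhdsGT, eventually_sup]
  have right : ∀ d : G.Dart, ∀ t ∈ Icc 0 (G.len d.1),
      ∀ᶠ u in 𝓝[>] t, ¬ (u ∈ Ioo 0 (G.len d.1) ∧ divZ f (G.dpt d u) ≠ 0) := by
    intro d t ht
    rcases eq_or_lt_of_le ht.2 with h | h
    · filter_upwards [self_mem_nhdsWithin] with u hu hu'
      exact absurd hu'.1.2 (not_lt.2 (h ▸ (mem_Ioi.1 hu).le))
    · filter_upwards [hf.eventually_slope_right ⟨ht.1, h⟩] with u hu hu'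
      refine hu'.2 ?_
      rw [divZ_dpt f hu'.1, hu.1, hu.2, add_neg_cancel]
  refine ⟨?_, right d t ht⟩
  have h := right (G.rev d) (G.len d.1 - t) ⟨sub_nonneg.2 ht.2, by simp [ht.1]⟩
  filter_upwards [(tendsto_const_sub_nhdsLT (G.len d.1) t).eventually h] with u hu hu'
  refine hu ⟨⟨by linarith [hu'.1.2], by simp [hu'.1.1]⟩, ?_⟩
  rw [dpt_rev, sub_sub_cancel]
  exact hu'.2

open Classical in
/-- A finite set of points containing the support of the divisor of `f`, on which the values of
this divisor add up to zero. -/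
lemma PL.exists_support {f : G.Point → ℝ} (hf : PL f) :
    ∃ T : Finset G.Point, (∀ x, divZ f x ≠ 0 → x ∈ T) ∧ ∑ x ∈ T, divZ f x = 0 := by
  set S : G.E → Finset ℝ := fun e => (hf.finite_edge (e, true)).toFinset with hSdef
  have hS : ∀ e t, t ∈ S e ↔ t ∈ Ioo 0 (G.len e) ∧ divZ f (G.dpt (e, true) t) ≠ 0 :=
    fun e t => by simp [hSdef]
  refine ⟨Finset.univ.image Point.vertex ∪
    Finset.univ.biUnion fun e => (S e).image (G.dpt (e, true)), ?_, ?_⟩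
  · rintro (v | ⟨e, t, h₀, h₁⟩) hx
    · simp
    · refine Finset.mem_union_right _ (Finset.mem_biUnion.2 ⟨e, Finset.mem_univ _, ?_⟩)
      refine Finset.mem_image.2 ⟨t, (hS e t).2 ⟨⟨h₀, h₁⟩, ?_⟩, dpt_true h₀ h₁⟩
      rwa [dpt_true h₀ h₁]
  · rw [Finset.sum_union, Finset.sum_image, Finset.sum_biUnion]
    · have h1 : ∀ e, ∑ x ∈ (S e).image (G.dpt (e, true)), divZ f x =
          -(slope f ((e, true), 0) + slope f ((e, false), 0)) := by
        intro e
        rw [Finset.sum_image]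
        · have := hf.sum_edge (d := (e, true)) (S := S e)
            (fun t ht h => (hS e t).2 ⟨ht, h⟩) fun t ht => ((hS e t).1 ht).1
          simp only [rev, Bool.not_true] at this
          linarith
        · exact fun s hs t ht h => dpt_injOn (e, true) ((hS e s).1 hs).1 ((hS e t).1 ht).1 h
      have h2 : ∑ v, divZ f (Point.vertex v) = ∑ d : G.Dart, slope f (d, 0) := by
        simp only [divZ, sum_dirs_vertex]
        exact Finset.sum_fiberwise _ _ _
      rw [Finset.sum_congr rfl fun e _ => h1 e, h2, Fintype.sum_prod_type,
        ← Finset.sum_add_distrib]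
      refine Finset.sum_eq_zero fun e _ => ?_
      rw [Fintype.sum_bool]
      ring
    · intro e _ e' _ hne
      rw [Function.onFun, Finset.disjoint_left]
      intro x hx hx'
      obtain ⟨s, hs, rfl⟩ := Finset.mem_image.1 hx
      obtain ⟨s', hs', h⟩ := Finset.mem_image.1 hx'
      have h1 := ((hS e s).1 hs).1
      have h2 := ((hS e' s').1 hs').1
      exact hne (fst_eq_of_dpt_eq (d := (e, true)) (d' := (e', true)) h1
        ⟨h2.1.le, h2.2.le⟩ h.symm).1
    · intro v _ w _ h
      simpa using h
    · rw [Finset.disjoint_left]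
      intro x hx hx'
      obtain ⟨v, -, rfl⟩ := Finset.mem_image.1 hx
      obtain ⟨e, -, he⟩ := Finset.mem_biUnion.1 hx'
      obtain ⟨s, hs, h⟩ := Finset.mem_image.1 he
      exact dpt_ne_vertex (d := (e, true)) ((hS e s).1 hs).1 v h

/-! ### Linear equivalence -/

lemma deg_add (D D' : G.Divisor) : Divisor.deg (D + D') = Divisor.deg D + Divisor.deg D' :=
  Finsupp.sum_add_index' (fun _ => rfl) fun _ _ _ => rfl

lemma deg_neg (D : G.Divisor) : Divisor.deg (-D) = -Divisor.deg D := by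
  have h := deg_add D (-D)
  rw [add_neg_cancel] at h
  have h0 : Divisor.deg (0 : G.Divisor) = 0 := Finsupp.sum_zero_index
  linarith

lemma deg_sub (D D' : G.Divisor) : Divisor.deg (D - D') = Divisor.deg D - Divisor.deg D' := by
  rw [sub_eq_add_neg, deg_add, deg_neg, sub_eq_add_neg]

/-- The divisor consisting of a single point. -/
noncomputable def delta (x : G.Point) : G.Divisor := Finsupp.single x 1

@[simp] lemma deg_delta (x : G.Point) : Divisor.deg (delta x) = 1 :=
  Finsupp.sum_single_index rfl

@[simp] lemma delta_self (x : G.Point) : delta x x = 1 := Finsupp.single_eq_same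

lemma delta_of_ne {x y : G.Point} (h : y ≠ x) : delta x y = 0 :=
  Finsupp.single_eq_of_ne h

open Classical in
lemma delta_apply (x y : G.Point) : delta x y = if x = y then 1 else 0 := Finsupp.single_apply

lemma delta_nonneg (x : G.Point) : 0 ≤ delta x := by
  classical
  intro y
  rw [delta_apply]
  split_ifs <;> simp

lemma delta_injective : Function.Injective (delta : G.Point → G.Divisor) :=
  Finsupp.single_left_injective one_ne_zero

/-- Linear equivalence of divisors. -/
def LinEquiv (D D' : G.Divisor) : Prop := ∃ f, PL f ∧ ∀ x, divZ f x = D x - D' x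

lemma isPrincipal_sub_iff {D D' : G.Divisor} :
    Divisor.IsPrincipal (D - D') ↔ LinEquiv D D' := by
  constructor
  · rintro ⟨f, hf, h⟩
    rw [isRational_iff] at hf
    refine ⟨f, hf, fun x => ?_⟩
    have h1 := h x
    rw [hf.divFun_eq] at h1
    have h2 : (D - D') x = divZ f x := by exact_mod_cast h1
    rw [← h2, Finsupp.sub_apply]
  · rintro ⟨f, hf, h⟩
    refine ⟨f, isRational_iff.2 hf, fun x => ?_⟩
    rw [hf.divFun_eq, h, Finsupp.sub_apply]

lemma LinEquiv.refl (D : G.Divisor) : LinEquiv D D :=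
  ⟨_, pl_const 0, fun x => by rw [divZ_const, sub_self]⟩

lemma LinEquiv.symm {D D' : G.Divisor} (h : LinEquiv D D') : LinEquiv D' D := by
  obtain ⟨f, hf, hd⟩ := h
  exact ⟨-f, hf.neg, fun x => by rw [hf.divZ_neg, hd]; ring⟩

lemma LinEquiv.add {D D' F F' : G.Divisor} (h : LinEquiv D D') (h' : LinEquiv F F') :
    LinEquiv (D + F) (D' + F') := by
  obtain ⟨f, hf, hd⟩ := h
  obtain ⟨g, hg, hd'⟩ := h'
  refine ⟨f + g, hf.add hg, fun x => ?_⟩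
  rw [hf.divZ_add hg, hd, hd', Finsupp.add_apply, Finsupp.add_apply]
  ring

lemma LinEquiv.trans {D D' D'' : G.Divisor} (h : LinEquiv D D') (h' : LinEquiv D' D'') :
    LinEquiv D D'' := by
  obtain ⟨f, hf, hd⟩ := h
  obtain ⟨g, hg, hd'⟩ := h'
  refine ⟨f + g, hf.add hg, fun x => ?_⟩
  rw [hf.divZ_add hg, hd, hd']
  ring

lemma LinEquiv.add_right_cancel {D D' F : G.Divisor} (h : LinEquiv (D + F) (D' + F)) :
    LinEquiv D D' := by
  obtain ⟨f, hf, hd⟩ := h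
  refine ⟨f, hf, fun x => ?_⟩
  rw [hd, Finsupp.add_apply, Finsupp.add_apply]
  ring

lemma LinEquiv.add_left_cancel {D D' F : G.Divisor} (h : LinEquiv (F + D) (F + D')) :
    LinEquiv D D' := by
  rw [add_comm F, add_comm F] at h
  exact h.add_right_cancel

lemma PL.deg_eq_zero {f : G.Point → ℝ} (hf : PL f) {D : G.Divisor} (h : ∀ x, divZ f x = D x) :
    Divisor.deg D = 0 := by
  obtain ⟨T, hT, h0⟩ := hf.exists_support
  rw [← h0]
  refine (Finset.sum_subset (fun x hx => hT x ?_) fun x _ hx => ?_).trans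
    (Finset.sum_congr rfl fun x _ => (h x).symm)
  · rw [h]
    exact Finsupp.mem_support_iff.1 hx
  · exact Finsupp.notMem_support_iff.1 hx

lemma PL.exists_divisor {f : G.Point → ℝ} (hf : PL f) : ∃ D : G.Divisor, ∀ x, divZ f x = D x := by
  obtain ⟨T, hT, -⟩ := hf.exists_support
  exact ⟨Finsupp.onFinset T (divZ f) hT, fun x => rfl⟩

lemma LinEquiv.deg_eq {D D' : G.Divisor} (h : LinEquiv D D') :
    Divisor.deg D = Divisor.deg D' := by
  obtain ⟨f, hf, hd⟩ := h
  have := hf.deg_eq_zero (D := D - D') fun x => by rw [hd, Finsupp.sub_apply]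
  rw [deg_sub] at this
  linarith

lemma deg_nonneg {F : G.Divisor} (hF : 0 ≤ F) : 0 ≤ Divisor.deg F :=
  Finset.sum_nonneg fun x _ => hF x

lemma eq_zero_of_deg_eq_zero {F : G.Divisor} (hF : 0 ≤ F) (h : Divisor.deg F = 0) : F = 0 := by
  ext x
  by_contra hx
  have h1 := (Finset.sum_eq_zero_iff_of_nonneg (s := F.support) fun x _ => hF x).1 h x
    (Finsupp.mem_support_iff.2 hx)
  exact hx h1

lemma exists_eq_add_delta {F : G.Divisor} (hF : 0 ≤ F) {x : G.Point} (hx : 1 ≤ F x) :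
    ∃ F', 0 ≤ F' ∧ F = F' + delta x ∧ Divisor.deg F' = Divisor.deg F - 1 := by
  classical
  refine ⟨F - delta x, fun y => ?_, by simp, by rw [deg_sub, deg_delta]⟩
  rw [Finsupp.sub_apply, delta_apply]
  have := hF y
  split_ifs with h
  · subst h
    simpa using hx
  · simpa using this

lemma exists_pos_of_deg_pos {F : G.Divisor} (hF : 0 ≤ F) (h : 0 < Divisor.deg F) :
    ∃ x, 1 ≤ F x := by
  by_contra! hx
  have : F = 0 := by
    ext x
    have h1 := hF x
    have h2 := hx x
    simp only [Finsupp.coe_zero, Pi.zero_apply] at h1 ⊢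
    omega
  rw [this] at h
  exact lt_irrefl _ (h.trans_eq Finsupp.sum_zero_index)

lemma eq_delta_of_deg_one {F : G.Divisor} (hF : 0 ≤ F) (h : Divisor.deg F = 1) {x : G.Point}
    (hx : 1 ≤ F x) : F = delta x := by
  obtain ⟨F', hF', rfl, hd⟩ := exists_eq_add_delta hF hx
  rw [eq_zero_of_deg_eq_zero hF' (by rw [hd, h]; rfl), zero_add]

lemma exists_eq_delta {F : G.Divisor} (hF : 0 ≤ F) (h : Divisor.deg F = 1) :
    ∃ x, F = delta x := by
  obtain ⟨x, hx⟩ := exists_pos_of_deg_pos hF (by rw [h]; exact one_pos)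
  exact ⟨x, eq_delta_of_deg_one hF h hx⟩

lemma exists_eq_delta_add {F : G.Divisor} (hF : 0 ≤ F) (h : Divisor.deg F = 2) {x : G.Point}
    (hx : 1 ≤ F x) : ∃ y, F = delta x + delta y := by
  obtain ⟨F', hF', rfl, hd⟩ := exists_eq_add_delta hF hx
  obtain ⟨y, rfl⟩ := exists_eq_delta hF' (by rw [hd, h]; rfl)
  exact ⟨y, add_comm _ _⟩

/-! ### Maximum principle -/

lemma PL.exists_isMax (hconn : G.Connected) [Nonempty G.E] {f : G.Point → ℝ} (hf : PL f) :
    ∃ x, ∀ y, f y ≤ f x := by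
  have h1 : ∀ d : G.Dart, ∃ s ∈ Icc 0 (G.len d.1), ∀ t ∈ Icc 0 (G.len d.1),
      f (G.dpt d t) ≤ f (G.dpt d s) := fun d =>
    isCompact_Icc.exists_isMaxOn (nonempty_Icc.2 (dart_len_pos d).le) (hf.continuousOn d)
  choose s _ hs using h1
  obtain ⟨d, -, hd⟩ := Finset.exists_max_image (Finset.univ : Finset G.Dart)
    (fun d => f (G.dpt d (s d))) Finset.univ_nonempty
  refine ⟨G.dpt d (s d), fun y => ?_⟩
  obtain ⟨d', t, ht, rfl⟩ := hconn.exists_dpt_eq y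
  exact (hs d' t ⟨ht.1, ht.2.le⟩).trans (hd d' (Finset.mem_univ _))

lemma PL.slope_nonpos_of_isMax {f : G.Point → ℝ} (hf : PL f) {x : G.Point}
    (hx : ∀ y, f y ≤ f x) {p : G.Dart × ℝ} (hp : p ∈ G.dirs x) : slope f p ≤ 0 := by
  have h := hf.hasSlope' hp
  obtain ⟨u, hu, hu'⟩ := (h.and self_mem_nhdsWithin).exists
  rw [(mem_dirs.1 hp).2] at hu
  have h1 := hx (G.dpt p.1 u)
  have h2 : 0 < u - p.2 := sub_pos.2 hu'
  by_contra! h3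
  have h4 : (0 : ℝ) < slope f p := by exact_mod_cast h3
  nlinarith

lemma PL.slope_eq_zero_of_isMax {f : G.Point → ℝ} (hf : PL f) {x : G.Point}
    (hx : ∀ y, f y ≤ f x) (hd : 0 ≤ divZ f x) {p : G.Dart × ℝ} (hp : p ∈ G.dirs x) :
    slope f p = 0 := by
  have h1 : ∀ q ∈ G.dirs x, slope f q ≤ 0 := fun q hq => hf.slope_nonpos_of_isMax hx hq
  have h2 : divZ f x = 0 := le_antisymm (Finset.sum_nonpos h1) hd
  exact (Finset.sum_eq_zero_iff_of_nonpos h1).1 h2 p hp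

/-- A function whose slope vanishes as long as it has the value `M` keeps this value. -/
lemma PL.eq_on_segment {f : G.Point → ℝ} (hf : PL f) {M : ℝ} {d : G.Dart} {a b : ℝ} (ha : 0 ≤ a)
    (hb : b ≤ G.len d.1) (hM : f (G.dpt d a) = M)
    (h : ∀ s ∈ Ico a b, f (G.dpt d s) = M → slope f (d, s) = 0) {s : ℝ} (hs : s ∈ Icc a b) :
    f (G.dpt d s) = M := by
  have hcl : IsClosed ({s | f (G.dpt d s) = M} ∩ Icc a b) := by
    rw [inter_comm]
    exact ((hf.continuousOn d).mono (Icc_subset_Icc ha hb)).preimage_isClosed_of_isClosed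
      isClosed_Icc (isClosed_singleton (x := M))
  refine IsClosed.Icc_subset_of_forall_mem_nhdsWithin hcl hM ?_ hs
  rintro t ⟨ht, ht'⟩
  have h1 := hf.hasSlope (d := d) (s := t) ⟨ha.trans ht'.1, ht'.2.trans_le hb⟩
  rw [h t ht' ht] at h1
  filter_upwards [h1] with u hu
  show f (G.dpt d u) = M
  rw [hu, show f (G.dpt d t) = M from ht]
  simp

/-- A function with effective divisor is constant. -/
lemma PL.eq_of_divZ_nonneg (hconn : G.Connected) [Nonempty G.E] {f : G.Point → ℝ} (hf : PL f)
    (h : ∀ x, 0 ≤ divZ f x) (x y : G.Point) : f x = f y := by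
  obtain ⟨z, hz⟩ := hf.exists_isMax hconn
  have hseg : ∀ d : G.Dart, ∀ a ∈ Icc 0 (G.len d.1), f (G.dpt d a) = f z →
      ∀ s ∈ Icc a (G.len d.1), f (G.dpt d s) = f z := by
    intro d a ha hM s hs
    refine hf.eq_on_segment ha.1 le_rfl hM (fun t ht hft => ?_) hs
    have htI : t ∈ Ico 0 (G.len d.1) := ⟨ha.1.trans ht.1, ht.2⟩
    exact hf.slope_eq_zero_of_isMax (x := G.dpt d t) (fun y => hft ▸ hz y) (h _)
      (mem_dirs_dpt htI)
  obtain ⟨d, s, hs, hdz⟩ := hconn.exists_dpt_eq z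
  have h0 : f (Point.vertex (G.head d)) = f z := by
    rw [← dpt_len]
    exact hseg d s ⟨hs.1, hs.2.le⟩ (by rw [hdz]) _ ⟨hs.2.le, le_rfl⟩
  have hv : ∀ v, f (Point.vertex v) = f z := by
    refine hconn.forall_vertex (fun d hd => ?_) h0
    rw [← dpt_len]
    exact hseg d 0 ⟨le_rfl, (dart_len_pos d).le⟩ (by rw [dpt_zero, hd]) _
      ⟨(dart_len_pos d).le, le_rfl⟩
  have hall : ∀ x, f x = f z := by
    intro x
    obtain ⟨d, s, hs, rfl⟩ := hconn.exists_dpt_eq x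
    exact hseg d 0 ⟨le_rfl, (dart_len_pos d).le⟩ (by rw [dpt_zero, hv]) _ ⟨hs.1, hs.2.le⟩
  rw [hall x, hall y]

lemma PL.divZ_trunc_nonneg {f : G.Point → ℝ} (hf : PL f) {c : ℝ} {x : G.Point} (h : f x ≤ c) :
    0 ≤ divZ (LengthGraph.trunc f c) x := by
  rcases eq_or_lt_of_le h with h | h
  · rw [hf.divZ_trunc_of_eq h]
    exact up_nonneg f x
  · rw [hf.divZ_trunc_of_gt h]

lemma PL.le_of_divZ_nonneg (hconn : G.Connected) [Nonempty G.E] {f : G.Point → ℝ} (hf : PL f)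
    {c : ℝ} (h : ∀ x, c < f x → 0 ≤ divZ f x) {x₀ : G.Point} (hx₀ : f x₀ ≤ c) (x : G.Point) :
    f x ≤ c := by
  have h1 := (hf.trunc c).eq_of_divZ_nonneg hconn (fun x => ?_) x x₀
  · rw [LengthGraph.trunc, LengthGraph.trunc, max_eq_right hx₀] at h1
    exact (le_max_left _ _).trans_eq h1
  · rcases le_or_gt (f x) c with h2 | h2
    · exact hf.divZ_trunc_nonneg h2
    · rw [hf.divZ_trunc_of_lt h2]
      exact h x h2

/-- If `f` falls along an edge from above `c` to at most `c`, then on the way there is a point at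
the level `c` from which `f` increases backwards. -/
lemma PL.exists_level {f : G.Point → ℝ} (hf : PL f) {d : G.Dart} {a b c : ℝ} (ha : 0 ≤ a)
    (hab : a ≤ b) (hb : b ≤ G.len d.1) (hca : c < f (G.dpt d a)) (hcb : f (G.dpt d b) ≤ c) :
    ∃ s ∈ Ioc a b, f (G.dpt d s) = c ∧ 0 < slope f (G.rev d, G.len d.1 - s) := by
  have hcont := (hf.continuousOn d).mono (Icc_subset_Icc ha hb)
  have hcomp : IsCompact (Icc a b ∩ (fun s => f (G.dpt d s)) ⁻¹' Iic c) :=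
    isCompact_Icc.of_isClosed_subset
      (hcont.preimage_isClosed_of_isClosed isClosed_Icc isClosed_Iic) inter_subset_left
  obtain ⟨s, ⟨hs, hsc⟩, hmin⟩ := hcomp.exists_isLeast ⟨b, ⟨hab, le_rfl⟩, hcb⟩
  have has : a < s := lt_of_le_of_ne hs.1 fun h => by
    rw [← h] at hsc
    exact absurd hca (not_lt.2 hsc)
  have hlt : ∀ᶠ t in 𝓝[<] s, c < f (G.dpt d t) := by
    filter_upwards [Ioo_mem_nhdsLT has] with t ht
    by_contra! h
    exact absurd (hmin ⟨⟨ht.1.le, ht.2.le.trans hs.2⟩, h⟩) (not_le.2 ht.2)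
  have hcs : c ≤ f (G.dpt d s) := by
    have h1 : Tendsto (fun t => f (G.dpt d t)) (𝓝[<] s) (𝓝 (f (G.dpt d s))) :=
      ((hcont s hs).mono_of_mem_nhdsWithin
        (mem_of_superset (Ioo_mem_nhdsLT has) fun t ht => ⟨ht.1.le, ht.2.le.trans hs.2⟩))
    exact ge_of_tendsto h1 (hlt.mono fun _ h => h.le)
  have hfs : f (G.dpt d s) = c := le_antisymm hsc hcs
  refine ⟨s, ⟨has, hs.2⟩, hfs, ?_⟩
  have h1 := hf.hasSlope (d := G.rev d) (s := G.len d.1 - s)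
    ⟨sub_nonneg.2 (hs.2.trans hb), sub_lt_self _ (ha.trans_lt has)⟩
  have h2 := (tendsto_const_sub_nhdsLT (G.len d.1) s).eventually h1
  obtain ⟨t, ⟨ht1, ht2⟩, ht3⟩ := ((h2.and hlt).and self_mem_nhdsWithin).exists
  simp only [dpt_rev, sub_sub_cancel] at ht1
  have ht3' : t < s := ht3
  rw [ht1, hfs] at ht2
  have h3 : (0 : ℝ) < slope f (G.rev d, G.len d.1 - s) := by
    by_contra! h
    nlinarith
  exact_mod_cast h3

/-- The effective divisor cut out by the truncation at the level `c` of a function whose divisor is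
a difference of effective divisors `D₁ - D₂`. -/
lemma PL.exists_level_divisor {f : G.Point → ℝ} (hf : PL f) {D₁ D₂ : G.Divisor} (h₁ : 0 ≤ D₁)
    (h₂ : 0 ≤ D₂) (hd : ∀ x, divZ f x = D₁ x - D₂ x) (c : ℝ) :
    ∃ F : G.Divisor, 0 ≤ F ∧ LinEquiv F D₂ ∧ (∀ x, c < f x → F x = D₁ x) ∧
      (∀ x, f x = c → F x = D₂ x + up f x) ∧ (∀ x, f x < c → F x = D₂ x) := by
  obtain ⟨E, hE⟩ := (hf.trunc c).exists_divisor
  have hgt : ∀ x, c < f x → (E + D₂) x = D₁ x := fun x hx => by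
    rw [Finsupp.add_apply, ← hE, hf.divZ_trunc_of_lt hx, hd]
    ring
  have heq : ∀ x, f x = c → (E + D₂) x = D₂ x + up f x := fun x hx => by
    rw [Finsupp.add_apply, ← hE, hf.divZ_trunc_of_eq hx, add_comm]
  have hlt : ∀ x, f x < c → (E + D₂) x = D₂ x := fun x hx => by
    rw [Finsupp.add_apply, ← hE, hf.divZ_trunc_of_gt hx, zero_add]
  refine ⟨E + D₂, fun x => ?_, ⟨_, hf.trunc c, fun x => ?_⟩, hgt, heq, hlt⟩
  · rcases lt_trichotomy (f x) c with h | h | h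
    · rw [hlt x h]
      exact h₂ x
    · rw [heq x h]
      exact add_nonneg (h₂ x) (up_nonneg f x)
    · rw [hgt x h]
      exact h₁ x
  · rw [hE, Finsupp.add_apply]
    ring

/-- Where `f` has a nonzero slope, the class of `D₁ ~ D₂` has an effective member through that
point. -/
lemma PL.exists_effective_of_slope_ne_zero {f : G.Point → ℝ} (hf : PL f) {D₁ D₂ : G.Divisor}
    (h₁ : 0 ≤ D₁) (h₂ : 0 ≤ D₂) (hd : ∀ x, divZ f x = D₁ x - D₂ x) {x : G.Point}
    {p : G.Dart × ℝ} (hp : p ∈ G.dirs x) (hs : slope f p ≠ 0) :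
    ∃ F : G.Divisor, 0 ≤ F ∧ LinEquiv F D₂ ∧ 1 ≤ F x := by
  have pos : ∀ {f : G.Point → ℝ} (_ : PL f) {D₁ D₂ : G.Divisor} (_ : 0 ≤ D₁)
      (_ : 0 ≤ D₂) (_ : ∀ x, divZ f x = D₁ x - D₂ x), 0 < slope f p →
      ∃ F : G.Divisor, 0 ≤ F ∧ LinEquiv F D₂ ∧ 1 ≤ F x := by
    intro f hf D₁ D₂ h₁ h₂ hd hs
    obtain ⟨F, hF, hFe, -, heq, -⟩ := hf.exists_level_divisor h₁ h₂ hd (f x)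
    refine ⟨F, hF, hFe, ?_⟩
    have := slope_le_up f hp
    have := h₂ x
    rw [heq x rfl]
    simp only [Finsupp.coe_zero, Pi.zero_apply] at this
    omega
  rcases lt_or_gt_of_ne hs with h | h
  · obtain ⟨F, hF, hFe, hx⟩ := pos hf.neg h₂ h₁
      (fun x => by rw [hf.divZ_neg, hd]; ring) (by rw [hf.slope_neg hp]; omega)
    exact ⟨F, hF, hFe.trans ⟨f, hf, hd⟩, hx⟩
  · exact pos hf h₁ h₂ hd h

/-! ### Functions that are linear on the edges -/

/-- The function with the values `h` at the vertices that is linear on every edge. -/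
noncomputable def ofVertex (h : G.V → ℝ) : G.Point → ℝ
  | Point.vertex v => h v
  | Point.interior e t _ _ => h (G.src e) + (h (G.tgt e) - h (G.src e)) * (t / G.len e)

/-- `n d` is the slope along `d` of the function with the values `h` at the vertices. -/
def IsSlope (h : G.V → ℝ) (n : G.Dart → ℤ) : Prop :=
  ∀ d, h (G.head d) - h (G.tail d) = n d * G.len d.1

lemma dpt_of_mem_Icc {P : G.Point → ℝ → Prop} {d : G.Dart} {s : ℝ} (hs : s ∈ Icc 0 (G.len d.1))
    (h0 : P (Point.vertex (G.tail d)) 0) (h1 : P (Point.vertex (G.head d)) (G.len d.1))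
    (h : s ∈ Ioo 0 (G.len d.1) → P (G.dpt d s) s) : P (G.dpt d s) s := by
  rcases eq_or_lt_of_le hs.1 with rfl | h2
  · simpa using h0
  rcases eq_or_lt_of_le hs.2 with rfl | h3
  · simpa using h1
  exact h ⟨h2, h3⟩

lemma ofVertex_dpt (h : G.V → ℝ) {d : G.Dart} {s : ℝ} (hs : s ∈ Icc 0 (G.len d.1)) :
    ofVertex h (G.dpt d s) = h (G.tail d) + (h (G.head d) - h (G.tail d)) * (s / G.len d.1) := by
  have hL := (dart_len_pos d).ne'
  refine dpt_of_mem_Icc (P := fun x s => ofVertex h x =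
    h (G.tail d) + (h (G.head d) - h (G.tail d)) * (s / G.len d.1)) hs ?_ ?_ fun hs' => ?_
  · simp [ofVertex]
  · rw [div_self hL]
    simp [ofVertex]
  · rcases d with ⟨e, _ | _⟩
    · rw [dpt_false' hs'.1 hs'.2]
      simp only [ofVertex, tail, head]
      simp only at hL
      simp only [Bool.false_eq_true, if_false]
      field_simp
      ring
    · rw [dpt_true hs'.1 hs'.2]
      simp [ofVertex, tail, head]

lemma IsSlope.hasSlope {h : G.V → ℝ} {n : G.Dart → ℤ} (hn : IsSlope h n) {d : G.Dart} {s : ℝ}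
    (hs : s ∈ Ico 0 (G.len d.1)) : HasSlope (ofVertex h) (d, s) (n d) := by
  have hL := (dart_len_pos d).ne'
  filter_upwards [Ioo_mem_nhdsGT hs.2] with u hu
  rw [ofVertex_dpt h ⟨hs.1.trans hu.1.le, hu.2.le⟩, ofVertex_dpt h ⟨hs.1, hs.2.le⟩, hn d]
  field_simp
  ring

lemma IsSlope.pl {h : G.V → ℝ} {n : G.Dart → ℤ} (hn : IsSlope h n) : PL (ofVertex h) :=
  fun _ _ hs => ⟨_, hn.hasSlope hs⟩

lemma IsSlope.rev {h : G.V → ℝ} {n : G.Dart → ℤ} (hn : IsSlope h n) (d : G.Dart) :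
    n (G.rev d) = -n d := by
  have h1 := hn d
  have h2 := hn (G.rev d)
  rw [head_rev, tail_rev, rev_fst] at h2
  have h3 : ((n (G.rev d) : ℝ) + n d) * G.len d.1 = 0 := by linarith
  rcases mul_eq_zero.1 h3 with h4 | h4
  · have h5 : n (G.rev d) + n d = 0 := by exact_mod_cast h4
    linarith
  · exact absurd h4 (dart_len_pos d).ne'

lemma IsSlope.divZ_dpt {h : G.V → ℝ} {n : G.Dart → ℤ} (hn : IsSlope h n) {d : G.Dart} {s : ℝ}
    (hs : s ∈ Ioo 0 (G.len d.1)) : divZ (ofVertex h) (G.dpt d s) = 0 := by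
  rw [LengthGraph.divZ_dpt _ hs, (hn.hasSlope ⟨hs.1.le, hs.2⟩).slope_eq,
    (hn.hasSlope (d := G.rev d) ⟨by simp [hs.2.le], by simp [hs.1]⟩).slope_eq, hn.rev,
    add_neg_cancel]

open Classical in
lemma IsSlope.divZ_vertex {h : G.V → ℝ} {n : G.Dart → ℤ} (hn : IsSlope h n) (v : G.V) :
    divZ (ofVertex h) (Point.vertex v) =
      ∑ d ∈ Finset.univ.filter (fun d : G.Dart => G.tail d = v), n d := by
  rw [divZ, sum_dirs_vertex]
  exact Finset.sum_congr rfl fun d _ => (hn.hasSlope ⟨le_rfl, dart_len_pos d⟩).slope_eq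

/-! ### The tent on an edge -/

open Classical in
/-- The function that on the edge `e₀` is the distance to the nearer end, and zero elsewhere. -/
noncomputable def tent (e₀ : G.E) : G.Point → ℝ
  | Point.vertex _ => 0
  | Point.interior e t _ _ => if e = e₀ then min t (G.len e - t) else 0

open Classical in
lemma tent_dpt (e₀ : G.E) {d : G.Dart} {s : ℝ} (hs : s ∈ Icc 0 (G.len d.1)) :
    tent e₀ (G.dpt d s) = if d.1 = e₀ then min s (G.len d.1 - s) else 0 := by
  have hL := (dart_len_pos d).le
  refine dpt_of_mem_Icc (P := fun x s => tent e₀ x =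
    if d.1 = e₀ then min s (G.len d.1 - s) else 0) hs ?_ ?_ fun hs' => ?_
  · simp [tent, hL]
  · simp [tent, hL]
  · rcases d with ⟨e, _ | _⟩
    · rw [dpt_false' hs'.1 hs'.2]
      simp [tent, min_comm]
    · rw [dpt_true hs'.1 hs'.2]
      simp [tent]

open Classical in
lemma hasSlope_tent (e₀ : G.E) {d : G.Dart} {s : ℝ} (hs : s ∈ Ico 0 (G.len d.1)) :
    HasSlope (tent e₀) (d, s)
      (if d.1 = e₀ then (if s < G.len d.1 / 2 then 1 else -1) else 0) := by
  have h1 : ∀ᶠ u in 𝓝[>] s, s < u ∧ u < G.len d.1 ∧ (s < G.len d.1 / 2 → u < G.len d.1 / 2) := by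
    filter_upwards [Ioo_mem_nhdsGT hs.2, (eventually_imp_distrib_left.2 fun h =>
      Ioo_mem_nhdsGT h : ∀ᶠ u in 𝓝[>] s, s < G.len d.1 / 2 → u ∈ Ioo s (G.len d.1 / 2))]
      with u hu hu'
    exact ⟨hu.1, hu.2, fun h => (hu' h).2⟩
  filter_upwards [h1] with u hu
  rw [tent_dpt _ ⟨hs.1.trans hu.1.le, hu.2.1.le⟩, tent_dpt _ ⟨hs.1, hs.2.le⟩]
  split_ifs with h2 h3
  · have := hu.2.2 h3
    rw [min_eq_left (by linarith), min_eq_left (by linarith)]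
    push_cast
    ring
  · rw [min_eq_right (by linarith), min_eq_right (by linarith)]
    push_cast
    ring
  · simp

lemma pl_tent (e₀ : G.E) : PL (tent e₀) := fun _ _ hs => ⟨_, hasSlope_tent e₀ hs⟩

lemma divZ_tent (e₀ : G.E) (x : G.Point) :
    divZ (tent e₀) x = (delta (Point.vertex (G.src e₀)) + delta (Point.vertex (G.tgt e₀))) x -
      (delta (G.dpt (e₀, true) (G.len e₀ / 2)) + delta (G.dpt (e₀, true) (G.len e₀ / 2))) x := by
  classical
  have hmid : G.len e₀ / 2 ∈ Ioo 0 (G.len e₀) :=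
    ⟨half_pos (G.len_pos e₀), half_lt_self (G.len_pos e₀)⟩
  simp only [Finsupp.add_apply, delta_apply]
  rcases x with v | ⟨e, t, h₀, h₁⟩
  · rw [divZ, sum_dirs_vertex, Finset.sum_congr rfl fun d _ =>
      (hasSlope_tent e₀ ⟨le_rfl, dart_len_pos d⟩).slope_eq, sum_filter_tail]
    simp only [half_pos (G.len_pos _), if_true, dpt_ne_vertex (d := (e₀, true)) hmid v, if_false,
      Point.vertex.injEq, Finset.sum_ite_eq', Finset.mem_filter, Finset.mem_univ, true_and]
    ring
  · rw [← dpt_true h₀ h₁, divZ_dpt _ ⟨h₀, h₁⟩, (hasSlope_tent e₀ ⟨h₀.le, h₁⟩).slope_eq,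
      (hasSlope_tent e₀ (d := G.rev (e, true)) ⟨by simp [h₁.le], by simp [h₀]⟩).slope_eq]
    have hv : ∀ v, Point.vertex v ≠ G.dpt (e, true) t := fun v h =>
      dpt_ne_vertex (d := (e, true)) ⟨h₀, h₁⟩ v h.symm
    have hm : G.dpt (e₀, true) (G.len e₀ / 2) = G.dpt (e, true) t ↔ e = e₀ ∧ t = G.len e / 2 := by
      constructor
      · intro h
        obtain rfl : e₀ = e := (fst_eq_of_dpt_eq (d := (e₀, true)) (d' := (e, true)) hmid
          ⟨h₀.le, h₁.le⟩ h).1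
        exact ⟨rfl, (dpt_injOn (e₀, true) hmid ⟨h₀, h₁⟩ h).symm⟩
      · rintro ⟨rfl, rfl⟩
        rfl
    simp only [hv, hm, if_false, rev_fst]
    by_cases h1 : e = e₀
    · simp only [h1, true_and, if_true]
      subst h1
      rcases lt_trichotomy t (G.len e / 2) with h2 | h2 | h2
      · rw [if_pos h2, if_neg (by linarith), if_neg h2.ne]
        norm_num
      · rw [if_neg h2.not_lt, if_neg (by linarith), if_pos h2]
        norm_num
      · rw [if_neg h2.not_gt, if_pos (by linarith), if_neg h2.ne']
        norm_num
    · simp [h1]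

/-- The sum of the two ends of an edge moves to a divisor through any given point of the edge. -/
lemma exists_effective_of_edge (d : G.Dart) {s : ℝ} (hs : s ∈ Ioo 0 (G.len d.1)) :
    ∃ F : G.Divisor, 0 ≤ F ∧
      LinEquiv F (delta (Point.vertex (G.tail d)) + delta (Point.vertex (G.head d))) ∧
      1 ≤ F (G.dpt d s) := by
  have h : delta (Point.vertex (G.tail d)) + delta (Point.vertex (G.head d)) =
      delta (Point.vertex (G.src d.1)) + delta (Point.vertex (G.tgt d.1)) := by
    rcases d with ⟨e, _ | _⟩
    · exact add_comm _ _
    · rfl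
  rw [h]
  obtain ⟨F, hF, hFe, hx⟩ := (pl_tent d.1).exists_effective_of_slope_ne_zero
    (add_nonneg (delta_nonneg _) (delta_nonneg _)) (add_nonneg (delta_nonneg _) (delta_nonneg _))
    (divZ_tent d.1) (mem_dirs_dpt ⟨hs.1.le, hs.2⟩) (by
      rw [(hasSlope_tent d.1 ⟨hs.1.le, hs.2⟩).slope_eq]
      split_ifs <;> simp_all)
  exact ⟨F, hF, hFe.trans (LinEquiv.symm ⟨_, pl_tent d.1, divZ_tent d.1⟩), hx⟩

/-! ### Bridges -/

/-- The vertex set `B` contains the head of `d` but not its tail, and no other edge leaves `B`. -/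
def IsCut (d : G.Dart) (B : Set G.V) : Prop :=
  G.tail d ∉ B ∧ G.head d ∈ B ∧ ∀ d' : G.Dart, d'.1 ≠ d.1 → (G.tail d' ∈ B ↔ G.head d' ∈ B)

/-- The edge `e` is a bridge. -/
def IsBridge (e : G.E) : Prop := ∃ (d : G.Dart) (B : Set G.V), d.1 = e ∧ IsCut d B

lemma IsCut.rev {d : G.Dart} {B : Set G.V} (h : IsCut d B) : IsCut (G.rev d) Bᶜ :=
  ⟨by simpa using h.2.1, by simpa using h.1, fun d' hd' => not_congr (h.2.2 d' hd')⟩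

lemma IsBridge.exists_isCut {d : G.Dart} (h : IsBridge d.1) : ∃ B, IsCut d B := by
  obtain ⟨d', B, hd, hB⟩ := h
  rcases eq_or_eq_rev_of_fst_eq hd with rfl | rfl
  · exact ⟨B, hB⟩
  · exact ⟨Bᶜ, by simpa using hB.rev⟩

/-- The function that is constant on the two sides of a bridge and has slope one on the bridge. -/
lemma IsCut.exists_fun {d : G.Dart} {B : Set G.V} (h : IsCut d B) :
    ∃ b : G.Point → ℝ, PL b ∧
      (∀ x, divZ b x = delta (Point.vertex (G.tail d)) x - delta (Point.vertex (G.head d)) x) ∧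
      b (Point.vertex (G.tail d)) = 0 ∧ b (Point.vertex (G.head d)) = G.len d.1 ∧
      ∀ s ∈ Ico 0 (G.len d.1), slope b (d, s) = 1 := by
  classical
  have hne : d ≠ G.rev d := (rev_ne d).symm
  set n : G.Dart → ℤ := fun d' => (if d' = d then 1 else 0) - (if d' = G.rev d then 1 else 0)
    with hn
  set b : G.V → ℝ := fun v => if v ∈ B then G.len d.1 else 0 with hb
  have hs : IsSlope b n := by
    intro d'
    by_cases hd : d'.1 = d.1
    · rcases eq_or_eq_rev_of_fst_eq hd with rfl | rfl
      · simp [hn, hb, h.1, h.2.1, hne]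
      · simp [hn, hb, h.1, h.2.1, rev_ne]
    · have h1 := h.2.2 d' hd
      have h2 : d' ≠ d := fun h => hd (by rw [h])
      have h3 : d' ≠ G.rev d := fun h => hd (by rw [h, rev_fst])
      simp [hn, hb, h1, h2, h3]
  refine ⟨ofVertex b, hs.pl, fun x => ?_, ?_, ?_, fun s hs' => ?_⟩
  · rcases vertex_or_dpt x with ⟨v, rfl⟩ | ⟨d', s, hs', rfl⟩
    · rw [hs.divZ_vertex, hn]
      simp [delta_apply, Finset.sum_sub_distrib]
    · rw [hs.divZ_dpt hs', delta_of_ne (dpt_ne_vertex hs' _), delta_of_ne (dpt_ne_vertex hs' _),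
        sub_self]
  · simp [ofVertex, hb, h.1]
  · simp [ofVertex, hb, h.2.1]
  · rw [(hs.hasSlope hs').slope_eq]
    simp [hn, hne]

lemma IsBridge.linEquiv {d : G.Dart} (h : IsBridge d.1) :
    LinEquiv (delta (Point.vertex (G.tail d))) (delta (Point.vertex (G.head d))) := by
  obtain ⟨B, hB⟩ := h.exists_isCut
  obtain ⟨b, hb, hd, -⟩ := hB.exists_fun
  exact ⟨b, hb, hd⟩

lemma IsBridge.linEquiv_dpt {d : G.Dart} (h : IsBridge d.1) {s : ℝ} (hs : s ∈ Ioo 0 (G.len d.1)) :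
    LinEquiv (delta (G.dpt d s)) (delta (Point.vertex (G.head d))) := by
  obtain ⟨B, hB⟩ := h.exists_isCut
  obtain ⟨b, hb, hd, -, -, hsl⟩ := hB.exists_fun
  obtain ⟨F, hF, hFe, hx⟩ := hb.exists_effective_of_slope_ne_zero (delta_nonneg _)
    (delta_nonneg _) hd (mem_dirs_dpt ⟨hs.1.le, hs.2⟩) (by rw [hsl s ⟨hs.1.le, hs.2⟩]; simp)
  rwa [eq_delta_of_deg_one hF (by rw [hFe.deg_eq, deg_delta]) hx] at hFe

/-- A point that is linearly equivalent to no other point. -/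
def Rigid (x : G.Point) : Prop := ∀ y, LinEquiv (delta y) (delta x) → y = x

/-- An inner point of an edge that is equivalent to another point lies on a bridge: the truncations
of the function `k` with divisor `y - x` are points, so each level of `k` contains a single point
with nonzero slopes, and the vertices with the maximal value of `k` are separated by the edge. -/
lemma isBridge_of_linEquiv (hconn : G.Connected) {d : G.Dart} {s : ℝ}
    (hs : s ∈ Ioo 0 (G.len d.1)) {y : G.Point} (hy : LinEquiv (delta y) (delta (G.dpt d s)))
    (hne : y ≠ G.dpt d s) : IsBridge d.1 := by
  have : Nonempty G.E := ⟨d.1⟩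
  obtain ⟨k, hk, hd⟩ := hy
  set M := k (G.dpt d s) with hM
  have hmax : ∀ z, k z ≤ M := by
    refine fun z => hk.le_of_divZ_nonneg hconn (fun x hx => ?_) (x₀ := G.dpt d s) le_rfl z
    have hx' : x ≠ G.dpt d s := fun h => by simp [h] at hx
    rw [hd, delta_of_ne hx', sub_zero]
    exact delta_nonneg y x
  have huniq : ∀ z z', k z = k z' → 0 < up k z → 0 < up k z' → z = z' := by
    intro z z' hzz hz hz'
    obtain ⟨F, hF, hFe, -, heq, -⟩ :=
      hk.exists_level_divisor (delta_nonneg _) (delta_nonneg _) hd (k z)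
    have hdeg : Divisor.deg F = 1 := by rw [hFe.deg_eq, deg_delta]
    have h1 : ∀ w, k w = k z → 0 < up k w → F = delta w := by
      intro w hw hw'
      refine eq_delta_of_deg_one hF hdeg ?_
      rw [heq w hw]
      have := delta_nonneg (G.dpt d s) w
      simp only [Finsupp.coe_zero, Pi.zero_apply] at this
      omega
    exact delta_injective ((h1 z rfl hz).symm.trans (h1 z' hzz.symm hz'))
  -- it is enough to treat the orientation in which `k` decreases
  suffices key : ∀ (d : G.Dart) (s : ℝ), s ∈ Ioo 0 (G.len d.1) → k (G.dpt d s) = M →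
      (∀ z, k z = M → z ≠ G.dpt d s → 0 ≤ divZ k z) → slope k (d, s) = -1 →
      slope k (G.rev d, G.len d.1 - s) = 0 → IsBridge d.1 by
    have hpos : ∀ z, k z = M → z ≠ G.dpt d s → 0 ≤ divZ k z := by
      intro z _ hz
      rw [hd, delta_of_ne hz, sub_zero]
      exact delta_nonneg y z
    have h1 := hk.slope_nonpos_of_isMax hmax (mem_dirs_dpt ⟨hs.1.le, hs.2⟩)
    have h2 := hk.slope_nonpos_of_isMax hmax (mem_dirs_rev ⟨hs.1, hs.2.le⟩)
    have h3 := divZ_dpt k hs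
    rw [hd, delta_self, delta_of_ne hne.symm] at h3
    rcases eq_or_ne (slope k (d, s)) 0 with h4 | h4
    · refine key (G.rev d) (G.len d.1 - s) ⟨by simp [hs.2], by simp [hs.1]⟩ ?_ ?_ ?_ ?_
      · rw [dpt_rev, sub_sub_cancel]
      · rw [dpt_rev, sub_sub_cancel]
        exact hpos
      · omega
      · simpa using h4
    · exact key d s hs rfl hpos (by omega) (by omega)
  clear hne hs hM hd
  intro d s hs hM hpos hsl hsl'
  obtain ⟨s₁, hs₁, hs₁'⟩ : ∃ s₁ ∈ Ioo s (G.len d.1), k (G.dpt d s₁) < M := by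
    have h1 := hk.hasSlope (d := d) ⟨hs.1.le, hs.2⟩
    obtain ⟨u, hu, hu'⟩ := (h1.and (Ioo_mem_nhdsGT hs.2)).exists
    refine ⟨u, hu', ?_⟩
    rw [hu, hsl, hM]
    push_cast
    linarith [hu'.1]
  have hlevel : ∀ c, k (G.dpt d s₁) < c → c < M → ∃ t ∈ Ioo s s₁, k (G.dpt d t) = c ∧
      0 < up k (G.dpt d t) := by
    intro c hc hc'
    obtain ⟨t, ht, htc, htp⟩ := hk.exists_level hs.1.le hs₁.1.le hs₁.2.le (hM ▸ hc') hc.le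
    refine ⟨t, ⟨ht.1, lt_of_le_of_ne ht.2 ?_⟩, htc, htp.trans_le (slope_le_up k
      (mem_dirs_rev ⟨hs.1.trans ht.1, ht.2.trans hs₁.2.le⟩))⟩
    rintro rfl
    exact hc.ne htc
  have htail : k (Point.vertex (G.tail d)) = M := by
    have h1 := hk.eq_on_segment (M := M) (d := G.rev d) (a := G.len d.1 - s) (b := G.len d.1)
      (sub_nonneg.2 hs.2.le) le_rfl (by rw [dpt_rev, sub_sub_cancel, hM]) (fun t ht htM => ?_)
      (s := G.len d.1) ⟨by linarith [hs.1], le_rfl⟩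
    · rwa [dpt_rev, sub_self, dpt_zero] at h1
    · rcases eq_or_lt_of_le ht.1 with rfl | h2
      · exact hsl'
      · refine hk.slope_eq_zero_of_isMax (fun z => (hmax z).trans_eq htM.symm) (hpos _ htM ?_)
          (mem_dirs_dpt ⟨(sub_nonneg.2 hs.2.le).trans ht.1, ht.2⟩)
        rw [dpt_rev]
        intro h3
        have := dpt_injOn d ⟨by linarith [ht.2], by linarith [hs.2]⟩ hs h3
        linarith
  have hhead : k (Point.vertex (G.head d)) ≠ M := by
    intro hh
    obtain ⟨c, hc, hc'⟩ := exists_between hs₁'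
    obtain ⟨t, ht, htc, htp⟩ := hlevel c hc hc'
    obtain ⟨t', ht', htc', htp'⟩ := hk.exists_level (d := G.rev d) (a := 0) (b := G.len d.1 - s₁)
      (c := c) le_rfl (sub_nonneg.2 hs₁.2.le) (by simp only [rev_fst]; linarith [hs.1, hs₁.1])
      (by rw [dpt_zero, tail_rev, hh]; exact hc') (by rw [dpt_rev, sub_sub_cancel]; exact hc.le)
    have h1 := htp'.trans_le (slope_le_up k (x := G.dpt (G.rev d) t')
      (mem_dirs_rev ⟨ht'.1, ht'.2.trans (by simp only [rev_fst]; linarith [hs.1, hs₁.1])⟩))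
    have h2 := huniq _ _ (htc.trans htc'.symm) htp h1
    rw [dpt_rev] at h2
    have h3 := dpt_injOn d ⟨hs.1.trans ht.1, ht.2.trans hs₁.2⟩
      ⟨by linarith [ht'.2, hs.1, hs₁.1], by linarith [ht'.1]⟩ h2
    linarith [ht.2, ht'.2]
  have hother : ∀ d' : G.Dart, d'.1 ≠ d.1 → k (Point.vertex (G.tail d')) = M →
      k (Point.vertex (G.head d')) = M := by
    intro d' hd' ht'
    by_contra hh
    have hlt : max (k (Point.vertex (G.head d'))) (k (G.dpt d s₁)) < M :=
      max_lt (lt_of_le_of_ne (hmax _) hh) hs₁'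
    obtain ⟨c, hc, hc'⟩ := exists_between hlt
    obtain ⟨t, ht, htc, htp⟩ := hlevel c ((le_max_right _ _).trans_lt hc) hc'
    obtain ⟨t', ht', htc', htp'⟩ := hk.exists_level (d := d') (a := 0) (b := G.len d'.1)
      (c := c) le_rfl (dart_len_pos d').le le_rfl (by rw [dpt_zero, ht']; exact hc')
      (by rw [dpt_len]; exact ((le_max_left _ _).trans_lt hc).le)
    have h2 := huniq _ _ (htc.trans htc'.symm) htp (htp'.trans_le (slope_le_up k
      (mem_dirs_rev ht')))
    exact hd' (fst_eq_of_dpt_eq ⟨hs.1.trans ht.1, ht.2.trans hs₁.2⟩ ⟨ht'.1.le, ht'.2⟩ h2).1.symm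
  refine ⟨d, {v | k (Point.vertex v) ≠ M}, rfl, by simpa using htail, hhead, fun d' hd' => ?_⟩
  refine not_congr ⟨hother d' hd', fun h => ?_⟩
  have := hother (G.rev d') hd'
  rw [tail_rev, head_rev] at this
  exact this h

lemma rigid_of_not_isBridge (hconn : G.Connected) {d : G.Dart} (h : ¬ IsBridge d.1) {s : ℝ}
    (hs : s ∈ Ioo 0 (G.len d.1)) : Rigid (G.dpt d s) := by
  intro y hy
  by_contra hne
  exact h (isBridge_of_linEquiv hconn hs hy hne)

lemma exists_isBridge_of_not_rigid (hconn : G.Connected) [Nonempty G.E] {x : G.Point}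
    (hx : ¬ Rigid x) :
    ∃ d : G.Dart, IsBridge d.1 ∧ LinEquiv (delta x) (delta (Point.vertex (G.tail d))) := by
  rw [Rigid] at hx
  push Not at hx
  obtain ⟨y, hy, hne⟩ := hx
  rcases vertex_or_dpt x with ⟨v, rfl⟩ | ⟨d, s, hs, rfl⟩
  · obtain ⟨k, hk, hd⟩ := hy
    have hdiv := hd (Point.vertex v)
    rw [delta_self, delta_of_ne hne.symm] at hdiv
    obtain ⟨p, hp, hps⟩ : ∃ p ∈ G.dirs (Point.vertex v), slope k p ≠ 0 := by
      by_contra! h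
      rw [divZ, Finset.sum_eq_zero h] at hdiv
      omega
    obtain ⟨d, s⟩ := p
    obtain ⟨rfl, rfl⟩ := mem_dirs_vertex.1 hp
    have hL := dart_len_pos d
    obtain ⟨u, hu, hu'⟩ :=
      ((hk.eventually_slope_right (d := d) ⟨le_rfl, hL⟩).and (Ioo_mem_nhdsGT hL)).exists
    obtain ⟨F, hF, hFe, hFx⟩ := hk.exists_effective_of_slope_ne_zero (delta_nonneg _)
      (delta_nonneg _) hd (mem_dirs_dpt ⟨hu'.1.le, hu'.2⟩) (by rw [hu.1]; exact hps)
    rw [eq_delta_of_deg_one hF (by rw [hFe.deg_eq, deg_delta]) hFx] at hFe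
    exact ⟨d, isBridge_of_linEquiv hconn hu' hFe.symm (dpt_ne_vertex hu' _).symm,
      LinEquiv.refl _⟩
  · have hbr : IsBridge d.1 := isBridge_of_linEquiv hconn hs hy hne
    refine ⟨G.rev d, hbr, ?_⟩
    rw [tail_rev]
    exact hbr.linEquiv_dpt hs

/-- Since there are no points of valence `1`, each side of a bridge contains an edge that is not a
bridge: otherwise go on to a bridge that cuts off a smaller side. -/
lemma IsCut.exists_not_isBridge (hconn : G.Connected) (hval : ∀ x : G.Point, G.val x ≠ 1) :
    ∀ (n : ℕ) (d : G.Dart) (B : Set G.V), IsCut d B → B.ncard = n →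
      ∃ d' : G.Dart, ¬ IsBridge d'.1 ∧ d'.1 ≠ d.1 ∧ G.tail d' ∈ B := by
  intro n
  induction n using Nat.strong_induction_on with
  | _ n ih =>
    intro d B hB hn
    obtain ⟨d', hd', hne⟩ : ∃ d', G.tail d' = G.head d ∧ d' ≠ G.rev d := by
      by_contra! h
      refine hval (Point.vertex (G.head d)) ?_
      rw [val_eq_card_dirs, Finset.card_eq_one]
      refine ⟨(G.rev d, 0), Finset.eq_singleton_iff_unique_mem.2 ⟨?_, ?_⟩⟩
      · exact mem_dirs_vertex.2 ⟨rfl, tail_rev d⟩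
      · rintro ⟨d'', s⟩ hp
        obtain ⟨rfl, h1⟩ := mem_dirs_vertex.1 hp
        rw [h d'' h1]
    have hfst : d'.1 ≠ d.1 := by
      intro h
      rcases eq_or_eq_rev_of_fst_eq h with rfl | rfl
      · exact hB.1 (hd' ▸ hB.2.1)
      · exact hne rfl
    have htB : G.tail d' ∈ B := hd' ▸ hB.2.1
    by_cases hbr : IsBridge d'.1
    · obtain ⟨B', hB'⟩ := hbr.exists_isCut
      have hsub : B' ⊆ B := by
        intro v hv
        by_contra hvB
        -- no edge leaves the set `B' \ B`, which does not contain the head of `d`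
        have hC := hconn.forall_vertex (P := fun v => v ∈ B' ∧ v ∉ B) (fun d₁ h₁ => ?_)
          (v₀ := v) ⟨hv, hvB⟩ (G.head d)
        · exact hC.2 hB.2.1
        · by_cases e1 : d₁.1 = d.1
          · exfalso
            have h2 : G.tail d ∉ B' := fun h => hB'.1 (hd' ▸ (hB'.2.2 d hfst.symm).1 h)
            rcases eq_or_eq_rev_of_fst_eq e1 with rfl | rfl
            · exact h2 h₁.1
            · rw [tail_rev] at h₁
              exact h₁.2 hB.2.1
          · by_cases e2 : d₁.1 = d'.1
            · exfalso
              have h2 : G.head d' ∈ B := (hB.2.2 d' hfst).1 htB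
              rcases eq_or_eq_rev_of_fst_eq e2 with rfl | rfl
              · exact h₁.2 htB
              · rw [tail_rev] at h₁
                exact h₁.2 h2
            · exact ⟨(hB'.2.2 d₁ e2).1 h₁.1, fun h => h₁.2 ((hB.2.2 d₁ e1).2 h)⟩
      have hssub : B' ⊂ B := ⟨hsub, fun h => hB'.1 (h htB)⟩
      obtain ⟨d'', h1, h2, h3⟩ := ih B'.ncard
        (hn ▸ Set.ncard_lt_ncard hssub (Set.toFinite B)) d' B' hB' rfl
      refine ⟨d'', h1, fun h => ?_, hsub h3⟩
      rcases eq_or_eq_rev_of_fst_eq h with rfl | rfl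
      · exact hB.1 (hsub h3)
      · have h4 := (hB'.2.2 _ h2).1 h3
        rw [head_rev] at h4
        exact hB.1 (hsub h4)
    · exact ⟨d', hbr, hfst, htB⟩

lemma exists_not_isBridge (hconn : G.Connected) [hE : Nonempty G.E]
    (hval : ∀ x : G.Point, G.val x ≠ 1) : ∃ d : G.Dart, ¬ IsBridge d.1 := by
  obtain ⟨e⟩ := hE
  by_cases h : IsBridge e
  · obtain ⟨d, B, -, hB⟩ := h
    obtain ⟨d', hd', -⟩ := hB.exists_not_isBridge hconn hval _ d B rfl
    exact ⟨d', hd'⟩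
  · exact ⟨(e, true), h⟩

/-! ### Restriction to one side of a bridge -/

/-- The points on the side `B` of the bridge `e`, not counting the inner points of the bridge. -/
def OnSide (e : G.E) (B : Set G.V) : G.Point → Prop
  | Point.vertex v => v ∈ B
  | Point.interior e' _ _ _ => e' ≠ e ∧ G.src e' ∈ B

lemma IsCut.src_mem_iff {d : G.Dart} {B : Set G.V} (h : IsCut d B) {d' : G.Dart}
    (hd : d'.1 ≠ d.1) : G.src d'.1 ∈ B ↔ G.tail d' ∈ B := by
  rcases d' with ⟨e, _ | _⟩
  · exact (h.2.2 (e, false) hd).symm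
  · exact Iff.rfl

lemma IsCut.onSide_dpt {d : G.Dart} {B : Set G.V} (h : IsCut d B) {d' : G.Dart} {s : ℝ}
    (hs : s ∈ Icc 0 (G.len d'.1)) (hd : d'.1 ≠ d.1) :
    OnSide d.1 B (G.dpt d' s) ↔ G.tail d' ∈ B := by
  refine dpt_of_mem_Icc (P := fun x _ => OnSide d.1 B x ↔ G.tail d' ∈ B) hs Iff.rfl
    (h.2.2 d' hd).symm fun hs' => ?_
  rw [← h.src_mem_iff hd]
  rcases d' with ⟨e, _ | _⟩
  · rw [dpt_false' hs'.1 hs'.2]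
    exact ⟨fun h => h.2, fun h => ⟨hd, h⟩⟩
  · rw [dpt_true hs'.1 hs'.2]
    exact ⟨fun h => h.2, fun h => ⟨hd, h⟩⟩

lemma not_onSide_dpt {d : G.Dart} {B : Set G.V} {s : ℝ} (hs : s ∈ Ioo 0 (G.len d.1)) :
    ¬ OnSide d.1 B (G.dpt d s) := by
  rcases d with ⟨e, _ | _⟩
  · rw [dpt_false' hs.1 hs.2]
    exact fun h => h.1 rfl
  · rw [dpt_true hs.1 hs.2]
    exact fun h => h.1 rfl

open Classical in
/-- A function may be restricted to one side of a bridge and continued by a constant. This changes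
its divisor only on the other side and at the end of the bridge. -/
lemma IsCut.exists_restrict {d : G.Dart} {B : Set G.V} (h : IsCut d B) {g : G.Point → ℝ}
    (hg : PL g) : ∃ f, PL f ∧ ∃ m : ℤ, ∀ x, divZ f x =
      (if OnSide d.1 B x then divZ g x else 0) + m * delta (Point.vertex (G.head d)) x := by
  set c := g (Point.vertex (G.head d)) with hc
  set f : G.Point → ℝ := fun x => if OnSide d.1 B x then g x - c else 0 with hf
  have hslope : ∀ (d' : G.Dart) (s : ℝ), s ∈ Ico 0 (G.len d'.1) →
      HasSlope f (d', s) (if d'.1 ≠ d.1 ∧ G.tail d' ∈ B then slope g (d', s) else 0) := by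
    intro d' s hs
    have hs' : s ∈ Icc 0 (G.len d'.1) := ⟨hs.1, hs.2.le⟩
    by_cases hd : d'.1 = d.1
    · have hzero : ∀ u ∈ Icc 0 (G.len d'.1), f (G.dpt d' u) = 0 := by
        intro u hu
        have h1 : f (Point.vertex (G.tail d)) = 0 := if_neg h.1
        have h2 : f (Point.vertex (G.head d)) = 0 := (if_pos h.2.1).trans (sub_self _)
        refine dpt_of_mem_Icc (P := fun x _ => f x = 0) hu ?_ ?_ fun hu' => if_neg ?_
        · rcases eq_or_eq_rev_of_fst_eq hd with rfl | rfl
          · exact h1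
          · rwa [tail_rev]
        · rcases eq_or_eq_rev_of_fst_eq hd with rfl | rfl
          · exact h2
          · rwa [head_rev]
        · rw [← hd]
          exact not_onSide_dpt hu'
      rw [if_neg fun h => h.1 hd]
      filter_upwards [Ioo_mem_nhdsGT hs.2] with u hu
      rw [hzero u ⟨hs.1.trans hu.1.le, hu.2.le⟩, hzero s hs']
      simp
    · by_cases ht : G.tail d' ∈ B
      · rw [if_pos ⟨hd, ht⟩]
        filter_upwards [Ioo_mem_nhdsGT hs.2, hg.hasSlope hs] with u hu hu'
        simp only [hf]
        rw [if_pos ((h.onSide_dpt ⟨hs.1.trans hu.1.le, hu.2.le⟩ hd).2 ht),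
          if_pos ((h.onSide_dpt hs' hd).2 ht), hu']
        ring
      · rw [if_neg fun h => ht h.2]
        filter_upwards [Ioo_mem_nhdsGT hs.2] with u hu
        simp only [hf]
        rw [if_neg fun h' => ht ((h.onSide_dpt ⟨hs.1.trans hu.1.le, hu.2.le⟩ hd).1 h'),
          if_neg fun h' => ht ((h.onSide_dpt hs' hd).1 h')]
        simp
  refine ⟨f, fun d' s hs => ⟨_, hslope d' s hs⟩, -slope g (G.rev d, 0), fun x => ?_⟩
  rcases vertex_or_dpt x with ⟨v, rfl⟩ | ⟨d', s, hs, rfl⟩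
  · rw [divZ, divZ, sum_dirs_vertex, sum_dirs_vertex]
    have h1 : ∀ d' ∈ Finset.univ.filter (fun d' : G.Dart => G.tail d' = v), slope f (d', 0) =
        if d'.1 ≠ d.1 ∧ v ∈ B then slope g (d', 0) else 0 := by
      intro d' hd'
      rw [(hslope d' 0 ⟨le_rfl, dart_len_pos d'⟩).slope_eq, (Finset.mem_filter.1 hd').2]
    rw [Finset.sum_congr rfl h1]
    by_cases hv : v ∈ B
    · rw [if_pos (show OnSide d.1 B (Point.vertex v) from hv)]
      have h2 : ∀ d' ∈ Finset.univ.filter (fun d' : G.Dart => G.tail d' = v),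
          (if d'.1 ≠ d.1 ∧ v ∈ B then slope g (d', 0) else 0) =
            slope g (d', 0) - if d' = G.rev d then slope g (G.rev d, 0) else 0 := by
        intro d' hd'
        have hd'' := (Finset.mem_filter.1 hd').2
        by_cases hd : d'.1 = d.1
        · rcases eq_or_eq_rev_of_fst_eq hd with rfl | rfl
          · exact absurd (hd'' ▸ hv) h.1
          · simp
        · have : d' ≠ G.rev d := fun h => hd (by rw [h, rev_fst])
          simp [hd, hv, this]
      rw [Finset.sum_congr rfl h2, Finset.sum_sub_distrib, Finset.sum_ite_eq', delta_apply]
      simp only [Finset.mem_filter, Finset.mem_univ, true_and, tail_rev, Point.vertex.injEq]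
      split_ifs <;> ring
    · rw [if_neg (show ¬ OnSide d.1 B (Point.vertex v) from hv), delta_of_ne]
      · simp [hv]
      · intro h'
        cases h'
        exact hv h.2.1
  · rw [divZ_dpt _ hs, divZ_dpt _ hs, (hslope d' s ⟨hs.1.le, hs.2⟩).slope_eq,
      (hslope (G.rev d') (G.len d'.1 - s) ⟨by simp [hs.2.le], by simp [hs.1]⟩).slope_eq,
      delta_of_ne (dpt_ne_vertex hs _), mul_zero, add_zero, rev_fst, tail_rev]
    by_cases hd : d'.1 = d.1
    · rw [if_neg fun h => h.1 hd, if_neg fun h => h.1 hd, if_neg, add_zero]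
      rw [← hd]
      exact not_onSide_dpt hs
    · have h1 := h.onSide_dpt ⟨hs.1.le, hs.2.le⟩ hd
      have h2 := h.2.2 d' hd
      by_cases ht : G.tail d' ∈ B
      · rw [if_pos ⟨hd, ht⟩, if_pos ⟨hd, h2.1 ht⟩, if_pos (h1.2 ht)]
      · rw [if_neg fun h => ht h.2, if_neg fun h => ht (h2.2 h.2), if_neg fun h => ht (h1.1 h),
          add_zero]

/-! ### Divisors of degree two and positive rank -/

/-- Every point lies in the support of an effective divisor of degree two equivalent to `D`. -/
def Moves (D : G.Divisor) : Prop := ∀ x, ∃ y, LinEquiv (delta x + delta y) D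

/-- If `D` moves, then twice an end of a bridge is equivalent to `D`: on the side of the bridge
there is a rigid point `z`, and in `z + z' ~ D` the point `z'` must be on the same side, because
otherwise `z` would be equivalent to the end of the bridge. -/
lemma Moves.linEquiv_of_isBridge (hconn : G.Connected) (hval : ∀ x : G.Point, G.val x ≠ 1)
    {D : G.Divisor} (hD : Moves D) {d : G.Dart} (hd : IsBridge d.1) :
    LinEquiv (delta (Point.vertex (G.tail d)) + delta (Point.vertex (G.tail d))) D := by
  classical
  have aux : ∀ (d : G.Dart) (B : Set G.V), IsCut d B → ∀ v', ¬ OnSide d.1 B v' →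
      LinEquiv (delta (Point.vertex (G.head d)) + delta v') D →
      LinEquiv (delta (Point.vertex (G.head d)) + delta (Point.vertex (G.head d))) D := by
    intro d B hB v' hv' hv
    set w := Point.vertex (G.head d) with hw
    obtain ⟨d', hd', hne, hdB⟩ := hB.exists_not_isBridge hconn hval _ d B rfl
    have hmid : G.len d'.1 / 2 ∈ Ioo 0 (G.len d'.1) :=
      ⟨half_pos (dart_len_pos d'), half_lt_self (dart_len_pos d')⟩
    set z := G.dpt d' (G.len d'.1 / 2) with hz
    have hzr : Rigid z := rigid_of_not_isBridge hconn hd' hmid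
    have hzB : OnSide d.1 B z := (hB.onSide_dpt ⟨hmid.1.le, hmid.2.le⟩ hne).2 hdB
    have hwB : OnSide d.1 B w := hB.2.1
    obtain ⟨z', hz'⟩ := hD z
    obtain ⟨g, hg, hgd⟩ := hz'.trans hv.symm
    obtain ⟨f, hf, m, hfd⟩ := hB.exists_restrict hg
    have hside : ∀ y, OnSide d.1 B y → ∀ x, ¬ OnSide d.1 B x → delta y x = 0 := by
      intro y hy x hx
      exact delta_of_ne fun h => hx (h ▸ hy)
    by_cases hz'B : OnSide d.1 B z'
    · have key : ∀ x, divZ f x = (delta z + delta z' + (m - 1) • delta w) x := by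
        intro x
        rw [hfd]
        simp only [Finsupp.add_apply, Finsupp.smul_apply, smul_eq_mul]
        split_ifs with hx
        · have h1 : delta v' x = 0 := delta_of_ne fun h => hv' (h ▸ hx)
          rw [hgd]
          simp only [Finsupp.add_apply, h1]
          ring
        · rw [hside z hzB x hx, hside z' hz'B x hx, hside w hwB x hx]
          ring
      have hdeg := hf.deg_eq_zero key
      rw [deg_add, deg_add, deg_delta, deg_delta] at hdeg
      have hsm : Divisor.deg ((m - 1) • delta w) = m - 1 := by
        rw [delta, Finsupp.smul_single, smul_eq_mul, mul_one]
        exact Finsupp.sum_single_index rfl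
      rw [hsm] at hdeg
      have hm : m = -1 := by omega
      refine LinEquiv.trans (LinEquiv.symm ⟨f, hf, fun x => ?_⟩) hz'
      rw [key, hm]
      simp only [Finsupp.add_apply, Finsupp.smul_apply, smul_eq_mul]
      ring
    · exfalso
      have key : ∀ x, divZ f x = (delta z + (m - 1) • delta w) x := by
        intro x
        rw [hfd]
        simp only [Finsupp.add_apply, Finsupp.smul_apply, smul_eq_mul]
        split_ifs with hx
        · have h1 : delta v' x = 0 := delta_of_ne fun h => hv' (h ▸ hx)
          have h2 : delta z' x = 0 := delta_of_ne fun h => hz'B (h ▸ hx)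
          rw [hgd]
          simp only [Finsupp.add_apply, h1, h2]
          ring
        · rw [hside z hzB x hx, hside w hwB x hx]
          ring
      have hdeg := hf.deg_eq_zero key
      rw [deg_add, deg_delta] at hdeg
      have hsm : Divisor.deg ((m - 1) • delta w) = m - 1 := by
        rw [delta, Finsupp.smul_single, smul_eq_mul, mul_one]
        exact Finsupp.sum_single_index rfl
      rw [hsm] at hdeg
      have hm : m = 0 := by omega
      have hwz : w = z := by
        refine hzr w (LinEquiv.symm ⟨f, hf, fun x => ?_⟩)
        rw [key, hm]
        simp only [Finsupp.add_apply, Finsupp.smul_apply, smul_eq_mul]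
        ring
      exact dpt_ne_vertex hmid _ (hz.symm.trans hwz.symm)
  obtain ⟨B, hB⟩ := hd.exists_isCut
  have heq := hd.linEquiv
  obtain ⟨v', hv'⟩ := hD (Point.vertex (G.tail d))
  by_cases hside : OnSide d.1 B v'
  · have h1 : ¬ OnSide (G.rev d).1 Bᶜ v' := by
      rcases v' with v | ⟨e, t, h₀, h₁⟩
      · exact fun h => h hside
      · exact fun h => h.2 hside.2
    have h2 := aux (G.rev d) Bᶜ hB.rev v' h1
    rw [head_rev] at h2
    exact h2 hv'
  · exact (heq.add heq).trans (aux d B hB v' hside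
      ((heq.symm.add (LinEquiv.refl (delta v'))).trans hv'))

lemma Moves.rigid_of_not_fixed (hconn : G.Connected) [Nonempty G.E]
    (hval : ∀ x : G.Point, G.val x ≠ 1) {D : G.Divisor} (hD : Moves D) {x : G.Point}
    (hx : ¬ LinEquiv (delta x + delta x) D) : Rigid x := by
  by_contra h
  obtain ⟨d, hd, he⟩ := exists_isBridge_of_not_rigid hconn h
  exact hx ((he.add he).trans (hD.linEquiv_of_isBridge hconn hval hd))

/-- A divisor of degree two that moves has rank exactly one. -/
lemma isHyperelliptic_of_moves (hconn : G.Connected) [Nonempty G.E]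
    (hval : ∀ x : G.Point, G.val x ≠ 1) {D : G.Divisor} (hdeg : Divisor.deg D = 2)
    (hD : ∀ x, ∃ F : G.Divisor, 0 ≤ F ∧ LinEquiv F D ∧ 1 ≤ F x) : G.IsHyperelliptic := by
  refine ⟨D, hdeg, fun F hF hFd => ?_, fun k hk => ?_⟩
  · obtain ⟨x, rfl⟩ := exists_eq_delta hF hFd
    obtain ⟨F₁, hF₁, he, hx⟩ := hD x
    obtain ⟨F', hF', rfl, -⟩ := exists_eq_add_delta hF₁ hx
    refine ⟨F', hF', ?_⟩
    rw [sub_sub, isPrincipal_sub_iff, add_comm]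
    exact he.symm
  · by_contra! hk1
    have huse : ∀ F : G.Divisor, 0 ≤ F → Divisor.deg F = k → k = 2 ∧ LinEquiv D F := by
      intro F hF hFk
      obtain ⟨F', hF', hp⟩ := hk F hF hFk
      rw [sub_sub, isPrincipal_sub_iff] at hp
      have h1 := hp.deg_eq
      rw [deg_add, hdeg, hFk] at h1
      have h2 := deg_nonneg hF'
      have h3 : k = 2 := by omega
      have h4 := eq_zero_of_deg_eq_zero hF' (by omega)
      rw [h4, add_zero] at hp
      exact ⟨h3, hp⟩
    obtain ⟨d, hd⟩ := exists_not_isBridge hconn hval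
    have hmid : G.len d.1 / 2 ∈ Ioo 0 (G.len d.1) :=
      ⟨half_pos (dart_len_pos d), half_lt_self (dart_len_pos d)⟩
    set z := G.dpt d (G.len d.1 / 2) with hz
    have hzr : Rigid z := rigid_of_not_isBridge hconn hd hmid
    set y : G.Point := Point.vertex (G.tail d) with hy
    have hk2 : k = 2 := by
      refine (huse (k • delta z) (fun x => ?_) ?_).1
      · rw [Finsupp.smul_apply, smul_eq_mul]
        exact mul_nonneg (by omega) (delta_nonneg z x)
      · rw [delta, Finsupp.smul_single, smul_eq_mul, mul_one]
        exact Finsupp.sum_single_index rfl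
    have h1 := (huse (delta z + delta z) (add_nonneg (delta_nonneg _) (delta_nonneg _))
      (by rw [deg_add, deg_delta, hk2]; rfl)).2
    have h2 := (huse (delta z + delta y) (add_nonneg (delta_nonneg _) (delta_nonneg _))
      (by rw [deg_add, deg_delta, deg_delta, hk2]; rfl)).2
    exact dpt_ne_vertex hmid _ (hzr y (h2.symm.trans h1).add_left_cancel).symm

lemma IsHyperelliptic.exists_moves (h : G.IsHyperelliptic) : ∃ D : G.Divisor, Moves D := by
  obtain ⟨D, hdeg, hD, -⟩ := h
  refine ⟨D, fun x => ?_⟩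
  obtain ⟨F', hF', hp⟩ := hD (delta x) (delta_nonneg x) (deg_delta x)
  rw [sub_sub, isPrincipal_sub_iff] at hp
  have h1 := hp.deg_eq
  rw [deg_add, deg_delta, hdeg] at h1
  obtain ⟨y, rfl⟩ := exists_eq_delta hF' (by omega)
  exact ⟨y, hp.symm⟩

/-! ### The involution on points -/

open Classical in
/-- The hyperelliptic involution on points: `x` itself if `2 x ~ D`, and otherwise the point `y`
with `x + y ~ D`, which is then unique. All points of bridges are fixed. -/
noncomputable def partner {D : G.Divisor} (hD : Moves D) (x : G.Point) : G.Point :=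
  if LinEquiv (delta x + delta x) D then x else (hD x).choose

/-- The divisor formed by a point and its partner. -/
noncomputable def pairDiv {D : G.Divisor} (hD : Moves D) (x : G.Point) : G.Divisor :=
  delta x + delta (partner hD x)

lemma pairDiv_nonneg {D : G.Divisor} (hD : Moves D) (x : G.Point) : 0 ≤ pairDiv hD x :=
  add_nonneg (delta_nonneg _) (delta_nonneg _)

lemma pairDiv_linEquiv {D : G.Divisor} (hD : Moves D) (x : G.Point) :
    LinEquiv (pairDiv hD x) D := by
  unfold pairDiv partner
  split_ifs with h
  · exact h
  · exact (hD x).choose_spec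

lemma one_le_pairDiv {D : G.Divisor} (hD : Moves D) (x : G.Point) : 1 ≤ pairDiv hD x x := by
  rw [pairDiv, Finsupp.add_apply, delta_self]
  have := delta_nonneg (partner hD x) x
  simp only [Finsupp.coe_zero, Pi.zero_apply] at this
  omega

lemma pairDiv_eq_zero {D : G.Divisor} (hD : Moves D) {x y : G.Point} (h : y ≠ x)
    (h' : y ≠ partner hD x) : pairDiv hD x y = 0 := by
  rw [pairDiv, Finsupp.add_apply, delta_of_ne h, delta_of_ne h', add_zero]

lemma partner_of_fixed {D : G.Divisor} (hD : Moves D) {x : G.Point}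
    (h : LinEquiv (delta x + delta x) D) : partner hD x = x := if_pos h

lemma fixed_of_partner_eq {D : G.Divisor} (hD : Moves D) {x : G.Point}
    (h : partner hD x = x) : LinEquiv (delta x + delta x) D := by
  have := pairDiv_linEquiv hD x
  rwa [pairDiv, h] at this

lemma not_fixed_partner (hconn : G.Connected) [Nonempty G.E]
    (hval : ∀ x : G.Point, G.val x ≠ 1) {D : G.Divisor} (hD : Moves D)
    {x : G.Point} (hx : ¬ LinEquiv (delta x + delta x) D) :
    ¬ LinEquiv (delta (partner hD x) + delta (partner hD x)) D := by
  intro h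
  have h1 := (pairDiv_linEquiv hD x).trans h.symm
  have h2 : partner hD x = x :=
    hD.rigid_of_not_fixed hconn hval hx _ (LinEquiv.symm h1.add_right_cancel)
  exact hx (fixed_of_partner_eq hD h2)

lemma eq_partner (hconn : G.Connected) [Nonempty G.E]
    (hval : ∀ x : G.Point, G.val x ≠ 1) {D : G.Divisor} (hD : Moves D)
    {x y : G.Point} (hx : ¬ LinEquiv (delta x + delta x) D)
    (hy : LinEquiv (delta x + delta y) D) : y = partner hD x :=
  hD.rigid_of_not_fixed hconn hval (not_fixed_partner hconn hval hD hx) y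
    (hy.trans (pairDiv_linEquiv hD x).symm).add_left_cancel

lemma partner_partner (hconn : G.Connected) [Nonempty G.E]
    (hval : ∀ x : G.Point, G.val x ≠ 1) {D : G.Divisor} (hD : Moves D)
    (x : G.Point) : partner hD (partner hD x) = x := by
  by_cases hx : LinEquiv (delta x + delta x) D
  · rw [partner_of_fixed hD hx, partner_of_fixed hD hx]
  · refine (eq_partner hconn hval hD (not_fixed_partner hconn hval hD hx) ?_).symm
    rw [add_comm]
    exact pairDiv_linEquiv hD x

lemma pairDiv_partner (hconn : G.Connected) [Nonempty G.E]
    (hval : ∀ x : G.Point, G.val x ≠ 1) {D : G.Divisor} (hD : Moves D)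
    (x : G.Point) : pairDiv hD (partner hD x) = pairDiv hD x := by
  rw [pairDiv, partner_partner hconn hval, add_comm, pairDiv]

lemma eq_or_rigid (hconn : G.Connected) [Nonempty G.E]
    (hval : ∀ x : G.Point, G.val x ≠ 1) {D : G.Divisor} (hD : Moves D)
    (x : G.Point) :
    x = partner hD x ∨ Rigid x ∧ Rigid (partner hD x) := by
  by_cases hx : LinEquiv (delta x + delta x) D
  · exact Or.inl (partner_of_fixed hD hx).symm
  · exact Or.inr ⟨hD.rigid_of_not_fixed hconn hval hx,
      hD.rigid_of_not_fixed hconn hval (not_fixed_partner hconn hval hD hx)⟩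

/-- If `x` and `y` are rigid (or equal), a function with divisor `D₁ - (x + y)` is maximal at both
points: if it were larger somewhere than at `x`, then its truncation at the level of `x` would have
a divisor of the form `y' - y`. -/
lemma PL.le_of_rigid (hconn : G.Connected) [Nonempty G.E] {f : G.Point → ℝ} (hf : PL f)
    {D₁ : G.Divisor} (h₁ : 0 ≤ D₁) {x y : G.Point} (hxy : x = y ∨ Rigid x ∧ Rigid y)
    (hd : ∀ z, divZ f z = D₁ z - (delta x + delta y) z) (z : G.Point) : f z ≤ f x := by
  by_contra! hz
  have hD₁ : ∀ w, 0 ≤ D₁ w := fun w => h₁ w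
  have hx0 : ∀ w, f x < f w → delta x w = 0 := fun w hw => delta_of_ne fun h => by
    rw [h] at hw
    exact lt_irrefl _ hw
  rcases le_or_gt (f y) (f x) with hy | hy
  · refine absurd (hf.le_of_divZ_nonneg hconn (fun w hw => ?_) (x₀ := x) le_rfl z) (not_le.2 hz)
    have hy0 : delta y w = 0 := delta_of_ne fun h => by
      rw [h] at hw
      exact absurd hw (not_lt.2 hy)
    rw [hd, Finsupp.add_apply, hx0 w hw, hy0]
    simpa using hD₁ w
  · have hne : x ≠ y := fun h => by
      rw [h] at hy
      exact lt_irrefl _ hy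
    have hyr : Rigid y := (hxy.resolve_left hne).2
    obtain ⟨E, hE⟩ := (hf.trunc (f x)).exists_divisor
    have hE0 : 0 ≤ E + delta y := by
      intro w
      rcases le_or_gt (f w) (f x) with hw | hw
      · have h2 := hf.divZ_trunc_nonneg hw
        rw [hE] at h2
        exact add_nonneg h2 (delta_nonneg y w)
      · rw [Finsupp.add_apply, ← hE, hf.divZ_trunc_of_lt hw, hd, Finsupp.add_apply, hx0 w hw]
        simpa using hD₁ w
    have hEdeg := (hf.trunc (f x)).deg_eq_zero hE
    obtain ⟨y', hy'⟩ := exists_eq_delta hE0 (by rw [deg_add, hEdeg, deg_delta, zero_add])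
    have hyy : y' = y := by
      refine hyr y' ⟨_, hf.trunc (f x), fun w => ?_⟩
      rw [hE, ← hy', Finsupp.add_apply]
      ring
    rw [hyy] at hy'
    have hE1 : E = 0 := by simpa using hy'
    have h3 := (hf.trunc (f x)).eq_of_divZ_nonneg hconn (fun w => by rw [hE, hE1]; simp) z x
    rw [LengthGraph.trunc, LengthGraph.trunc, max_self, max_eq_left hz.le] at h3
    exact hz.ne' h3

lemma le_of_pairDiv (hconn : G.Connected) [Nonempty G.E]
    (hval : ∀ x : G.Point, G.val x ≠ 1) {D : G.Divisor} (hD : Moves D)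
    {f : G.Point → ℝ} (hf : PL f) {D₁ : G.Divisor} (h₁ : 0 ≤ D₁)
    {x : G.Point} (hd : ∀ z, divZ f z = D₁ z - pairDiv hD x z) :
    (∀ z, f z ≤ f x) ∧ f (partner hD x) = f x := by
  have h := eq_or_rigid hconn hval hD x
  have h2 := hf.le_of_rigid hconn h₁ h hd
  refine ⟨h2, le_antisymm (h2 _) ?_⟩
  refine hf.le_of_rigid hconn h₁ (x := partner hD x) (y := x) (h.imp Eq.symm And.symm) ?_ x
  intro z
  rw [hd, pairDiv, add_comm]

lemma ge_of_pairDiv (hconn : G.Connected) [Nonempty G.E]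
    (hval : ∀ x : G.Point, G.val x ≠ 1) {D : G.Divisor} (hD : Moves D)
    {f : G.Point → ℝ} (hf : PL f) {D₂ : G.Divisor} (h₂ : 0 ≤ D₂)
    {x : G.Point} (hd : ∀ z, divZ f z = pairDiv hD x z - D₂ z) :
    (∀ z, f x ≤ f z) ∧ f (partner hD x) = f x := by
  have h := le_of_pairDiv hconn hval hD hf.neg h₂ (x := x)
    (fun z => by rw [hf.divZ_neg, hd]; ring)
  exact ⟨fun z => neg_le_neg_iff.1 (h.1 z), neg_injective h.2⟩

lemma divZ_eq_zero_of_le {f : G.Point → ℝ} {x y : G.Point} (hx : ∀ z, f z ≤ f x)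
    (hy : ∀ z, f y ≤ f z) (h : f x ≤ f y) (z : G.Point) : divZ f z = 0 := by
  refine divZ_const' (fun a b => le_antisymm ?_ ?_) z
  · exact (hx a).trans (h.trans (hy b))
  · exact (hx b).trans (h.trans (hy a))

lemma exists_eq_neg_one {ι : Type*} {s : Finset ι} {φ : ι → ℤ} (h : ∀ q ∈ s, φ q ≤ 0)
    (hs : ∑ q ∈ s, φ q = -1) : ∃ q ∈ s, φ q = -1 ∧ ∀ q' ∈ s, q' ≠ q → φ q' = 0 := by
  classical
  obtain ⟨q, hq, hq0⟩ : ∃ q ∈ s, φ q ≠ 0 := by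
    by_contra! h'
    rw [Finset.sum_eq_zero h'] at hs
    omega
  rw [← Finset.add_sum_erase s φ hq] at hs
  have h1 : ∀ q' ∈ s.erase q, φ q' ≤ 0 := fun q' hq' => h q' (Finset.mem_of_mem_erase hq')
  have h2 := Finset.sum_nonpos h1
  have h3 := h q hq
  have h4 : ∑ q' ∈ s.erase q, φ q' = 0 := by omega
  refine ⟨q, hq, by omega, fun q' hq' hne => ?_⟩
  exact (Finset.sum_eq_zero_iff_of_nonpos h1).1 h4 q' (Finset.mem_erase.2 ⟨hne, hq'⟩)

/-- When `x` starts to move in the direction `p`, its partner starts to move in a unique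
direction `q`. -/
lemma exists_partner_direction (hconn : G.Connected) [Nonempty G.E]
    (hval : ∀ x : G.Point, G.val x ≠ 1) {D : G.Divisor} (hD : Moves D)
    {x : G.Point} (hx : ¬ LinEquiv (delta x + delta x) D)
    {p : G.Dart × ℝ} (hp : p ∈ G.dirs x) :
    ∃ (f : G.Point → ℝ) (y : G.Point), PL f ∧ (∀ z, divZ f z = pairDiv hD y z - pairDiv hD x z) ∧
      f (partner hD x) = f x ∧ pairDiv hD y (partner hD x) = 0 ∧
      slope f p = -1 ∧ (∀ p' ∈ G.dirs x, p' ≠ p → slope f p' = 0) ∧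
      ∃ q ∈ G.dirs (partner hD x), slope f q = -1 ∧
        ∀ q' ∈ G.dirs (partner hD x), q' ≠ q → slope f q' = 0 := by
  obtain ⟨d, a⟩ := p
  obtain ⟨ha, hda⟩ := mem_dirs.1 hp
  have ha0 : 0 ≤ a := ha.1
  -- stop before the partner of `x`
  obtain ⟨b, hb, hbx⟩ : ∃ b ∈ Ioo a (G.len d.1), ∀ s ∈ Ioc a b, G.dpt d s ≠ partner hD x := by
    by_cases h : ∃ s₀ ∈ Ioo a (G.len d.1), G.dpt d s₀ = partner hD x
    · obtain ⟨s₀, hs₀, hs₀x⟩ := h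
      refine ⟨(a + s₀) / 2, ⟨by linarith [hs₀.1], by linarith [hs₀.1, hs₀.2]⟩, fun s hs h => ?_⟩
      have h1 := dpt_injOn d (s := s) (s' := s₀) ⟨by linarith [hs.1], by linarith [hs.2, hs₀.1,
        hs₀.2]⟩ ⟨by linarith [hs₀.1], hs₀.2⟩ (h.trans hs₀x.symm)
      linarith [hs.2, hs₀.1]
    · push Not at h
      have ha2 : a < G.len d.1 := ha.2
      exact ⟨(a + G.len d.1) / 2, ⟨by linarith, by linarith⟩, fun s hs =>
        h s ⟨hs.1, by linarith [hs.2]⟩⟩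
  have hsx : ∀ s ∈ Ioc a b, G.dpt d s ≠ x := by
    intro s hs h
    have hsI : s ∈ Ioo 0 (G.len d.1) := ⟨by linarith [hs.1], by linarith [hs.2, hb.2]⟩
    have h1 := (fst_eq_of_dpt_eq hsI ⟨ha.1, ha.2.le⟩ (h.trans hda.symm)).2
    exact hs.1.ne' (dpt_injOn d hsI h1 (h.trans hda.symm))
  set y := G.dpt d b with hy
  have hyx : y ≠ x := hsx b ⟨hb.1, le_rfl⟩
  have hyx' : y ≠ partner hD x := hbx b ⟨hb.1, le_rfl⟩
  obtain ⟨f, hf, hd⟩ := (pairDiv_linEquiv hD y).trans (pairDiv_linEquiv hD x).symm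
  obtain ⟨hmax, hfx⟩ := le_of_pairDiv hconn hval hD hf (pairDiv_nonneg hD y) hd
  obtain ⟨hmin, hfy⟩ := ge_of_pairDiv hconn hval hD hf (pairDiv_nonneg hD x) hd
  have hlt : f y < f x := by
    by_contra! h
    have h1 := divZ_eq_zero_of_le hmax hmin h y
    rw [hd, pairDiv_eq_zero hD hyx hyx'] at h1
    have := one_le_pairDiv hD y
    omega
  have hzero : ∀ z, f z = f x → pairDiv hD y z = 0 := fun z hz =>
    pairDiv_eq_zero hD (fun h => by rw [h] at hz; exact hlt.ne hz)
      (fun h => by rw [h, hfy] at hz; exact hlt.ne hz)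
  have hnx : partner hD x ≠ x := fun h => hx (fixed_of_partner_eq hD h)
  have hdx : divZ f x = -1 := by
    rw [hd, hzero x rfl, pairDiv, Finsupp.add_apply, delta_self, delta_of_ne hnx.symm]
    norm_num
  have hdx' : divZ f (partner hD x) = -1 := by
    rw [hd, hzero _ hfx, pairDiv, Finsupp.add_apply, delta_self, delta_of_ne hnx]
    norm_num
  obtain ⟨p', hp', hp'1, hp'2⟩ := exists_eq_neg_one
    (fun q hq => hf.slope_nonpos_of_isMax hmax hq) hdx
  obtain ⟨q, hq, hq1, hq2⟩ := exists_eq_neg_one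
    (fun q hq => hf.slope_nonpos_of_isMax (fun z => (hmax z).trans_eq hfx.symm) hq) hdx'
  have hpp : p' = (d, a) := by
    by_contra hne
    have h0 : slope f (d, a) = 0 := hp'2 _ hp fun h => hne h.symm
    have h1 := hf.eq_on_segment (M := f x) (d := d) (a := a) (b := b) ha0 hb.2.le (by rw [hda])
      (fun s hs hsM => ?_) (s := b) ⟨hb.1.le, le_rfl⟩
    · exact hlt.ne h1
    · rcases eq_or_lt_of_le hs.1 with rfl | h2
      · exact h0
      · refine hf.slope_eq_zero_of_isMax (fun z => (hmax z).trans_eq hsM.symm) ?_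
          (mem_dirs_dpt ⟨ha0.trans hs.1, hs.2.trans hb.2⟩)
        rw [hd, pairDiv_eq_zero hD (hsx s ⟨h2, hs.2.le⟩) (hbx s ⟨h2, hs.2.le⟩), sub_zero]
        exact pairDiv_nonneg hD y _
  subst hpp
  exact ⟨f, y, hf, hd, hfx, hzero _ hfx, hp'1, hp'2, q, hq, hq1, hq2⟩

/-- The valence of a point is at most that of its partner. If two directions `p₁ ≠ p₂` at `x`
corresponded to the same direction at the partner of `x`, the truncation of the difference of the
corresponding functions would be an effective divisor equivalent to `D` that contains `x` but not
its partner. -/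
lemma card_dirs_le (hconn : G.Connected) [Nonempty G.E]
    (hval : ∀ x : G.Point, G.val x ≠ 1) {D : G.Divisor} (hD : Moves D)
    {x : G.Point} (hx : ¬ LinEquiv (delta x + delta x) D) :
    (G.dirs x).card ≤ (G.dirs (partner hD x)).card := by
  have h : ∀ p : G.Dart × ℝ, ∃ q, p ∈ G.dirs x → ∃ (f : G.Point → ℝ) (y : G.Point), PL f ∧
      (∀ z, divZ f z = pairDiv hD y z - pairDiv hD x z) ∧
      f (partner hD x) = f x ∧ pairDiv hD y (partner hD x) = 0 ∧
      slope f p = -1 ∧ (∀ p' ∈ G.dirs x, p' ≠ p → slope f p' = 0) ∧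
      q ∈ G.dirs (partner hD x) ∧ slope f q = -1 ∧
        ∀ q' ∈ G.dirs (partner hD x), q' ≠ q → slope f q' = 0 := by
    intro p
    by_cases hp : p ∈ G.dirs x
    · obtain ⟨f, y, h1, h2, h3, h4, h5, h6, q, h7⟩ :=
        exists_partner_direction hconn hval hD hx hp
      exact ⟨q, fun _ => ⟨f, y, h1, h2, h3, h4, h5, h6, h7⟩⟩
    · exact ⟨p, fun h => absurd h hp⟩
  choose q hq using h
  refine Finset.card_le_card_of_injOn q (fun p hp => ?_) fun p₁ hp₁ p₂ hp₂ heq => ?_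
  · obtain ⟨f, y, -, -, -, -, -, -, h7, -⟩ := hq p hp
    exact h7
  · by_contra hne
    obtain ⟨f₁, y₁, hf₁, hd₁, hfx₁, -, -, hp1', -, hs1, hz1⟩ := hq p₁ hp₁
    obtain ⟨f₂, y₂, hf₂, hd₂, hfx₂, hy₂, hp2, -, -, hs2, hz2⟩ := hq p₂ hp₂
    set h := f₁ - f₂ with hh
    have hh0 : PL h := hf₁.sub hf₂
    have hd : ∀ z, divZ h z = pairDiv hD y₁ z - pairDiv hD y₂ z := fun z => by
      rw [hf₁.divZ_sub hf₂, hd₁, hd₂]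
      ring
    obtain ⟨F, hF, hFe, -, heqF, -⟩ := hh0.exists_level_divisor (pairDiv_nonneg hD y₁)
      (pairDiv_nonneg hD y₂) hd (h x)
    have hFD := hFe.trans ((pairDiv_linEquiv hD y₂).trans (pairDiv_linEquiv hD x).symm)
    have hFdeg : Divisor.deg F = 2 := by
      rw [hFD.deg_eq, pairDiv, deg_add, deg_delta, deg_delta]
      rfl
    have hFx : 1 ≤ F x := by
      have h1 := slope_le_up h hp₂
      rw [hf₁.slope_sub hf₂ hp₂, hp1' p₂ hp₂ (Ne.symm hne), hp2] at h1
      have h2 := pairDiv_nonneg hD y₂ x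
      simp only [Finsupp.coe_zero, Pi.zero_apply] at h2
      rw [heqF x rfl]
      omega
    obtain ⟨y, rfl⟩ := exists_eq_delta_add hF hFdeg hFx
    have hy := eq_partner hconn hval hD hx (hFD.trans (pairDiv_linEquiv hD x))
    have h1 := heqF (partner hD x) (by rw [hh, Pi.sub_apply, Pi.sub_apply, hfx₁, hfx₂])
    have hup : up h (partner hD x) = 0 := by
      refine Finset.sum_eq_zero fun p hp => ?_
      rw [hf₁.slope_sub hf₂ hp]
      by_cases hpq : p = q p₁
      · rw [hpq, hs1, heq, hs2]
        rfl
      · rw [hz1 p hp hpq, hz2 p hp (heq ▸ hpq)]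
        rfl
    rw [hy₂, hup, ← hy, Finsupp.add_apply, delta_self] at h1
    have h2 := delta_nonneg x y
    simp only [Finsupp.coe_zero, Pi.zero_apply] at h2
    omega

/-! ### The involution on vertices -/

lemma three_le_card_dirs (hconn : G.Connected) [Nonempty G.E]
    (hval : ∀ x : G.Point, G.val x ≠ 1) {v : G.V} (hv : G.val (Point.vertex v) ≠ 2) :
    3 ≤ (G.dirs (Point.vertex v)).card := by
  have h1 := hval (Point.vertex v)
  rw [val_eq_card_dirs] at h1 hv
  obtain ⟨d, rfl⟩ := hconn.exists_dart_tail v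
  have h2 := Finset.card_pos.2 ⟨_, mem_dirs_tail d⟩
  omega

lemma exists_vertex_of_three_le {x : G.Point} (hx : 3 ≤ (G.dirs x).card) :
    ∃ v, x = Point.vertex v := by
  rcases x with v | ⟨e, t, h₀, h₁⟩
  · exact ⟨v, rfl⟩
  · rw [← val_eq_card_dirs] at hx
    exact absurd hx (by simp [val])

lemma exists_partner_vertex_of_val_ne_two (hconn : G.Connected) [Nonempty G.E]
    (hval : ∀ x : G.Point, G.val x ≠ 1) {D : G.Divisor} (hD : Moves D) {v : G.V}
    (hv : G.val (Point.vertex v) ≠ 2) : ∃ w, partner hD (Point.vertex v) = Point.vertex w := by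
  by_cases hx : LinEquiv (delta (Point.vertex v) + delta (Point.vertex v)) D
  · exact ⟨v, partner_of_fixed hD hx⟩
  · exact exists_vertex_of_three_le
      ((three_le_card_dirs hconn hval hv).trans (card_dirs_le hconn hval hD hx))

/-- The midpoint `v` of a loop at `w` is fixed by the involution. Otherwise compare the function with
divisor `(w + w̄) - (v + v̄)` with the one with divisor `2 w - 2 v` that vanishes off the loop: by
integrality the former falls at least as much from `v` to `w`, but the maximum principle for their
difference says the contrary. -/
lemma fixed_of_val_eq_two (hconn : G.Connected) [Nonempty G.E]
    (hval : ∀ x : G.Point, G.val x ≠ 1) {D : G.Divisor} (hD : Moves D)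
    (hG : G.IsCanonicalLoopless) {v : G.V} (hv : G.val (Point.vertex v) = 2) :
    LinEquiv (delta (Point.vertex v) + delta (Point.vertex v)) D := by
  classical
  obtain ⟨w, hw, e₁, e₂, hne, hj₁, hj₂, hlen⟩ := hG.midpoint v hv
  obtain ⟨d₁, rfl, ht₁, hh₁⟩ := joins_iff_exists_dart.1 hj₁
  obtain ⟨d₂, rfl, ht₂, hh₂⟩ := joins_iff_exists_dart.1 hj₂
  have hvw : v ≠ w := by
    rw [← ht₁, ← hh₁]
    exact hG.loopless.tail_ne_head d₁
  have hdirs : ∀ d : G.Dart, G.tail d = v → d = d₁ ∨ d = d₂ := by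
    intro d hd
    by_contra! h
    have hsub : ({(d, 0), (d₁, 0), (d₂, 0)} : Finset (G.Dart × ℝ)) ⊆ G.dirs (Point.vertex v) := by
      intro p hp
      simp only [Finset.mem_insert, Finset.mem_singleton] at hp
      rcases hp with rfl | rfl | rfl
      · exact mem_dirs_vertex.2 ⟨rfl, hd⟩
      · exact mem_dirs_vertex.2 ⟨rfl, ht₁⟩
      · exact mem_dirs_vertex.2 ⟨rfl, ht₂⟩
    have h1 := Finset.card_le_card hsub
    have h12 : d₁ ≠ d₂ := fun h => hne (by rw [h])
    rw [← val_eq_card_dirs, hv, Finset.card_eq_three.2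
      ⟨_, _, _, fun h' => h.1 (Prod.mk.inj h').1, fun h' => h.2 (Prod.mk.inj h').1,
        fun h' => h12 (Prod.mk.inj h').1, rfl⟩] at h1
    omega
  -- the function with divisor `2 w - 2 v`
  set n : G.Dart → ℤ := fun d => ((if d = G.rev d₁ then 1 else 0) - if d = d₁ then 1 else 0) +
    ((if d = G.rev d₂ then 1 else 0) - if d = d₂ then 1 else 0) with hn
  set g : G.V → ℝ := fun u => if u = v then G.len d₁.1 else 0 with hg
  have hs : IsSlope g n := by
    intro d
    by_cases h1 : d.1 = d₁.1
    · have h2 : d ≠ d₂ := fun h => hne (by rw [← h1, h])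
      have h3 : d ≠ G.rev d₂ := fun h => hne (by rw [← h1, h, rev_fst])
      rcases eq_or_eq_rev_of_fst_eq h1 with rfl | rfl
      · simp [hn, hg, h2, h3, (rev_ne d).symm, ht₁, hh₁, hvw.symm]
      · simp [hn, hg, h2, h3, rev_ne, ht₁, hh₁, hvw.symm]
    · have h2 : d ≠ d₁ := fun h => h1 (by rw [h])
      have h3 : d ≠ G.rev d₁ := fun h => h1 (by rw [h, rev_fst])
      by_cases h4 : d.1 = d₂.1
      · rcases eq_or_eq_rev_of_fst_eq h4 with rfl | rfl
        · simp [hn, hg, h2, h3, (rev_ne d).symm, ht₂, hh₂, hvw.symm, hlen]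
        · simp [hn, hg, h2, h3, rev_ne, ht₂, hh₂, hvw.symm, hlen]
      · have h5 : d ≠ d₂ := fun h => h4 (by rw [h])
        have h6 : d ≠ G.rev d₂ := fun h => h4 (by rw [h, rev_fst])
        have h7 : G.tail d ≠ v := fun h => (hdirs d h).elim h2 h5
        have h8 : G.head d ≠ v := fun h => by
          rcases hdirs (G.rev d) (by rw [tail_rev, h]) with h9 | h9
          · exact h3 (by rw [← h9, rev_rev])
          · exact h6 (by rw [← h9, rev_rev])
        simp [hn, hg, h2, h3, h5, h6, h7, h8]
  set V : G.Point := Point.vertex v with hV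
  set W : G.Point := Point.vertex w with hW
  have hgd : ∀ x, divZ (ofVertex g) x = 2 * delta W x - 2 * delta V x := by
    intro x
    rcases vertex_or_dpt x with ⟨u, rfl⟩ | ⟨d, s, hs', rfl⟩
    · rw [hs.divZ_vertex, hn]
      simp only [Finset.sum_add_distrib, Finset.sum_sub_distrib, Finset.sum_ite_eq',
        Finset.mem_filter, Finset.mem_univ, true_and, tail_rev, ht₁, hh₁, ht₂, hh₂, delta_apply,
        hV, hW, Point.vertex.injEq]
      ring
    · rw [hs.divZ_dpt hs', delta_of_ne (dpt_ne_vertex hs' _), delta_of_ne (dpt_ne_vertex hs' _)]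
      ring
  have hgV : ofVertex g V = G.len d₁.1 := by simp [hV, ofVertex, hg]
  have hgW : ofVertex g W = 0 := by simp [hW, ofVertex, hg, hvw.symm]
  by_contra hfix
  have hVW : V ≠ W := fun h => hvw (Point.vertex.inj h)
  by_cases hWfix : LinEquiv (delta W + delta W) D
  · refine hfix (LinEquiv.trans (LinEquiv.symm ⟨_, hs.pl, fun x => ?_⟩) hWfix)
    rw [hgd, Finsupp.add_apply, Finsupp.add_apply]
    ring
  obtain ⟨w', hw'⟩ := exists_partner_vertex_of_val_ne_two hconn hval hD hw
  have hVne : partner hD V ≠ V := fun h => hfix (fixed_of_partner_eq hD h)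
  have hWne : partner hD W ≠ W := fun h => hWfix (fixed_of_partner_eq hD h)
  have hWV : partner hD W ≠ V := by
    intro h
    have h1 := card_dirs_le hconn hval hD hWfix
    have h2 : 3 ≤ (G.dirs W).card := three_le_card_dirs hconn hval hw
    rw [h, ← val_eq_card_dirs V, hv] at h1
    omega
  obtain ⟨f, hf, hd⟩ := (pairDiv_linEquiv hD W).trans (pairDiv_linEquiv hD V).symm
  obtain ⟨hmax, -⟩ := le_of_pairDiv hconn hval hD hf (pairDiv_nonneg hD W) hd
  obtain ⟨hmin, -⟩ := ge_of_pairDiv hconn hval hD hf (pairDiv_nonneg hD V) hd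
  have hlt : f W < f V := by
    by_contra! h
    have h1 := divZ_eq_zero_of_le hmax hmin h V
    rw [hd, pairDiv_eq_zero hD hVW (Ne.symm hWV)] at h1
    have := one_le_pairDiv hD V
    omega
  -- `f - g` has the divisor `v + w̄ - w - v̄`
  have hfg := hf.sub hs.pl
  have hfgd : ∀ x, divZ (f - ofVertex g) x =
      (delta V + delta (partner hD W)) x - (delta W + delta (partner hD V)) x := by
    intro x
    rw [hf.divZ_sub hs.pl, hd, hgd, pairDiv, pairDiv]
    simp only [Finsupp.add_apply]
    ring
  have hle : (f - ofVertex g) V ≤ (f - ofVertex g) W :=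
    hfg.le_of_rigid hconn (add_nonneg (delta_nonneg _) (delta_nonneg _))
      (Or.inr ⟨hD.rigid_of_not_fixed hconn hval hWfix,
        hD.rigid_of_not_fixed hconn hval (not_fixed_partner hconn hval hD hfix)⟩) hfgd V
  have hge : ∀ z, (f - ofVertex g) V ≤ (f - ofVertex g) z := by
    intro z
    have h1 := hfg.neg.le_of_rigid hconn
      (D₁ := delta W + delta (partner hD V)) (x := V) (y := partner hD W)
      (add_nonneg (delta_nonneg _) (delta_nonneg _))
      (Or.inr ⟨hD.rigid_of_not_fixed hconn hval hfix,
        hD.rigid_of_not_fixed hconn hval (not_fixed_partner hconn hval hD hWfix)⟩)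
      (fun z => by rw [hfg.divZ_neg, hfgd]; ring) z
    exact neg_le_neg_iff.1 h1
  have hlt' : (f - ofVertex g) V < (f - ofVertex g) W := by
    refine lt_of_le_of_ne hle fun h => ?_
    have h1 : divZ (f - ofVertex g) V = 0 := by
      refine divZ_eq_zero_of_le (x := W) (y := V) (fun z => ?_) hge h.ge V
      exact hfg.le_of_rigid hconn (add_nonneg (delta_nonneg _) (delta_nonneg _))
        (Or.inr ⟨hD.rigid_of_not_fixed hconn hval hWfix,
          hD.rigid_of_not_fixed hconn hval (not_fixed_partner hconn hval hD hfix)⟩) hfgd z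
    rw [hfgd, Finsupp.add_apply, Finsupp.add_apply, delta_self, delta_of_ne hVW,
      delta_of_ne hVne.symm] at h1
    have h2 := delta_nonneg (partner hD W) V
    simp only [Finsupp.coe_zero, Pi.zero_apply] at h2
    omega
  rw [Pi.sub_apply, Pi.sub_apply, hgV, hgW] at hlt'
  -- the partner of `v` lies inside at most one of the two edges; on the other `f` is linear
  obtain ⟨d, hdt, hdh, hdl, hdp⟩ : ∃ d : G.Dart, G.tail d = v ∧ G.head d = w ∧
      G.len d.1 = G.len d₁.1 ∧ ∀ s ∈ Ioo 0 (G.len d.1), G.dpt d s ≠ partner hD V := by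
    by_cases h : ∀ s ∈ Ioo 0 (G.len d₁.1), G.dpt d₁ s ≠ partner hD V
    · exact ⟨d₁, ht₁, hh₁, rfl, h⟩
    · push Not at h
      obtain ⟨s, hs, hsp⟩ := h
      refine ⟨d₂, ht₂, hh₂, hlen.symm, fun s' hs' h' => hne ?_⟩
      exact (fst_eq_of_dpt_eq hs ⟨hs'.1.le, hs'.2.le⟩ (hsp.trans h'.symm)).1
  have hlin := hf.eq_of_divZ_eq_zero (d := d) (fun t ht => by
    rw [hd, pairDiv_eq_zero hD (dpt_ne_vertex ht _) (hw' ▸ dpt_ne_vertex ht _),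
      pairDiv_eq_zero hD (dpt_ne_vertex ht _) (hdp t ht), sub_zero])
    (t := G.len d.1) ⟨(dart_len_pos d).le, le_rfl⟩
  rw [dpt_len, dpt_zero, hdt, hdh, hdl] at hlin
  have hL := dart_len_pos d₁
  have hlin' : f W = f V + slope f (d, 0) * G.len d₁.1 := hlin
  have h1 : (slope f (d, 0) : ℝ) < 0 := by
    by_contra! h
    nlinarith
  have h2 : slope f (d, 0) ≤ -1 := by
    have : slope f (d, 0) < 0 := by exact_mod_cast h1
    omega
  have h3 : (slope f (d, 0) : ℝ) ≤ -1 := by exact_mod_cast h2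
  nlinarith

lemma exists_partner_vertex (hconn : G.Connected) [Nonempty G.E]
    (hval : ∀ x : G.Point, G.val x ≠ 1) {D : G.Divisor} (hD : Moves D)
    (hG : G.IsCanonicalLoopless) (v : G.V) :
    ∃ w, partner hD (Point.vertex v) = Point.vertex w := by
  by_cases hv : G.val (Point.vertex v) = 2
  · exact ⟨v, partner_of_fixed hD (fixed_of_val_eq_two hconn hval hD hG hv)⟩
  · exact exists_partner_vertex_of_val_ne_two hconn hval hD hv

/-- The hyperelliptic involution on the vertices. -/
noncomputable def partnerV (hconn : G.Connected) [Nonempty G.E]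
    (hval : ∀ x : G.Point, G.val x ≠ 1) {D : G.Divisor} (hD : Moves D)
    (hG : G.IsCanonicalLoopless) (v : G.V) : G.V :=
  (exists_partner_vertex hconn hval hD hG v).choose

lemma vertex_partnerV (hconn : G.Connected) [Nonempty G.E]
    (hval : ∀ x : G.Point, G.val x ≠ 1) {D : G.Divisor} (hD : Moves D)
    (hG : G.IsCanonicalLoopless) (v : G.V) :
    Point.vertex (partnerV hconn hval hD hG v) = partner hD (Point.vertex v) :=
  (exists_partner_vertex hconn hval hD hG v).choose_spec.symm

lemma partnerV_partnerV (hconn : G.Connected) [Nonempty G.E]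
    (hval : ∀ x : G.Point, G.val x ≠ 1) {D : G.Divisor} (hD : Moves D)
    (hG : G.IsCanonicalLoopless) (v : G.V) :
    partnerV hconn hval hD hG (partnerV hconn hval hD hG v) = v := by
  refine Point.vertex.inj (?_ : Point.vertex _ = Point.vertex _)
  rw [vertex_partnerV, vertex_partnerV, partner_partner hconn hval]

/-! ### The involution on edges -/

lemma two_le_of_ne {F : G.Divisor} (hF : 0 ≤ F) {x y : G.Point} (hxy : x ≠ y) (hx : 1 ≤ F x)
    (hy : 1 ≤ F y) : ∃ F' : G.Divisor, 0 ≤ F' ∧ F = F' + delta x + delta y := by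
  obtain ⟨F₁, hF₁, rfl, -⟩ := exists_eq_add_delta hF hx
  rw [Finsupp.add_apply, delta_of_ne hxy.symm, add_zero] at hy
  obtain ⟨F₂, hF₂, rfl, -⟩ := exists_eq_add_delta hF₁ hy
  exact ⟨F₂, hF₂, by abel⟩

lemma sum_le_of_nonpos {ι : Type*} {s : Finset ι} {φ : ι → ℤ} (h : ∀ q ∈ s, φ q ≤ 0) {q : ι}
    (hq : q ∈ s) : ∑ i ∈ s, φ i ≤ φ q := by
  classical
  rw [← Finset.add_sum_erase s φ hq]
  have := Finset.sum_nonpos fun i hi => h i (Finset.mem_of_mem_erase (a := q) hi)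
  linarith

lemma sum_le_of_nonpos₂ {ι : Type*} {s : Finset ι} {φ : ι → ℤ} (h : ∀ q ∈ s, φ q ≤ 0) {q q' : ι}
    (hq : q ∈ s) (hq' : q' ∈ s) (hne : q' ≠ q) : ∑ i ∈ s, φ i ≤ φ q + φ q' := by
  classical
  rw [← Finset.add_sum_erase s φ hq]
  have := sum_le_of_nonpos (fun i hi => h i (Finset.mem_of_mem_erase (a := q) hi))
    (Finset.mem_erase.2 ⟨hne, hq'⟩)
  linarith

lemma pairDiv_self {D : G.Divisor} (hD : Moves D) {x : G.Point} (h : partner hD x ≠ x) :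
    pairDiv hD x x = 1 := by
  rw [pairDiv, Finsupp.add_apply, delta_self, delta_of_ne h.symm, add_zero]

/-- An edge from `v` to `w` that does not join partners has a partner edge, possibly itself: the
function with divisor `(w + w̄) - (v + v̄)` is nonconstant exactly on these two edges. -/
lemma exists_partner_dart (hconn : G.Connected) [Nonempty G.E]
    (hval : ∀ x : G.Point, G.val x ≠ 1) {D : G.Divisor} (hD : Moves D)
    (hG : G.IsCanonicalLoopless) (d : G.Dart)
    (hd : G.head d ≠ partnerV hconn hval hD hG (G.tail d)) :
    ∃ d' : G.Dart, G.len d'.1 = G.len d.1 ∧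
      G.tail d' = partnerV hconn hval hD hG (G.tail d) ∧
      G.head d' = partnerV hconn hval hD hG (G.head d) ∧
      ∃ f, PL f ∧ (∀ z, divZ f z =
          pairDiv hD (Point.vertex (G.head d)) z - pairDiv hD (Point.vertex (G.tail d)) z) ∧
        ∀ d'' : G.Dart, f (Point.vertex (G.tail d'')) ≠ f (Point.vertex (G.head d'')) ↔
          d''.1 = d.1 ∨ d''.1 = d'.1 := by
  set ι := partnerV hconn hval hD hG with hι
  have hιv : ∀ v, partner hD (Point.vertex v) = Point.vertex (ι v) := fun v =>
    (vertex_partnerV hconn hval hD hG v).symm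
  have hιι : ∀ v, ι (ι v) = v := partnerV_partnerV hconn hval hD hG
  set v := G.tail d with hv
  set w := G.head d with hw
  have hvw : v ≠ w := hG.loopless.tail_ne_head d
  obtain ⟨f, hf, hfd⟩ :=
    (pairDiv_linEquiv hD (Point.vertex w)).trans (pairDiv_linEquiv hD (Point.vertex v)).symm
  obtain ⟨hmax, hfv⟩ := le_of_pairDiv hconn hval hD hf (pairDiv_nonneg hD _) hfd
  obtain ⟨hmin, hfw⟩ := ge_of_pairDiv hconn hval hD hf (pairDiv_nonneg hD _) hfd
  rw [hιv] at hfv hfw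
  set top := f (Point.vertex v) with htop
  set bot := f (Point.vertex w) with hbot
  have hpd : ∀ u x, x ≠ Point.vertex u → x ≠ Point.vertex (ι u) →
      pairDiv hD (Point.vertex u) x = 0 := fun u x h h' =>
    pairDiv_eq_zero hD h (by rwa [hιv])
  have hlt : bot < top := by
    by_contra! h
    have h1 := divZ_eq_zero_of_le hmax hmin h (Point.vertex w)
    rw [hfd, hpd v (Point.vertex w) (fun h => hvw (Point.vertex.inj h).symm)
      (fun h => hd (Point.vertex.inj h))] at h1
    have := one_le_pairDiv hD (Point.vertex w)
    omega
  have hpdv : ∀ x, f x ≠ top → pairDiv hD (Point.vertex v) x = 0 := fun x hx =>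
    hpd v x (fun h => hx (by rw [h])) (fun h => hx (by rw [h, hfv]))
  have hpdw : ∀ x, f x ≠ bot → pairDiv hD (Point.vertex w) x = 0 := fun x hx =>
    hpd w x (fun h => hx (by rw [h])) (fun h => hx (by rw [h, hfw]))
  -- `f` is linear on the edges
  have hint : ∀ (d' : G.Dart) (t : ℝ), t ∈ Ioo 0 (G.len d'.1) → divZ f (G.dpt d' t) = 0 := by
    intro d' t ht
    rw [hfd, hpd _ _ (dpt_ne_vertex ht _) (dpt_ne_vertex ht _),
      hpd _ _ (dpt_ne_vertex ht _) (dpt_ne_vertex ht _), sub_zero]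
  set m : G.Dart → ℤ := fun d' => slope f (d', 0) with hm
  have hlin : ∀ (d' : G.Dart) (t : ℝ), t ∈ Icc 0 (G.len d'.1) →
      f (G.dpt d' t) = f (Point.vertex (G.tail d')) + m d' * t := by
    intro d' t ht
    rw [hf.eq_of_divZ_eq_zero (hint d') ht, dpt_zero]
  have hends : ∀ d' : G.Dart, f (Point.vertex (G.head d')) =
      f (Point.vertex (G.tail d')) + m d' * G.len d'.1 := by
    intro d'
    rw [← hlin d' _ ⟨(dart_len_pos d').le, le_rfl⟩, dpt_len]
  have hmrev : ∀ d', m (G.rev d') = -m d' := by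
    intro d'
    have h := slope_rev_of_slope_eq hf (hint d') (t := G.len d'.1) ⟨dart_len_pos d', le_rfl⟩
    rwa [sub_self] at h
  have hupd : ∀ (d' : G.Dart) (t : ℝ), t ∈ Ioo 0 (G.len d'.1) →
      up f (G.dpt d' t) = max (m d') 0 + max (-m d') 0 := by
    intro d' t ht
    rw [up, sum_dirs_dpt _ ht, hf.slope_eq_of_divZ_eq_zero (hint d') ⟨ht.1.le, ht.2⟩,
      slope_rev_of_slope_eq hf (hint d') ⟨ht.1, ht.2.le⟩]
  -- the divisor cut out by a level
  have hlev : ∀ c, bot < c → c < top → ∃ F : G.Divisor, 0 ≤ F ∧ LinEquiv F D ∧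
      Divisor.deg F = 2 ∧ (∀ x, f x = c → F x = up f x) ∧ ∀ x, f x ≠ c → F x = 0 := by
    intro c hc hc'
    obtain ⟨F, hF, hFe, hgtF, heq, hltF⟩ := hf.exists_level_divisor (pairDiv_nonneg hD _)
      (pairDiv_nonneg hD _) hfd c
    refine ⟨F, hF, hFe.trans (pairDiv_linEquiv hD _), ?_, fun x hx => ?_,
      fun x hx => ?_⟩
    · rw [hFe.deg_eq, pairDiv, deg_add, deg_delta, deg_delta]
      rfl
    · rw [heq x hx, hpdv x (by rw [hx]; exact hc'.ne), zero_add]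
    · rcases lt_or_gt_of_ne hx with h | h
      · rw [hltF x h, hpdv x (h.trans hc').ne]
      · rw [hgtF x h, hpdw x (hc.trans h).ne']
  have hmd : m d < 0 := by
    have h1 : bot = top + m d * G.len d.1 := hends d
    have h2 : (m d : ℝ) < 0 := by
      by_contra! h
      have := mul_nonneg h (dart_len_pos d).le
      linarith
    exact_mod_cast h2
  have hLd := dart_len_pos d
  -- the inner point at a given level of an edge that descends from `top` to `bot`
  have hxc' : ∀ d' : G.Dart, f (Point.vertex (G.tail d')) = top →
      f (Point.vertex (G.head d')) = bot → ∀ c, bot < c → c < top →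
      ∃ t ∈ Ioo 0 (G.len d'.1), f (G.dpt d' t) = c := by
    intro d' hd₁ hd₂ c hc hc'
    obtain ⟨t, ht, htc, -⟩ := hf.exists_level (d := d') (a := 0) (b := G.len d'.1) (c := c) le_rfl
      (dart_len_pos d').le le_rfl (by rw [dpt_zero, hd₁]; exact hc')
      (by rw [dpt_len, hd₂]; exact hc.le)
    refine ⟨t, ⟨ht.1, lt_of_le_of_ne ht.2 ?_⟩, htc⟩
    rintro rfl
    rw [dpt_len, hd₂] at htc
    exact hc.ne htc
  have hxc := hxc' d rfl rfl
  have hupx : ∀ t ∈ Ioo 0 (G.len d.1), up f (G.dpt d t) = -m d := by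
    intro t ht
    rw [hupd d t ht, max_eq_right hmd.le, max_eq_left (by omega), zero_add]
  -- an inner point at an intermediate level on an edge on which `f` is not constant
  have hnc : ∀ d' : G.Dart, f (Point.vertex (G.tail d')) ≠ f (Point.vertex (G.head d')) →
      ∃ t ∈ Ioo 0 (G.len d'.1), bot < f (G.dpt d' t) ∧ f (G.dpt d' t) < top ∧
        1 ≤ up f (G.dpt d' t) := by
    intro d' hne
    have hL := dart_len_pos d'
    have hm0 : m d' ≠ 0 := fun h => hne (by rw [hends d', h]; simp)
    have hmid : G.len d'.1 / 2 ∈ Ioo 0 (G.len d'.1) := ⟨half_pos hL, half_lt_self hL⟩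
    have h1 := hlin d' _ (Ioo_subset_Icc_self hmid)
    have h2 := hends d'
    have h3 := hmin (Point.vertex (G.tail d'))
    have h4 := hmin (Point.vertex (G.head d'))
    have h5 := hmax (Point.vertex (G.tail d'))
    have h6 := hmax (Point.vertex (G.head d'))
    refine ⟨_, hmid, ?_, ?_, ?_⟩
    · rcases lt_or_gt_of_ne hne with h | h <;> linarith
    · rcases lt_or_gt_of_ne hne with h | h <;> linarith
    · rw [hupd d' _ hmid]
      omega
  -- vertices from which `f` decreases maximally
  have htail : ∀ d' : G.Dart, f (Point.vertex (G.tail d')) = top → m d' < 0 →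
      G.tail d' = v ∨ G.tail d' = ι v := by
    intro d' ht hm'
    by_contra! h
    have hmax' : ∀ z, f z ≤ f (Point.vertex (G.tail d')) := fun z => (hmax z).trans_eq ht.symm
    have h1 : 0 ≤ divZ f (Point.vertex (G.tail d')) := by
      rw [hfd, hpd v _ (fun h' => h.1 (Point.vertex.inj h')) fun h' => h.2 (Point.vertex.inj h'),
        sub_zero]
      exact pairDiv_nonneg hD _ _
    exact hm'.ne (hf.slope_eq_zero_of_isMax hmax' h1 (mem_dirs_tail d'))
  have hhead : ∀ d' : G.Dart, f (Point.vertex (G.head d')) = bot → m d' < 0 →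
      G.head d' = w ∨ G.head d' = ι w := by
    intro d' ht hm'
    by_contra! h
    have hmin' : ∀ z, (-f) z ≤ (-f) (Point.vertex (G.tail (G.rev d'))) := fun z => by
      rw [tail_rev, Pi.neg_apply, Pi.neg_apply, ht]
      exact neg_le_neg (hmin z)
    have h1 : 0 ≤ divZ (-f) (Point.vertex (G.tail (G.rev d'))) := by
      rw [hf.divZ_neg, hfd, tail_rev, hpd w _ (fun h' => h.1 (Point.vertex.inj h'))
        fun h' => h.2 (Point.vertex.inj h'), zero_sub, neg_neg]
      exact pairDiv_nonneg hD _ _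
    have h2 := hf.neg.slope_eq_zero_of_isMax hmin' h1 (mem_dirs_tail (G.rev d'))
    rw [hf.slope_neg (mem_dirs_tail (G.rev d'))] at h2
    have h3 := hmrev d'
    simp only [hm] at h3 hm'
    omega
  have hne_of_fst : ∀ d' d'' : G.Dart, m d' ≠ 0 → d''.1 = d'.1 →
      f (Point.vertex (G.tail d'')) ≠ f (Point.vertex (G.head d'')) := by
    intro d' d'' hm' h h'
    have h1 := hends d''
    rw [← h'] at h1
    have h2 : (m d'' : ℝ) * G.len d''.1 = 0 := by linarith
    have h3 : m d'' = 0 := by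
      rcases mul_eq_zero.1 h2 with h3 | h3
      · exact_mod_cast h3
      · exact absurd h3 (dart_len_pos d'').ne'
    rcases eq_or_eq_rev_of_fst_eq h with rfl | rfl
    · exact hm' h3
    · rw [hmrev] at h3
      exact hm' (neg_eq_zero.1 h3)
  have hslv : ∀ p ∈ G.dirs (Point.vertex v), slope f p ≤ 0 := fun p hp =>
    hf.slope_nonpos_of_isMax hmax hp
  have hslw : ∀ p ∈ G.dirs (Point.vertex w), slope (-f) p ≤ 0 := fun p hp =>
    hf.neg.slope_nonpos_of_isMax (fun z => neg_le_neg (hmin z)) hp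
  have hdivv : divZ f (Point.vertex v) = -pairDiv hD (Point.vertex v) (Point.vertex v) := by
    rw [hfd, hpdw _ hlt.ne', zero_sub]
  have hdivw : divZ (-f) (Point.vertex w) = -pairDiv hD (Point.vertex w) (Point.vertex w) := by
    rw [hf.divZ_neg, hfd, hpdv _ hlt.ne, sub_zero]
  have hslrev : ∀ d' : G.Dart, slope (-f) (G.rev d', 0) = m d' := fun d' => by
    rw [hf.slope_neg (mem_dirs_tail (G.rev d'))]
    have := hmrev d'
    simp only [hm] at this ⊢
    omega
  have hself : ∀ u, pairDiv hD (Point.vertex u) (Point.vertex u) ≠ 1 → u = ι u := by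
    intro u hu
    by_contra h
    refine hu (pairDiv_self hD fun h' => h ?_)
    rw [hιv] at h'
    exact (Point.vertex.inj h').symm
  rcases eq_or_ne (m d) (-1) with hm1 | hm1
  · -- slope one: the edge is not a bridge
    have hnb : ¬ IsBridge d.1 := by
      intro hb
      have hfixv := hD.linEquiv_of_isBridge hconn hval hb
      have hfixw := hD.linEquiv_of_isBridge hconn hval (d := G.rev d) hb
      rw [tail_rev] at hfixw
      obtain ⟨B, hB⟩ := hb.exists_isCut
      obtain ⟨b, hb, hbd, hb0, hb1, -⟩ := hB.exists_fun
      have hpv : pairDiv hD (Point.vertex v) = delta (Point.vertex v) + delta (Point.vertex v) := by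
        rw [pairDiv, partner_of_fixed hD hfixv]
      have hpw : pairDiv hD (Point.vertex w) = delta (Point.vertex w) + delta (Point.vertex w) := by
        rw [pairDiv, partner_of_fixed hD hfixw]
      have hsum := hf.add (hb.add hb)
      have hconst := hsum.eq_of_divZ_nonneg hconn (fun x => by
        rw [hf.divZ_add (hb.add hb), hb.divZ_add hb, hfd, hbd, hpv, hpw]
        simp only [Finsupp.add_apply]
        exact le_of_eq (by ring)) (Point.vertex v) (Point.vertex w)
      simp only [Pi.add_apply] at hconst
      rw [hb0, hb1] at hconst
      have h1 : bot = top + m d * G.len d.1 := hends d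
      rw [hm1] at h1
      push_cast at h1
      linarith
    have hnovert : ∀ u, bot < f (Point.vertex u) → f (Point.vertex u) < top →
        up f (Point.vertex u) ≤ 0 := by
      intro u hu hu'
      by_contra! hup
      obtain ⟨F, hF, hFD, hFdeg, hFx, hF0⟩ := hlev _ hu hu'
      obtain ⟨t, ht, htc⟩ := hxc _ hu hu'
      have h1 : 1 ≤ F (G.dpt d t) := by
        rw [hFx _ htc, hupx t ht]
        omega
      have h2 : 1 ≤ F (Point.vertex u) := by
        rw [hFx _ rfl]
        omega
      obtain ⟨F', hF', rfl⟩ := two_le_of_ne hF (dpt_ne_vertex ht u) h1 h2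
      rw [deg_add, deg_add, deg_delta, deg_delta] at hFdeg
      rw [eq_zero_of_deg_eq_zero hF' (by omega), zero_add] at hFD
      by_cases hfix : LinEquiv (delta (Point.vertex u) + delta (Point.vertex u)) D
      · have h3 := rigid_of_not_isBridge hconn hnb ht (Point.vertex u)
          (hfix.trans hFD.symm).add_right_cancel
        exact dpt_ne_vertex ht u h3.symm
      · rw [add_comm] at hFD
        have h3 := eq_partner hconn hval hD hfix hFD
        rw [hιv] at h3
        exact dpt_ne_vertex ht _ h3
    -- a second edge at some level
    obtain ⟨c, hc, hc'⟩ := exists_between hlt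
    obtain ⟨F, hF, hFD, hFdeg, hFx, hF0⟩ := hlev c hc hc'
    obtain ⟨t, ht, htc⟩ := hxc c hc hc'
    have hFt : F (G.dpt d t) = 1 := by
      rw [hFx _ htc, hupx t ht, hm1]
      rfl
    obtain ⟨y, rfl⟩ := exists_eq_delta_add hF hFdeg hFt.ge
    have hyt : y ≠ G.dpt d t := by
      rintro rfl
      rw [Finsupp.add_apply, delta_self] at hFt
      omega
    have hFy : (delta (G.dpt d t) + delta y) y = 1 := by
      rw [Finsupp.add_apply, delta_self, delta_of_ne hyt, zero_add]
    have hyc : f y = c := by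
      by_contra h
      rw [hF0 y h] at hFy
      omega
    rw [hFx y hyc] at hFy
    obtain ⟨d', s, hs, rfl, hm'⟩ : ∃ (d' : G.Dart) (s : ℝ), s ∈ Ioo 0 (G.len d'.1) ∧
        y = G.dpt d' s ∧ m d' = -1 := by
      rcases vertex_or_dpt y with ⟨u, rfl⟩ | ⟨d₁, s, hs, rfl⟩
      · have := hnovert u (by rw [hyc]; exact hc) (by rw [hyc]; exact hc')
        omega
      · rw [hupd d₁ s hs] at hFy
        rcases lt_or_ge (m d₁) 0 with h | h
        · exact ⟨d₁, s, hs, rfl, by omega⟩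
        · refine ⟨G.rev d₁, G.len d₁.1 - s, ⟨by simp [hs.2], by simp [hs.1]⟩, ?_, ?_⟩
          · rw [dpt_rev, sub_sub_cancel]
          · rw [hmrev]
            omega
    have hfst : d'.1 ≠ d.1 := by
      intro h
      rcases eq_or_eq_rev_of_fst_eq h with rfl | rfl
      · rw [hlin d' s (Ioo_subset_Icc_self hs)] at hyc
        rw [hlin d' t (Ioo_subset_Icc_self ht), ← hyc, hm1] at htc
        push_cast at htc
        exact hyt (by rw [show s = t by linarith])
      · rw [hmrev, hm1] at hm'
        omega
    have hflat : ∀ u, bot < f (Point.vertex u) → f (Point.vertex u) < top →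
        ∀ p ∈ G.dirs (Point.vertex u), slope f p = 0 := by
      intro u hu hu'
      have h1 : ∀ p ∈ G.dirs (Point.vertex u), slope f p ≤ 0 := fun p hp =>
        (slope_le_up f hp).trans (hnovert u hu hu')
      refine (Finset.sum_eq_zero_iff_of_nonpos h1).1 ?_
      change divZ f _ = 0
      rw [hfd, hpdw _ hu.ne', hpdv _ hu'.ne, sub_zero]
    have hlin' := hlin d' s (Ioo_subset_Icc_self hs)
    have hends' := hends d'
    rw [hm'] at hlin' hends'
    push_cast at hlin' hends'
    have hs1 : 0 < s := hs.1
    have hs2 : s < G.len d'.1 := hs.2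
    have httop : f (Point.vertex (G.tail d')) = top := by
      refine le_antisymm (hmax _) (not_lt.1 fun h => ?_)
      have := hflat _ (by linarith) h _ (mem_dirs_tail d')
      simp only [hm] at hm'
      omega
    have hhbot : f (Point.vertex (G.head d')) = bot := by
      refine le_antisymm (not_lt.1 fun h => ?_) (hmin _)
      have h1 := hflat _ h (by linarith) (G.rev d', 0) (mem_dirs_vertex.2 ⟨rfl, tail_rev d'⟩)
      have h2 := hmrev d'
      simp only [hm] at hm' h2
      omega
    have hlen : G.len d'.1 = G.len d.1 := by
      have h1 : bot = top + m d * G.len d.1 := hends d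
      rw [hm1] at h1
      push_cast at h1
      linarith
    refine ⟨d', hlen, ?_, ?_, f, hf, hfd, fun d'' => ⟨fun hne => ?_, fun h => ?_⟩⟩
    · rcases htail d' httop (by omega) with h | h
      · rw [h]
        refine hself v fun h1 => ?_
        have h2 := sum_le_of_nonpos₂ hslv (mem_dirs_vertex.2 ⟨rfl, hv.symm⟩)
          (mem_dirs_vertex.2 ⟨rfl, h⟩) fun h' => hfst (by rw [(Prod.mk.inj h').1])
        change divZ f _ ≤ m d + m d' at h2
        omega
      · exact h
    · rcases hhead d' hhbot (by omega) with h | h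
      · rw [h]
        refine hself w fun h1 => ?_
        have h2 := sum_le_of_nonpos₂ hslw
          (mem_dirs_vertex.2 ⟨rfl, (tail_rev d).trans hw.symm⟩)
          (mem_dirs_vertex.2 ⟨rfl, (tail_rev d').trans h⟩)
          fun h' => hfst (by rw [← rev_fst d', (Prod.mk.inj h').1, rev_fst])
        rw [hslrev, hslrev] at h2
        change divZ (-f) _ ≤ _ at h2
        omega
      · exact h
    · by_contra! hd''
      obtain ⟨r, hr, hr1, hr2, hr3⟩ := hnc d'' hne
      obtain ⟨F, hF, hFD, hFdeg, hFx, -⟩ := hlev _ hr1 hr2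
      obtain ⟨t₁, ht₁, ht₁c⟩ := hxc _ hr1 hr2
      obtain ⟨t₂, ht₂, ht₂c⟩ := hxc' d' httop hhbot _ hr1 hr2
      have e12 : G.dpt d t₁ ≠ G.dpt d' t₂ := fun h =>
        hfst (fst_eq_of_dpt_eq ht₁ (Ioo_subset_Icc_self ht₂) h).1.symm
      have e1 : G.dpt d'' r ≠ G.dpt d t₁ := fun h =>
        hd''.1 (fst_eq_of_dpt_eq hr (Ioo_subset_Icc_self ht₁) h).1
      have e2 : G.dpt d'' r ≠ G.dpt d' t₂ := fun h =>
        hd''.2 (fst_eq_of_dpt_eq hr (Ioo_subset_Icc_self ht₂) h).1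
      have h1 : 1 ≤ F (G.dpt d t₁) := by
        rw [hFx _ ht₁c, hupx _ ht₁]
        omega
      have h2 : 1 ≤ F (G.dpt d' t₂) := by
        rw [hFx _ ht₂c, hupd _ _ ht₂]
        omega
      rw [← hFx _ rfl] at hr3
      obtain ⟨F', hF', rfl⟩ := two_le_of_ne hF e12 h1 h2
      rw [deg_add, deg_add, deg_delta, deg_delta] at hFdeg
      rw [eq_zero_of_deg_eq_zero hF' (by omega), zero_add, Finsupp.add_apply, delta_of_ne e1,
        delta_of_ne e2] at hr3
      omega
    · rcases h with h | h
      · exact hne_of_fst d d'' hmd.ne h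
      · exact hne_of_fst d' d'' (by omega) h
  · -- slope at least two: `f` is constant on all other edges
    refine ⟨d, rfl, ?_, ?_, f, hf, hfd, fun d'' => ⟨fun hne => ?_, fun h => ?_⟩⟩
    · refine hself v fun h1 => ?_
      have h2 := sum_le_of_nonpos hslv (mem_dirs_vertex.2 ⟨rfl, hv.symm⟩)
      change divZ f _ ≤ m d at h2
      omega
    · refine hself w fun h1 => ?_
      have h2 := sum_le_of_nonpos hslw (mem_dirs_vertex.2 ⟨rfl, (tail_rev d).trans hw.symm⟩)
      rw [hslrev] at h2
      change divZ (-f) _ ≤ _ at h2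
      omega
    · rw [or_self]
      by_contra hd''
      obtain ⟨r, hr, hr1, hr2, hr3⟩ := hnc d'' hne
      obtain ⟨F, hF, hFD, hFdeg, hFx, -⟩ := hlev _ hr1 hr2
      obtain ⟨t₁, ht₁, ht₁c⟩ := hxc _ hr1 hr2
      have e1 : G.dpt d'' r ≠ G.dpt d t₁ := fun h =>
        hd'' (fst_eq_of_dpt_eq hr (Ioo_subset_Icc_self ht₁) h).1
      have h1 : 2 ≤ F (G.dpt d t₁) := by
        rw [hFx _ ht₁c, hupx _ ht₁]
        omega
      rw [← hFx _ rfl] at hr3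
      obtain ⟨F', hF', rfl⟩ := two_le_of_ne hF e1 hr3 (by omega)
      rw [deg_add, deg_add, deg_delta, deg_delta] at hFdeg
      rw [eq_zero_of_deg_eq_zero hF' (by omega), zero_add, Finsupp.add_apply, delta_self,
        delta_of_ne e1.symm] at h1
      omega
    · exact hne_of_fst d d'' hmd.ne (by simpa using h)

/-! ### Trees -/

lemma joins_symm {e : G.E} {v w : G.V} (h : G.Joins e v w) : G.Joins e w v :=
  h.trans Sym2.eq_swap

lemma Connected.of_reachable {v₀ : G.V} (h : ∀ v, G.toSimple.Reachable v₀ v) : G.Connected where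
  preconnected v w := (h v).symm.trans (h w)
  nonempty := ⟨v₀⟩

/-- A graph is a tree when it is connected and all its edges are bridges. -/
lemma isTree_iff : G.IsTree ↔ G.Connected ∧ ∀ e : G.E, IsBridge e := by
  constructor
  · rintro ⟨hl, hinj, hc, hac⟩
    refine ⟨hc, fun e => ?_⟩
    have hadj : G.toSimple.Adj (G.src e) (G.tgt e) := ⟨hl e, e, rfl⟩
    have hb := SimpleGraph.isAcyclic_iff_forall_adj_isBridge.1 hac hadj
    rw [SimpleGraph.isBridge_iff] at hb
    set H := G.toSimple \ SimpleGraph.fromEdgeSet {s(G.src e, G.tgt e)} with hH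
    refine ⟨(e, true), {v | ¬ H.Reachable (G.src e) v}, rfl, ?_, hb, fun d hd => ?_⟩
    · exact fun h => h (SimpleGraph.Reachable.refl _)
    · have hne : s(G.tail d, G.head d) ≠ s(G.src e, G.tgt e) := by
        intro h
        refine hd (hinj ?_)
        show s(G.src d.1, G.tgt d.1) = s(G.src e, G.tgt e)
        rw [← h]
        exact joins_dart d
      have hadj : H.Adj (G.tail d) (G.head d) := by
        rw [hH, SimpleGraph.sdiff_adj, SimpleGraph.fromEdgeSet_adj]
        exact ⟨⟨hl.tail_ne_head d, d.1, joins_dart d⟩, fun h => hne h.1⟩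
      exact not_congr ⟨fun h => h.trans hadj.reachable, fun h => h.trans hadj.symm.reachable⟩
  · rintro ⟨hc, hb⟩
    have hcut : ∀ e : G.E, ∃ B : Set G.V, G.src e ∉ B ∧ G.tgt e ∈ B ∧
        ∀ e', e' ≠ e → (G.src e' ∈ B ↔ G.tgt e' ∈ B) := by
      intro e
      obtain ⟨B, h1, h2, h3⟩ := IsBridge.exists_isCut (d := (e, true)) (hb e)
      exact ⟨B, h1, h2, fun e' he' => h3 (e', true) he'⟩
    have hjoins : ∀ {e : G.E} {v w : G.V}, G.Joins e v w → ∀ B : Set G.V,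
        ((G.src e ∈ B ↔ G.tgt e ∈ B) ↔ (v ∈ B ↔ w ∈ B)) := by
      intro e v w h B
      rcases Sym2.eq_iff.1 h with ⟨rfl, rfl⟩ | ⟨rfl, rfl⟩
      · exact Iff.rfl
      · exact Iff.comm
    refine ⟨fun e he => ?_, fun e e' he => ?_, hc, ?_⟩
    · obtain ⟨B, h1, h2, -⟩ := hcut e
      exact h1 (he ▸ h2)
    · by_contra hne
      obtain ⟨B, h1, h2, h3⟩ := hcut e
      have h4 := (hjoins (e := e') he.symm B).1 (h3 e' (Ne.symm hne))
      exact h1 (h4.2 h2)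
    · rw [SimpleGraph.isAcyclic_iff_forall_adj_isBridge]
      intro v w hvw
      rw [SimpleGraph.isBridge_iff]
      obtain ⟨hne, e, he⟩ := hvw
      obtain ⟨B, h1, h2, h3⟩ := hcut e
      rintro ⟨p⟩
      have key : ∀ a b, (G.toSimple \ SimpleGraph.fromEdgeSet {s(v, w)}).Walk a b →
          (a ∈ B ↔ b ∈ B) := by
        intro a b p
        induction p with
        | nil => exact Iff.rfl
        | cons hadj _ ih =>
          refine Iff.trans ?_ ih
          rw [SimpleGraph.sdiff_adj, SimpleGraph.fromEdgeSet_adj] at hadj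
          obtain ⟨⟨hab, e', he'⟩, hnot⟩ := hadj
          refine (hjoins he' B).1 (h3 e' ?_)
          rintro rfl
          exact hnot ⟨he'.symm.trans he, hab⟩
      exact h1 (((hjoins he B).2 (key v w p)).2 h2)

/-! ### The quotient by an involution -/

lemma smul_joins (k : G.Aut) (e : G.E) : G.Joins (k • e) (k • G.src e) (k • G.tgt e) :=
  (k.2 e).1

lemma smul_len (k : G.Aut) (e : G.E) : G.len (k • e) = G.len e := (k.2 e).2

/-- The class of a vertex in the quotient. -/
def quotV (K : Subgroup G.Aut) (v : G.V) : (G.quotient K).V :=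
  (Quotient.mk _ v : MulAction.orbitRel.Quotient K G.V)

/-- The class in the quotient of an edge with inequivalent ends. -/
def quotE (K : Subgroup G.Aut) (e : G.SurvivingEdge K) : (G.quotient K).E :=
  (Quotient.mk _ e : G.QuotientEdge K)

lemma quotV_eq_iff {K : Subgroup G.Aut} {v w : G.V} :
    quotV K v = quotV K w ↔ ∃ k ∈ K, k • w = v := by
  refine Quotient.eq.trans ?_
  rw [MulAction.orbitRel_apply]
  constructor
  · rintro ⟨k, hk⟩
    exact ⟨k.1, k.2, hk⟩
  · rintro ⟨k, hk, hk'⟩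
    exact ⟨⟨k, hk⟩, hk'⟩

lemma quotV_smul {K : Subgroup G.Aut} {k : G.Aut} (hk : k ∈ K) (v : G.V) :
    quotV K (k • v) = quotV K v := quotV_eq_iff.2 ⟨k, hk, rfl⟩

lemma quotE_eq_iff {K : Subgroup G.Aut} {e e' : G.SurvivingEdge K} :
    quotE K e = quotE K e' ↔ ∃ k ∈ K, k • e'.1 = e.1 := by
  refine Quotient.eq.trans ?_
  change MulAction.orbitRel K G.E e.1 e'.1 ↔ _
  rw [MulAction.orbitRel_apply]
  constructor
  · rintro ⟨k, hk⟩
    exact ⟨k.1, k.2, hk⟩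
  · rintro ⟨k, hk, hk'⟩
    exact ⟨⟨k, hk⟩, hk'⟩

lemma survives_iff {K : Subgroup G.Aut} {e : G.E} :
    ¬ MulAction.orbitRel K G.V (G.src e) (G.tgt e) ↔ quotV K (G.src e) ≠ quotV K (G.tgt e) :=
  not_congr Quotient.eq.symm

lemma quotV_surjective (K : Subgroup G.Aut) : Function.Surjective (quotV K) :=
  Quotient.mk_surjective

lemma quotE_surjective (K : Subgroup G.Aut) : Function.Surjective (quotE K) :=
  Quotient.mk_surjective

lemma exists_rep_eq_smul {K : Subgroup G.Aut} (e : G.SurvivingEdge K) :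
    ∃ k ∈ K, QuotientEdge.rep (quotE K e) = k • e.1 := by
  have h : quotE K (Quotient.out (quotE K e : G.QuotientEdge K)) = quotE K e :=
    Quotient.out_eq (quotE K e : G.QuotientEdge K)
  obtain ⟨k, hk, hk'⟩ := quotE_eq_iff.1 h
  exact ⟨k, hk, hk'.symm⟩

lemma quotient_joins {K : Subgroup G.Aut} (e : G.SurvivingEdge K) {v w : G.V}
    (h : G.Joins e.1 v w) : (G.quotient K).Joins (quotE K e) (quotV K v) (quotV K w) := by
  obtain ⟨k, hk, hr⟩ := exists_rep_eq_smul e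
  have h1 : s(quotV K (G.src (k • e.1)), quotV K (G.tgt (k • e.1))) =
      s(quotV K (k • G.src e.1), quotV K (k • G.tgt e.1)) :=
    congrArg (Sym2.map (quotV K)) (smul_joins k e.1)
  have h2 : s(quotV K (G.src e.1), quotV K (G.tgt e.1)) = s(quotV K v, quotV K w) :=
    congrArg (Sym2.map (quotV K)) h
  rw [quotV_smul hk, quotV_smul hk, h2, ← hr] at h1
  exact h1

lemma quotient_connected (hconn : G.Connected) (K : Subgroup G.Aut) :
    (G.quotient K).Connected := by
  obtain ⟨v₀⟩ := hconn.nonempty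
  refine Connected.of_reachable (v₀ := quotV K v₀) fun x => ?_
  obtain ⟨v, rfl⟩ := quotV_surjective K x
  refine hconn.forall_vertex
    (P := fun v => (G.quotient K).toSimple.Reachable (quotV K v₀) (quotV K v))
    (fun d hd => ?_) (SimpleGraph.Reachable.refl _) v
  by_cases h : quotV K (G.tail d) = quotV K (G.head d)
  · rwa [← h]
  · have hs : quotV K (G.src d.1) ≠ quotV K (G.tgt d.1) := by
      rcases d with ⟨e, _ | _⟩
      · exact Ne.symm h
      · exact h
    refine hd.trans (SimpleGraph.Adj.reachable ⟨h, quotE K ⟨d.1, survives_iff.2 hs⟩, ?_⟩)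
    exact quotient_joins _ (joins_dart d)

lemma mem_zpowers_of_sq_eq_one {i : G.Aut} (hi : i ^ 2 = 1) {k : G.Aut}
    (hk : k ∈ Subgroup.zpowers i) : k = 1 ∨ k = i := by
  obtain ⟨n, rfl⟩ := Subgroup.mem_zpowers_iff.1 hk
  have h2 : i ^ (2 : ℤ) = 1 := by exact_mod_cast hi
  rcases Int.even_or_odd' n with ⟨m, rfl | rfl⟩
  · left
    rw [zpow_mul, h2, one_zpow]
  · right
    rw [zpow_add, zpow_mul, h2, one_zpow, one_mul, zpow_one]

/-! ### From a moving divisor to an involution -/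

lemma PL.sub_eq_sub (hconn : G.Connected) [Nonempty G.E] {f g : G.Point → ℝ} (hf : PL f)
    (hg : PL g) (h : ∀ x, divZ f x = divZ g x) (x y : G.Point) : f x - f y = g x - g y := by
  have h1 := (hf.sub hg).eq_of_divZ_nonneg hconn
    (fun z => by rw [hf.divZ_sub hg, h, sub_self]) x y
  simp only [Pi.sub_apply] at h1
  linarith

/-- The involution `ι` maps the edge `e` to `e'`. If `e` joins `v` and `ι v`, then `e' = e`, and
otherwise there is a function with divisor `P (tgt e) - P (src e)` that is nonconstant exactly on
`e` and `e'`. Here `P v` stands for the divisor `v + ι v`. -/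
structure IsPartnerEdge (ι : G.V → G.V) (P : G.V → G.Divisor) (e e' : G.E) : Prop where
  joins : G.Joins e' (ι (G.src e)) (ι (G.tgt e))
  len_eq : G.len e' = G.len e
  eq_of_flip : G.tgt e = ι (G.src e) → e' = e
  exists_fun : G.tgt e ≠ ι (G.src e) → ∃ f, PL f ∧
    (∀ z, divZ f z = P (G.tgt e) z - P (G.src e) z) ∧
    ∀ e'', f (Point.vertex (G.src e'')) ≠ f (Point.vertex (G.tgt e'')) ↔ e'' = e ∨ e'' = e'

/-- The choice of the partner edges is an involution, because partner edges have the same function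
up to sign. -/
lemma exists_involution (hconn : G.Connected) [Nonempty G.E]
    (hval : ∀ x : G.Point, G.val x ≠ 1) (hG : G.IsCanonicalLoopless) {D : G.Divisor}
    (hD : Moves D) :
    ∃ (ι : G.V → G.V) (σ : G.E → G.E) (P : G.V → G.Divisor), (∀ v, ι (ι v) = v) ∧
      (∀ e, σ (σ e) = e) ∧ (∀ v, P (ι v) = P v) ∧ ∀ e, IsPartnerEdge ι P e (σ e) := by
  set ι := partnerV hconn hval hD hG with hι
  have hιι : ∀ v, ι (ι v) = v := partnerV_partnerV hconn hval hD hG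
  set P : G.V → G.Divisor := fun v => pairDiv hD (Point.vertex v) with hP
  have hPι : ∀ v, P (ι v) = P v := fun v => by
    simp only [hP, hι]
    rw [vertex_partnerV, pairDiv_partner hconn hval]
  have hex : ∀ e, ∃ e', IsPartnerEdge ι P e e' := by
    intro e
    by_cases h : G.tgt e = ι (G.src e)
    · refine ⟨e, ?_, rfl, fun _ => rfl, fun h' => absurd h h'⟩
      show s(G.src e, G.tgt e) = s(ι (G.src e), ι (G.tgt e))
      rw [h, hιι, Sym2.eq_swap]
    · obtain ⟨d', hl, ht, hh, f, hf, hfd, hiff⟩ :=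
        exists_partner_dart hconn hval hD hG (e, true) h
      refine ⟨d'.1, ?_, hl, fun h' => absurd h' h, fun _ => ⟨f, hf, hfd, fun e'' =>
        hiff (e'', true)⟩⟩
      have := joins_dart d'
      rwa [ht, hh] at this
  choose σ hσ using hex
  refine ⟨ι, σ, P, hιι, fun e => ?_, hPι, hσ⟩
  by_cases h : G.tgt e = ι (G.src e)
  · rw [(hσ e).eq_of_flip h, (hσ e).eq_of_flip h]
  · obtain ⟨f, hf, hfd, hfe⟩ := (hσ e).exists_fun h
    have hj := Sym2.eq_iff.1 (hσ e).joins
    have h' : G.tgt (σ e) ≠ ι (G.src (σ e)) := by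
      rcases hj with ⟨h1, h2⟩ | ⟨h1, h2⟩
      · rw [h1, h2, hιι]
        intro h3
        exact h (by rw [← h3, hιι])
      · rw [h1, h2, hιι]
        exact Ne.symm h
    obtain ⟨g, hg, hgd, hge⟩ := (hσ (σ e)).exists_fun h'
    have hfg : ∀ e'', f (Point.vertex (G.src e'')) ≠ f (Point.vertex (G.tgt e'')) ↔
        g (Point.vertex (G.src e'')) ≠ g (Point.vertex (G.tgt e'')) := by
      intro e''
      rcases hj with ⟨h1, h2⟩ | ⟨h1, h2⟩
      · have := hf.sub_eq_sub hconn hg (fun x => by rw [hfd, hgd, h1, h2, hPι, hPι])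
          (Point.vertex (G.src e'')) (Point.vertex (G.tgt e''))
        rw [← sub_ne_zero, this, sub_ne_zero]
      · have := hf.neg.sub_eq_sub hconn hg
          (fun x => by rw [hf.divZ_neg, hfd, hgd, h1, h2, hPι, hPι]; ring)
          (Point.vertex (G.src e'')) (Point.vertex (G.tgt e''))
        simp only [Pi.neg_apply] at this
        rw [← sub_ne_zero, ← neg_ne_zero, neg_sub', this, sub_ne_zero]
    have h1 := (hge (σ (σ e))).2 (Or.inr rfl)
    have h2 := (hfe e).2 (Or.inl rfl)
    rw [← hfg, hfe] at h1
    rw [hfg, hge] at h2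
    rcases h1 with h1 | h1
    · exact h1
    · rcases h2 with h2 | h2
      · rw [h1, ← h2]
      · exact h2.symm

/-- A moving divisor gives an involution whose quotient is a tree. If an edge of the quotient were
not a bridge, the functions of other edges would add up to a function with the same divisor as the
function of this edge, but constant on it. -/
lemma exists_aut_of_moves (hconn : G.Connected) [Nonempty G.E]
    (hval : ∀ x : G.Point, G.val x ≠ 1) (hG : G.IsCanonicalLoopless) {D : G.Divisor}
    (hD : Moves D) :
    ∃ i : G.Aut, i ^ 2 = 1 ∧ (G.quotient (Subgroup.zpowers i)).IsTree := by
  obtain ⟨ι, σ, P, hι, hσ, hP, hpart⟩ := exists_involution hconn hval hG hD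
  set i : G.Aut := ⟨(Function.Involutive.toPerm ι hι, Function.Involutive.toPerm σ hσ),
    fun e => ⟨(hpart e).joins, (hpart e).len_eq⟩⟩ with hi
  have hi2 : i ^ 2 = 1 := by
    rw [pow_two]
    exact Subtype.ext (Prod.ext (Equiv.ext hι) (Equiv.ext hσ))
  set K := Subgroup.zpowers i with hK
  refine ⟨i, hi2, isTree_iff.2 ⟨quotient_connected hconn K, fun q => ?_⟩⟩
  have hiK : i ∈ K := Subgroup.mem_zpowers i
  have hPq : ∀ v w, quotV K v = quotV K w → P v = P w := by
    intro v w h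
    obtain ⟨k, hk, rfl⟩ := quotV_eq_iff.1 h
    rcases mem_zpowers_of_sq_eq_one hi2 hk with rfl | rfl
    · rw [one_smul]
    · exact hP w
  have hsurv : ∀ e : G.SurvivingEdge K, G.tgt e.1 ≠ ι (G.src e.1) := by
    intro e h
    refine survives_iff.1 e.2 ?_
    rw [h]
    exact (quotV_smul hiK (G.src e.1)).symm
  obtain ⟨e₀, rfl⟩ := quotE_surjective K q
  obtain ⟨f₀, hf₀, hfd₀, hfe₀⟩ := (hpart e₀.1).exists_fun (hsurv e₀)
  -- the relation generated by the other edges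
  set R : G.V → G.V → Prop := fun v w => ∃ h, PL h ∧ (∀ z, divZ h z = P w z - P v z) ∧
    h (Point.vertex (G.src e₀.1)) = h (Point.vertex (G.tgt e₀.1)) with hR
  have hRsymm : ∀ v w, R v w → R w v := by
    rintro v w ⟨h, hh, hd, he⟩
    exact ⟨-h, hh.neg, fun z => by rw [hh.divZ_neg, hd]; ring, by simp [he]⟩
  have hRtrans : ∀ u v w, R u v → R v w → R u w := by
    rintro u v w ⟨h, hh, hd, he⟩ ⟨h', hh', hd', he'⟩
    exact ⟨h + h', hh.add hh', fun z => by rw [hh.divZ_add hh', hd, hd']; ring, by simp [he, he']⟩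
  have hRq : ∀ v w, quotV K v = quotV K w → R v w := fun v w h =>
    ⟨_, pl_const 0, fun z => by rw [divZ_const, hPq v w h, sub_self], rfl⟩
  have hRedge : ∀ e : G.SurvivingEdge K, quotE K e ≠ quotE K e₀ →
      R (G.src e.1) (G.tgt e.1) := by
    intro e hne
    obtain ⟨f, hf, hfd, hfe⟩ := (hpart e.1).exists_fun (hsurv e)
    refine ⟨f, hf, hfd, ?_⟩
    by_contra h
    rcases (hfe e₀.1).1 h with h | h
    · exact hne (quotE_eq_iff.2 ⟨1, one_mem _, by rw [one_smul, h]⟩)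
    · exact hne.symm (quotE_eq_iff.2 ⟨i, hiK, h.symm⟩)
  have hR0 : ¬ R (G.src e₀.1) (G.tgt e₀.1) := by
    rintro ⟨h, hh, hd, he⟩
    have h1 := hf₀.sub_eq_sub hconn hh (fun z => by rw [hfd₀, hd]) (Point.vertex (G.src e₀.1))
      (Point.vertex (G.tgt e₀.1))
    rw [he, sub_self, sub_eq_zero] at h1
    exact (hfe₀ e₀.1).2 (Or.inl rfl) h1
  obtain ⟨d, hd, htl, hhd⟩ :=
    joins_iff_exists_dart.1 (quotient_joins e₀ (rfl : G.Joins e₀.1 (G.src e₀.1) (G.tgt e₀.1)))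
  refine ⟨d, {x | ∃ v, quotV K v = x ∧ ¬ R (G.src e₀.1) v}, hd, ?_, ?_, fun d' hd' => ?_⟩
  · rintro ⟨v, hv, hn⟩
    rw [htl] at hv
    exact hn (hRq _ _ hv.symm)
  · exact ⟨_, hhd.symm, hR0⟩
  · obtain ⟨e, he⟩ := quotE_surjective K d'.1
    have hmem : ∀ v, quotV K v ∈ {x | ∃ v, quotV K v = x ∧ ¬ R (G.src e₀.1) v} ↔
        ¬ R (G.src e₀.1) v := by
      intro v
      constructor
      · rintro ⟨w, hw, hn⟩ hv
        exact hn (hRtrans _ _ _ hv (hRq _ _ hw.symm))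
      · exact fun h => ⟨v, rfl, h⟩
    have hre := hRedge e (by rw [he, ← hd]; exact hd')
    have key : quotV K (G.src e.1) ∈ {x | ∃ v, quotV K v = x ∧ ¬ R (G.src e₀.1) v} ↔
        quotV K (G.tgt e.1) ∈ {x | ∃ v, quotV K v = x ∧ ¬ R (G.src e₀.1) v} := by
      rw [hmem, hmem]
      exact not_congr ⟨fun h => hRtrans _ _ _ h hre, fun h => hRtrans _ _ _ h (hRsymm _ _ hre)⟩
    have hj := quotient_joins e (rfl : G.Joins e.1 (G.src e.1) (G.tgt e.1))
    rw [he] at hj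
    rcases Sym2.eq_iff.1 ((joins_dart d').symm.trans hj) with ⟨h1, h2⟩ | ⟨h1, h2⟩
    · rw [h1, h2]
      exact key
    · rw [h1, h2]
      exact key.symm

/-! ### From an involution to a morphism -/

lemma incident_iff_of_joins {e : G.E} {v w x : G.V} (h : G.Joins e v w) :
    G.Incident e x ↔ v = x ∨ w = x := by
  rcases Sym2.eq_iff.1 h with ⟨rfl, rfl⟩ | ⟨rfl, rfl⟩
  · exact Iff.rfl
  · exact or_comm

lemma incident_tail (d : G.Dart) : G.Incident d.1 (G.tail d) :=
  (incident_iff_of_joins (joins_dart d)).2 (Or.inl rfl)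

/-- The identity does not have a tree as its quotient, because `G` has edges that are not
bridges. -/
lemma ne_one_of_isTree (hconn : G.Connected) [Nonempty G.E] (hval : ∀ x : G.Point, G.val x ≠ 1)
    (hl : G.Loopless) {i : G.Aut} (hT : (G.quotient (Subgroup.zpowers i)).IsTree) : i ≠ 1 := by
  rintro rfl
  obtain ⟨d, hd⟩ := exists_not_isBridge hconn hval
  set K := Subgroup.zpowers (1 : G.Aut) with hK
  have hK1 : ∀ k ∈ K, k = 1 := fun k hk => by
    rwa [hK, Subgroup.zpowers_one_eq_bot, Subgroup.mem_bot] at hk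
  have hs : ∀ e : G.E, ¬ MulAction.orbitRel K G.V (G.src e) (G.tgt e) := fun e => by
    rw [survives_iff, Ne, quotV_eq_iff]
    rintro ⟨k, hk, hk'⟩
    rw [hK1 k hk, one_smul] at hk'
    exact hl e hk'.symm
  have hbr := (isTree_iff.1 hT).2 (quotE K ⟨d.1, hs d.1⟩)
  obtain ⟨d', hd', ht, hh⟩ := joins_iff_exists_dart.1 (quotient_joins ⟨d.1, hs d.1⟩ (joins_dart d))
  rw [← hd'] at hbr
  obtain ⟨B, hB⟩ := hbr.exists_isCut
  refine hd ⟨d, quotV K ⁻¹' B, rfl, ?_, ?_, fun d₁ hd₁ => ?_⟩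
  · show quotV K (G.tail d) ∉ B
    rw [← ht]
    exact hB.1
  · show quotV K (G.head d) ∈ B
    rw [← hh]
    exact hB.2.1
  · obtain ⟨d₂, hd₂, ht₂, hh₂⟩ :=
      joins_iff_exists_dart.1 (quotient_joins ⟨d₁.1, hs d₁.1⟩ (joins_dart d₁))
    have := hB.2.2 d₂ fun h => by
      obtain ⟨k, hk, hk'⟩ := quotE_eq_iff.1 (hd₂.symm.trans (h.trans hd'))
      rw [hK1 k hk, one_smul] at hk'
      exact hd₁ hk'.symm
    rw [ht₂, hh₂] at this
    exact this

open Classical in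
/-- The quotient map, which contracts the edges with equivalent ends. -/
noncomputable def quotientMorphism (G : LengthGraph.{u}) (K : Subgroup G.Aut) :
    Morphism G (G.quotient K) where
  onV := quotV K
  onE e := if h : quotV K (G.src e) = quotV K (G.tgt e) then Sum.inl (quotV K (G.src e))
    else Sum.inr (quotE K ⟨e, survives_iff.2 h⟩)
  vertical e v' h := by
    split_ifs at h with h1
    · cases h
      exact ⟨rfl, h1.symm⟩
  horizontal e e' h := by
    split_ifs at h with h1
    · cases h
      exact quotient_joins _ rfl
  integral e e' h := by
    split_ifs at h with h1
    · cases h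
      obtain ⟨k, hk, hr⟩ := exists_rep_eq_smul ⟨e, survives_iff.2 h1⟩
      have hlen : G.len (QuotientEdge.rep (quotE K ⟨e, survives_iff.2 h1⟩)) = G.len e := by
        rw [hr, smul_len]
      refine ⟨Nat.card (MulAction.stabilizer K
        (QuotientEdge.rep (quotE K ⟨e, survives_iff.2 h1⟩))), ?_⟩
      change G.len (QuotientEdge.rep (quotE K ⟨e, survives_iff.2 h1⟩)) * _ / G.len e = _
      rw [hlen, mul_div_cancel_left₀ _ (G.len_pos e).ne']
      push_cast
      rfl

lemma quotientMorphism_onE_eq_iff {K : Subgroup G.Aut} {e : G.E} {e₀ : G.SurvivingEdge K} :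
    (quotientMorphism G K).onE e = Sum.inr (quotE K e₀) ↔ ∃ k ∈ K, k • e₀.1 = e := by
  constructor
  · intro h
    simp only [quotientMorphism] at h
    split_ifs at h with h1
    exact quotE_eq_iff.1 (Sum.inr.inj h)
  · rintro ⟨k, hk, rfl⟩
    have h1 : quotV K (G.src (k • e₀.1)) ≠ quotV K (G.tgt (k • e₀.1)) := by
      have h2 := survives_iff.1 e₀.2
      rcases Sym2.eq_iff.1 (smul_joins k e₀.1) with ⟨h3, h4⟩ | ⟨h3, h4⟩
      · rw [h3, h4, quotV_smul hk, quotV_smul hk]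
        exact h2
      · rw [h3, h4, quotV_smul hk, quotV_smul hk]
        exact h2.symm
    simp only [quotientMorphism]
    rw [dif_neg h1]
    exact congrArg Sum.inr (quotE_eq_iff.2 ⟨k, hk, rfl⟩)

open Classical in
/-- Summation over the fibre of an edge in the quotient by an involution, with the slopes as
weights: an edge fixed by the involution has slope two. -/
lemma sum_fibre {i : G.Aut} (hi : i ^ 2 = 1) (hi1 : i ≠ 1) {K : Subgroup G.Aut}
    (hK : K = Subgroup.zpowers i) (e₀ : G.SurvivingEdge K) (ψ : G.E → ℝ) :
    ∑ e ∈ Finset.univ.filter (fun e => (quotientMorphism G K).onE e = Sum.inr (quotE K e₀)),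
      ψ e * ((G.quotient K).len (quotE K e₀) / G.len e) = ψ e₀.1 + ψ (i • e₀.1) := by
  have hiK : i ∈ K := hK ▸ Subgroup.mem_zpowers i
  have hK2 : ∀ k ∈ K, k = 1 ∨ k = i := fun k hk => mem_zpowers_of_sq_eq_one hi (hK ▸ hk)
  have hfib : Finset.univ.filter (fun e => (quotientMorphism G K).onE e = Sum.inr (quotE K e₀)) =
      {e₀.1, i • e₀.1} := by
    ext e
    rw [Finset.mem_filter, quotientMorphism_onE_eq_iff]
    simp only [Finset.mem_univ, true_and, Finset.mem_insert, Finset.mem_singleton]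
    constructor
    · rintro ⟨k, hk, rfl⟩
      rcases hK2 k hk with rfl | rfl
      · exact Or.inl (one_smul _ _)
      · exact Or.inr rfl
    · rintro (rfl | rfl)
      · exact ⟨1, one_mem _, one_smul _ _⟩
      · exact ⟨i, hiK, rfl⟩
  have hii : i * i = 1 := by rw [← pow_two, hi]
  obtain ⟨k, hk, hr⟩ := exists_rep_eq_smul e₀
  have hlen : ∀ e, e = e₀.1 ∨ e = i • e₀.1 → (G.quotient K).len (quotE K e₀) / G.len e =
      Nat.card (MulAction.stabilizer K (QuotientEdge.rep (quotE K e₀))) := by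
    intro e he
    have h1 : G.len e = G.len e₀.1 := by
      rcases he with rfl | rfl
      · rfl
      · exact smul_len i _
    change G.len (QuotientEdge.rep (quotE K e₀)) * _ / G.len e = _
    rw [hr, smul_len, h1, mul_div_cancel_left₀ _ (G.len_pos _).ne']
  have hrep : i • QuotientEdge.rep (quotE K e₀) = QuotientEdge.rep (quotE K e₀) ↔
      i • e₀.1 = e₀.1 := by
    rw [hr]
    rcases hK2 k hk with rfl | rfl
    · rw [one_smul]
    · rw [← mul_smul, hii, one_smul]
      exact eq_comm
  have hcard : Nat.card K = 2 := by
    rw [hK, Nat.card_zpowers]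
    exact orderOf_eq_prime hi hi1
  rw [hfib]
  by_cases hfix : i • e₀.1 = e₀.1
  · have hstab : MulAction.stabilizer K (QuotientEdge.rep (quotE K e₀)) = ⊤ := by
      refine eq_top_iff.2 fun k' _ => ?_
      rw [MulAction.mem_stabilizer_iff]
      rcases hK2 k' k'.2 with h | h
      · change k'.1 • QuotientEdge.rep (quotE K e₀) = _
        rw [h, one_smul]
      · change k'.1 • QuotientEdge.rep (quotE K e₀) = _
        rw [h]
        exact hrep.2 hfix
    have h2 : Nat.card (MulAction.stabilizer K (QuotientEdge.rep (quotE K e₀))) = 2 := by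
      rw [hstab, Subgroup.card_top, hcard]
    rw [hfix, Finset.pair_eq_singleton, Finset.sum_singleton, hlen _ (Or.inl rfl), h2]
    push_cast
    ring
  · have hstab : MulAction.stabilizer K (QuotientEdge.rep (quotE K e₀)) = ⊥ := by
      refine eq_bot_iff.2 fun k' hk' => ?_
      rw [MulAction.mem_stabilizer_iff] at hk'
      rcases hK2 k' k'.2 with h | h
      · exact Subgroup.mem_bot.2 (Subtype.ext h)
      · change k'.1 • QuotientEdge.rep (quotE K e₀) = _ at hk'
        rw [h] at hk'
        exact absurd (hrep.1 hk') hfix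
    have h2 : Nat.card (MulAction.stabilizer K (QuotientEdge.rep (quotE K e₀))) = 1 := by
      rw [hstab, Subgroup.card_bot]
    rw [Finset.sum_pair (Ne.symm hfix), hlen _ (Or.inl rfl), hlen _ (Or.inr rfl), h2]
    push_cast
    ring

open Classical in
lemma mult_quotientMorphism {i : G.Aut} (hi : i ^ 2 = 1) (hi1 : i ≠ 1) {K : Subgroup G.Aut}
    (hK : K = Subgroup.zpowers i) (x : G.V) (q : (G.quotient K).E)
    (hq : (G.quotient K).Incident q (quotV K x)) :
    (quotientMorphism G K).mult x q = if i • x = x then 2 else 1 := by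
  have hiK : i ∈ K := hK ▸ Subgroup.mem_zpowers i
  obtain ⟨e₀, rfl⟩ := quotE_surjective K q
  have hii : i * i = 1 := by rw [← pow_two, hi]
  rw [Morphism.mult, ← Finset.filter_filter, Finset.filter_comm, Finset.sum_filter]
  have h1 := sum_fibre hi hi1 hK e₀ fun e => if G.Incident e x then 1 else 0
  simp only [ite_mul, one_mul, zero_mul] at h1
  rw [h1]
  -- the end of `e₀` that lies over the image of `x`
  obtain ⟨y, z, hyz, hy⟩ : ∃ y z, G.Joins e₀.1 y z ∧ quotV K y = quotV K x := by
    rcases (incident_iff_of_joins (quotient_joins e₀ rfl)).1 hq with h | h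
    · exact ⟨_, _, rfl, h⟩
    · exact ⟨_, _, joins_symm rfl, h⟩
  have hz : quotV K z ≠ quotV K x := by
    have h2 := survives_iff.1 e₀.2
    rcases Sym2.eq_iff.1 hyz with ⟨h3, h4⟩ | ⟨h3, h4⟩
    · rw [h3, h4, hy] at h2
      exact h2.symm
    · rw [h3, h4, hy] at h2
      exact h2
  have hinc : G.Incident e₀.1 x ↔ y = x := by
    rw [incident_iff_of_joins hyz]
    exact or_iff_left fun h => hz (by rw [h])
  have hinc' : G.Incident (i • e₀.1) x ↔ i • y = x := by
    have h3 : G.Joins (i • e₀.1) (i • y) (i • z) :=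
      (smul_joins i e₀.1).trans (congrArg (Sym2.map (i • ·)) hyz)
    rw [incident_iff_of_joins h3]
    exact or_iff_left fun h => hz (by rw [← h, quotV_smul hiK])
  simp only [hinc, hinc']
  obtain ⟨k, hk, rfl⟩ := quotV_eq_iff.1 hy
  rcases mem_zpowers_of_sq_eq_one hi (hK ▸ hk) with rfl | rfl
  · rw [one_smul, if_pos rfl]
    split_ifs <;> norm_num
  · rw [← mul_smul, hii, one_smul, if_pos rfl]
    split_ifs <;> norm_num

lemma exists_morphism_of_aut (hconn : G.Connected) [hE : Nonempty G.E]
    (hval : ∀ x : G.Point, G.val x ≠ 1) (hl : G.Loopless) {i : G.Aut} (hi : i ^ 2 = 1)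
    (hT : (G.quotient (Subgroup.zpowers i)).IsTree) :
    (∃ (T : LengthGraph.{u}) (φ : LengthGraph.Morphism G T),
      T.IsTree ∧ φ.IsHarmonic ∧ φ.IsNondegenerate ∧ φ.HasDegree 2) ∨ Fintype.card G.V = 2 := by
  classical
  have hi1 := ne_one_of_isTree hconn hval hl hT
  set K := Subgroup.zpowers i with hK
  by_cases hne : Nonempty (G.quotient K).E
  · left
    refine ⟨G.quotient K, quotientMorphism G K, hT, ?_, ?_, ?_, ?_⟩
    · intro x q q' hq hq'
      rw [mult_quotientMorphism hi hi1 hK x q hq, mult_quotientMorphism hi hi1 hK x q' hq']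
    · intro x
      obtain ⟨d, hd⟩ := Connected.exists_dart_tail (hE := hne) (isTree_iff.1 hT).1 (quotV K x)
      have hinc : (G.quotient K).Incident d.1 (quotV K x) := hd ▸ incident_tail d
      refine ⟨d.1, hinc, ?_⟩
      rw [mult_quotientMorphism hi hi1 hK x d.1 hinc]
      split_ifs <;> norm_num
    · intro q
      obtain ⟨e₀, rfl⟩ := quotE_surjective K q
      have h1 := sum_fibre hi hi1 hK e₀ fun _ => 1
      simp only [one_mul] at h1
      rw [h1]
      norm_num
    · exact fun h => absurd hne (not_nonempty_iff.2 h)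
  · right
    obtain ⟨e⟩ := hE
    have hcollapse : ∀ d : G.Dart, quotV K (G.tail d) = quotV K (G.head d) := by
      intro d
      by_contra h
      refine hne ⟨quotE K ⟨d.1, survives_iff.2 ?_⟩⟩
      rcases d with ⟨e, _ | _⟩
      · exact Ne.symm h
      · exact h
    have hall := hconn.forall_vertex (P := fun v => quotV K v = quotV K (G.src e))
      (fun d hd => (hcollapse d).symm.trans hd) (v₀ := G.src e) rfl
    have hsub : (Finset.univ : Finset G.V) ⊆ {G.src e, i • G.src e} := by
      intro v _
      obtain ⟨k, hk, rfl⟩ := quotV_eq_iff.1 (hall v)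
      rcases mem_zpowers_of_sq_eq_one hi hk with rfl | rfl
      · simp
      · simp
    have h1 := (Finset.card_le_card hsub).trans Finset.card_le_two
    have h2 : 1 < Fintype.card G.V := Fintype.one_lt_card_iff.2 ⟨_, _, hl e⟩
    rw [Finset.card_univ] at h1
    omega

/-! ### From a morphism to a moving divisor -/

lemma isHyperelliptic_of_card_eq_two (hconn : G.Connected) [Nonempty G.E]
    (hval : ∀ x : G.Point, G.val x ≠ 1) (hl : G.Loopless) (h : Fintype.card G.V = 2) :
    G.IsHyperelliptic := by
  classical
  obtain ⟨a, b, hab, huniv⟩ := Finset.card_eq_two.1 (Finset.card_univ.trans h)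
  have hmem : ∀ v, v = a ∨ v = b := fun v => by
    have : v ∈ (Finset.univ : Finset G.V) := Finset.mem_univ v
    rw [huniv] at this
    simpa using this
  refine isHyperelliptic_of_moves hconn hval
    (D := delta (Point.vertex a) + delta (Point.vertex b))
    (by rw [deg_add, deg_delta, deg_delta]; rfl) fun x => ?_
  rcases vertex_or_dpt x with ⟨v, rfl⟩ | ⟨d, s, hs, rfl⟩
  · refine ⟨_, add_nonneg (delta_nonneg _) (delta_nonneg _), LinEquiv.refl _, ?_⟩
    have h1 := delta_nonneg (Point.vertex a) (Point.vertex v)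
    have h2 := delta_nonneg (Point.vertex b) (Point.vertex v)
    simp only [Finsupp.coe_zero, Pi.zero_apply] at h1 h2
    rw [Finsupp.add_apply]
    rcases hmem v with rfl | rfl
    · rw [delta_self]
      omega
    · rw [delta_self]
      omega
  · obtain ⟨F, hF, hFe, hx⟩ := exists_effective_of_edge d hs
    refine ⟨F, hF, ?_, hx⟩
    have hne := hl.tail_ne_head d
    rcases hmem (G.tail d) with h1 | h1 <;> rcases hmem (G.head d) with h2 | h2
    · exact absurd (h1.trans h2.symm) hne
    · rwa [h1, h2] at hFe
    · rwa [h1, h2, add_comm] at hFe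
    · exact absurd (h1.trans h2.symm) hne

open Classical in
lemma sum_incident (hl : G.Loopless) {M : Type*} [AddCommMonoid M] (ψ : G.E → M) (v : G.V) :
    ∑ e ∈ Finset.univ.filter (fun e => G.Incident e v), ψ e =
      ∑ d ∈ Finset.univ.filter (fun d : G.Dart => G.tail d = v), ψ d.1 := by
  rw [sum_filter_tail, ← Finset.sum_union]
  · refine Finset.sum_congr ?_ fun _ _ => rfl
    ext e
    rw [Finset.mem_union, Finset.mem_filter, Finset.mem_filter, Finset.mem_filter]
    simp only [Finset.mem_univ, true_and, Incident]
  · rw [Finset.disjoint_filter]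
    exact fun e _ h h' => hl e (h.trans h'.symm)

/-- The fibres of a nondegenerate harmonic morphism of degree two to a tree, counted with
multiplicities, form a moving divisor of degree two. Moving the point of the tree along an edge
moves the fibre; on a contracted edge the two ends, which both have multiplicity one, move towards
each other. -/
lemma isHyperelliptic_of_morphism (hconn : G.Connected) [Nonempty G.E]
    (hval : ∀ x : G.Point, G.val x ≠ 1) (hl : G.Loopless) {T : LengthGraph.{u}}
    (φ : Morphism G T) (hT : T.IsTree) (hh : φ.IsHarmonic) (hn : φ.IsNondegenerate)
    (hd : φ.HasDegree 2) : G.IsHyperelliptic := by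
  classical
  have hTl : T.Loopless := hT.1
  -- the slopes and the multiplicities as integers
  have hμ : ∀ e, ∃ n : ℤ, ∀ e', φ.onE e = Sum.inr e' → T.len e' / G.len e = n ∧ 1 ≤ n := by
    intro e
    rcases he : φ.onE e with v' | e'
    · exact ⟨0, fun e' h => by cases h⟩
    · obtain ⟨n, hn⟩ := φ.integral e e' he
      refine ⟨n, fun e'' h => ?_⟩
      cases h
      refine ⟨hn, ?_⟩
      have h1 : 0 < T.len e' / G.len e := div_pos (T.len_pos _) (G.len_pos _)
      rw [hn] at h1
      exact_mod_cast h1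
  choose μ hμ using hμ
  have hmult : ∀ x e', φ.mult x e' = ((∑ d ∈ Finset.univ.filter (fun d : G.Dart => G.tail d = x),
      if φ.onE d.1 = Sum.inr e' then μ d.1 else 0 : ℤ) : ℝ) := by
    intro x e'
    rw [← sum_incident hl (fun e => if φ.onE e = Sum.inr e' then μ e else 0), Morphism.mult,
      ← Finset.filter_filter, Finset.sum_filter]
    push_cast
    refine Finset.sum_congr rfl fun e _ => ?_
    split_ifs with h
    · exact (hμ e e' h).1
    · rfl
  have hm : ∀ x, ∃ m : ℤ, 1 ≤ m ∧ ∀ e', T.Incident e' (φ.onV x) → φ.mult x e' = m := by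
    intro x
    obtain ⟨e', he', hpos⟩ := hn x
    refine ⟨_, ?_, fun e'' he'' => (hh x e'' e' he'' he').trans (hmult x e')⟩
    rw [hmult] at hpos
    exact_mod_cast hpos
  choose m hm1 hm using hm
  -- the fibres
  set P : T.V → G.Divisor := fun v' =>
    ∑ x ∈ Finset.univ.filter (fun x => φ.onV x = v'), m x • delta (Point.vertex x) with hP
  have hPv : ∀ v' u, P v' (Point.vertex u) = if φ.onV u = v' then m u else 0 := by
    intro v' u
    simp only [hP, Finsupp.finsetSum_apply, Finsupp.smul_apply, delta_apply, smul_eq_mul,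
      Point.vertex.injEq, mul_ite, mul_one, mul_zero]
    rw [Finset.sum_ite_eq']
    simp
  have hPi : ∀ v' (d : G.Dart) (s : ℝ), s ∈ Ioo 0 (G.len d.1) → P v' (G.dpt d s) = 0 := by
    intro v' d s hs
    simp only [hP, Finsupp.finsetSum_apply, Finsupp.smul_apply]
    exact Finset.sum_eq_zero fun x _ => by rw [delta_of_ne (dpt_ne_vertex hs x), smul_zero]
  have hP0 : ∀ v', 0 ≤ P v' := by
    intro v' x
    rcases vertex_or_dpt x with ⟨u, rfl⟩ | ⟨d, s, hs, rfl⟩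
    · rw [hPv]
      split_ifs
      · exact zero_le_one.trans (hm1 u)
      · exact le_rfl
    · rw [hPi v' d s hs]
      rfl
  have hjoin : ∀ (d : G.Dart) e', φ.onE d.1 = Sum.inr e' →
      T.Joins e' (φ.onV (G.tail d)) (φ.onV (G.head d)) := by
    rintro ⟨e, _ | _⟩ e' h
    · exact joins_symm (φ.horizontal e e' h)
    · exact φ.horizontal e e' h
  -- moving along an edge of the tree
  have hmove : ∀ d' : T.Dart, ∃ f : G.Point → ℝ, PL f ∧
      (∀ x, divZ f x = P (T.tail d') x - P (T.head d') x) ∧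
      ∀ (d : G.Dart) (s : ℝ), s ∈ Ico 0 (G.len d.1) → φ.onE d.1 = Sum.inr d'.1 →
        slope f (d, s) ≠ 0 := by
    intro d'
    obtain ⟨B, hB⟩ := IsBridge.exists_isCut (d := d') ((isTree_iff.1 hT).2 d'.1)
    set n : G.Dart → ℤ := fun d => if φ.onE d.1 = Sum.inr d'.1 then
      (if φ.onV (G.tail d) ∈ B then -μ d.1 else μ d.1) else 0 with hn
    set h : G.V → ℝ := fun v => if φ.onV v ∈ B then T.len d'.1 else 0 with hh
    have hs : IsSlope h n := by
      intro d
      have hL := (G.len_pos d.1).ne'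
      rcases he : φ.onE d.1 with v' | e'
      · have h1 : φ.onV (G.tail d) = φ.onV (G.head d) := by
          obtain ⟨h1, h2⟩ := φ.vertical d.1 v' he
          rcases d with ⟨e, _ | _⟩
          · exact h2.trans h1.symm
          · exact h1.trans h2.symm
        simp [hn, hh, he, h1]
      · obtain ⟨d₁, rfl, ht, hhd⟩ := joins_iff_exists_dart.1 (hjoin d e' he)
        by_cases h1 : d₁.1 = d'.1
        · have h2 : T.len d'.1 = μ d.1 * G.len d.1 := by
            rw [← (hμ d.1 _ he).1, div_mul_cancel₀ _ hL, h1]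
          have h3 : φ.onE d.1 = Sum.inr d'.1 := by rw [he, h1]
          rcases eq_or_eq_rev_of_fst_eq h1 with h4 | h4
          · rw [h4] at ht hhd
            simp only [hn, hh, ← ht, ← hhd, hB.1, hB.2.1, if_true, if_false, h3]
            rw [h2, sub_zero]
          · rw [h4, tail_rev] at ht
            rw [h4, head_rev] at hhd
            simp only [hn, hh, ← ht, ← hhd, hB.1, hB.2.1, if_true, if_false, h3]
            rw [h2]
            push_cast
            ring
        · have h2 := hB.2.2 d₁ h1
          rw [ht, hhd] at h2
          simp [hn, hh, he, h1, h2]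
    refine ⟨ofVertex h, hs.pl, fun x => ?_, fun d s hsI hd0 => ?_⟩
    · rcases vertex_or_dpt x with ⟨u, rfl⟩ | ⟨d, s, hs', rfl⟩
      · rw [hs.divZ_vertex, hPv, hPv]
        have h1 : ∑ d ∈ Finset.univ.filter (fun d : G.Dart => G.tail d = u), n d =
            (if φ.onV u ∈ B then -1 else 1) *
              ∑ d ∈ Finset.univ.filter (fun d : G.Dart => G.tail d = u),
                if φ.onE d.1 = Sum.inr d'.1 then μ d.1 else 0 := by
          rw [Finset.mul_sum]
          refine Finset.sum_congr rfl fun d hd => ?_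
          simp only [hn]
          rw [(Finset.mem_filter.1 hd).2]
          split_ifs <;> ring
        rw [h1]
        have hne := hTl.tail_ne_head d'
        by_cases hinc : T.Incident d'.1 (φ.onV u)
        · have h2 : (∑ d ∈ Finset.univ.filter (fun d : G.Dart => G.tail d = u),
              if φ.onE d.1 = Sum.inr d'.1 then μ d.1 else 0) = m u := by
            have h3 := hm u _ hinc
            rw [hmult] at h3
            exact_mod_cast h3
          rw [h2]
          rcases (incident_iff_of_joins (joins_dart d')).1 hinc with h3 | h3
          · rw [← h3, if_neg hB.1, if_pos rfl, if_neg hne]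
            ring
          · rw [← h3, if_pos hB.2.1, if_neg hne.symm, if_pos rfl]
            ring
        · have h2 : (∑ d ∈ Finset.univ.filter (fun d : G.Dart => G.tail d = u),
              if φ.onE d.1 = Sum.inr d'.1 then μ d.1 else 0) = 0 := by
            refine Finset.sum_eq_zero fun d hd => if_neg fun he => hinc ?_
            rw [← (Finset.mem_filter.1 hd).2]
            exact (incident_iff_of_joins (hjoin d _ he)).2 (Or.inl rfl)
          have h3 : ¬ φ.onV u = T.tail d' := fun h => hinc (h ▸ incident_tail d')
          have h4 : ¬ φ.onV u = T.head d' := fun h => hinc (by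
            rw [h, ← tail_rev]
            exact incident_tail (T.rev d'))
          rw [h2, if_neg h3, if_neg h4]
          ring
      · rw [hs.divZ_dpt hs', hPi _ d s hs', hPi _ d s hs', sub_self]
    · rw [(hs.hasSlope hsI).slope_eq]
      have := (hμ d.1 _ hd0).2
      simp only [hn]
      rw [if_pos hd0]
      split_ifs <;> omega
  obtain ⟨x₀⟩ := hconn.nonempty
  have hPe : ∀ v', LinEquiv (P v') (P (φ.onV x₀)) := by
    refine (isTree_iff.1 hT).1.forall_vertex (P := fun v' => LinEquiv (P v') (P (φ.onV x₀)))
      (fun d' h => ?_) (v₀ := φ.onV x₀) (LinEquiv.refl _)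
    obtain ⟨f, hf, hfd, -⟩ := hmove d'
    exact (LinEquiv.symm ⟨f, hf, hfd⟩).trans h
  have hdeg : Divisor.deg (P (φ.onV x₀)) = 2 := by
    obtain ⟨e', he', -⟩ := hn x₀
    set v' := φ.onV x₀ with hv'
    have hdegsum : Divisor.deg (P v') = ∑ x ∈ Finset.univ.filter (fun x => φ.onV x = v'), m x := by
      simp only [hP]
      rw [show Divisor.deg (G := G) = ⇑(AddMonoidHom.mk' Divisor.deg deg_add) from rfl, map_sum]
      refine Finset.sum_congr rfl fun x _ => ?_
      rw [map_zsmul]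
      change m x • Divisor.deg (delta (Point.vertex x)) = m x
      rw [deg_delta, smul_eq_mul, mul_one]
    have h1 : ((∑ x ∈ Finset.univ.filter (fun x => φ.onV x = v'), m x : ℤ) : ℝ) = (2 : ℕ) := by
      rw [← hd.1 e']
      push_cast
      have h2 : ∀ x ∈ Finset.univ.filter (fun x => φ.onV x = v'), (m x : ℝ) =
          ∑ e ∈ Finset.univ.filter (fun e => φ.onE e = Sum.inr e'),
            if G.Incident e x then T.len e' / G.len e else 0 := by
        intro x hx
        rw [← hm x e' ((Finset.mem_filter.1 hx).2 ▸ he'), Morphism.mult, ← Finset.filter_filter,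
          Finset.filter_comm, Finset.sum_filter]
      rw [Finset.sum_congr rfl h2, Finset.sum_comm]
      refine Finset.sum_congr rfl fun e he => ?_
      -- exactly one end of `e` lies over `v'`
      have hj := φ.horizontal e e' (Finset.mem_filter.1 he).2
      have hne : φ.onV (G.src e) ≠ φ.onV (G.tgt e) := by
        rcases Sym2.eq_iff.1 hj with ⟨h3, h4⟩ | ⟨h3, h4⟩
        · rw [← h3, ← h4]
          exact hTl e'
        · rw [← h3, ← h4]
          exact (hTl e').symm
      rw [← Finset.sum_filter, Finset.filter_filter]
      have h3 : ∃ y, Finset.univ.filter (fun x => φ.onV x = v' ∧ G.Incident e x) = {y} := by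
        rcases (incident_iff_of_joins hj).1 he' with h4 | h4
        · refine ⟨G.src e, ?_⟩
          ext x
          simp only [Finset.mem_filter, Finset.mem_univ, true_and, Finset.mem_singleton]
          constructor
          · rintro ⟨h5, h6 | h6⟩
            · exact h6.symm
            · rw [← h6] at h5
              exact absurd (h4.trans h5.symm) hne
          · rintro rfl
            exact ⟨h4, Or.inl rfl⟩
        · refine ⟨G.tgt e, ?_⟩
          ext x
          simp only [Finset.mem_filter, Finset.mem_univ, true_and, Finset.mem_singleton]
          constructor
          · rintro ⟨h5, h6 | h6⟩
            · rw [← h6] at h5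
              exact absurd (h5.trans h4.symm) hne
            · exact h6.symm
          · rintro rfl
            exact ⟨h4, Or.inr rfl⟩
      obtain ⟨y, hy⟩ := h3
      rw [hy, Finset.sum_singleton]
    rw [hdegsum]
    exact_mod_cast h1
  refine isHyperelliptic_of_moves hconn hval hdeg fun x => ?_
  rcases vertex_or_dpt x with ⟨u, rfl⟩ | ⟨d, s, hs, rfl⟩
  · refine ⟨P (φ.onV u), hP0 _, hPe _, ?_⟩
    rw [hPv, if_pos rfl]
    exact hm1 u
  · rcases he : φ.onE d.1 with v' | e'
    · -- a contracted edge
      have h1 : φ.onV (G.tail d) = v' ∧ φ.onV (G.head d) = v' := by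
        obtain ⟨h1, h2⟩ := φ.vertical d.1 v' he
        rcases d with ⟨e, _ | _⟩
        · exact ⟨h2, h1⟩
        · exact ⟨h1, h2⟩
      obtain ⟨F₀, hF₀, hF₀e⟩ := two_le_of_ne (hP0 v')
        (x := Point.vertex (G.tail d)) (y := Point.vertex (G.head d))
        (fun h => hl.tail_ne_head d (Point.vertex.inj h))
        (by rw [hPv, if_pos h1.1]; exact hm1 _) (by rw [hPv, if_pos h1.2]; exact hm1 _)
      obtain ⟨F, hF, hFe, hx⟩ := exists_effective_of_edge d hs
      refine ⟨F₀ + F, add_nonneg hF₀ hF, ?_, ?_⟩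
      · refine LinEquiv.trans ?_ (hPe v')
        rw [hF₀e, add_assoc]
        exact (LinEquiv.refl F₀).add hFe
      · have := hF₀ (G.dpt d s)
        simp only [Finsupp.coe_zero, Pi.zero_apply] at this
        rw [Finsupp.add_apply]
        omega
    · obtain ⟨f, hf, hfd, hfs⟩ := hmove (e', true)
      obtain ⟨F, hF, hFe, hx⟩ := hf.exists_effective_of_slope_ne_zero (hP0 _) (hP0 _) hfd
        (mem_dirs_dpt ⟨hs.1.le, hs.2⟩) (hfs d s ⟨hs.1.le, hs.2⟩ he)
      exact ⟨F, hF, hFe.trans (hPe _), hx⟩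

end LengthGraph

theorem theoremt (G : LengthGraph.{u}) (hconn : G.Connected) (hG : G.IsCanonicalLoopless)
    (hpoint : Nonempty G.E) (hval : ∀ x : G.Point, G.val x ≠ 1) :
    List.TFAE
      [G.IsHyperelliptic,
       ∃ i : G.Aut, i ^ 2 = 1 ∧ (G.quotient (Subgroup.zpowers i)).IsTree,
       (∃ (T : LengthGraph.{u}) (φ : LengthGraph.Morphism G T),
          T.IsTree ∧ φ.IsHarmonic ∧ φ.IsNondegenerate ∧ φ.HasDegree 2) ∨
        Fintype.card G.V = 2] := by
  tfae_have 1 → 2 := fun h => by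
    obtain ⟨D, hD⟩ := h.exists_moves
    exact LengthGraph.exists_aut_of_moves hconn hval hG hD
  tfae_have 2 → 3 := fun ⟨i, hi, hT⟩ =>
    LengthGraph.exists_morphism_of_aut hconn hval hG.loopless hi hT
  tfae_have 3 → 1 := by
    rintro (⟨T, φ, hT, hh, hn, hd⟩ | h)
    · exact LengthGraph.isHyperelliptic_of_morphism hconn hval hG.loopless φ hT hh hn hd
    · exact LengthGraph.isHyperelliptic_of_card_eq_two hconn hval hG.loopless h
  tfae_finish
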